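/- Let $\Sigma=\mathbb F_2$, let $\Sigma^*$ be the binary rooted tree of finite words over $\Sigma$, write $\overline x=1-x$, and let $a,\tilde b,\tilde c,\tilde d$ be the automorphisms of $\Sigma^*$ given by $$a(x\sigma)=\overline x\sigma,\quad \tilde b(0x\sigma)=0\overline x\sigma,\ \tilde b(1\sigma)=1\tilde c(\sigma),\quad \tilde c(0\sigma)=0\sigma,\ \tilde c(1\sigma)=1\tilde d(\sigma),\quad \tilde d(0\sigma)=0\sigma,\ \tilde d(1\sigma)=1\tilde b(\sigma)$$ (the empty word and the word $0$ are fixed by $\tilde b,\tilde c,\tilde d$). Let $\tilde G=\langle a,\tilde b,\tilde c,\tilde d\rangle$, acting on the left. With $[g,h]=ghg^{-1}h^{-1}$, put $x=[a,\tilde b]$, $y=[a,\tilde d]$, let $\tilde K$ be the normal closure of $\{x,y\}$ in $\tilde G$ and $\tilde T$ the normal closure of $x^2$ in $\tilde G$. For a subgroup $Q$ of $\tilde K$ let $Q_m=Q\times\dots\times Q$ ($2^m$ copies), one copy acting on the subtree below each vertex of level $m$ (with $Q_0=Q$). For $m\ge1$ put $\tilde N_m=\tilde K_m\cdot\tilde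 T_{m-1}$. For $n\ge 0$ let $V_n=\mathbb F_2[X_1,\dots,X_n]/(X_1^2-1,\dots,X_n^2-1)$, where the monomial $X_1^{\sigma_1}\cdots X_n^{\sigma_n}$ corresponds to the vertex $\sigma_1\dots\sigma_n$ of level $n$. For $0\le r<2^n$ with binary expansion $r=r_n\dots r_1$ (that is, $r=\sum_i r_i2^{i-1}$) let $v_n^r=(1-X_1)^{r_1}\cdots(1-X_n)^{r_n}$; let $V_n^r$ be the $\mathbb F_2$-span of $v_n^r,v_n^{r+1},\dots,v_n^{2^n-1}$, and $V_n^r=0$ for $r\ge2^n$. For $m\ge1$ one has $\tilde N_{m+1}\le\tilde N_m$, and there is a unique group isomorphism $$\alpha\oplus\beta\oplus\gamma:\tilde N_m/\tilde N_{m+1}\to V_m\oplus V_m\oplus V_{m-1}$$ that sends the class of $(1,\dots,x,\dots,1)\in\tilde K_m$ to the monomial, in the first summand, of the vertex of level $m$ in $x$'s position, the class of $(1,\dots,y,\dots,1)\in\tilde K_m$ to the corresponding monomial in the second summand, and the class of $(1,\dots,x^2,\dots,1)\in\tilde T_{m-1}$ to the monomial, in the third summand, of the corresponding vertex of level $m-1$.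 For subspaces $A,B\le V_m$ and $C\le V_{m-1}$ write $\tilde N_{m+1}\alpha^{-1}(A)\beta^{-1}(B)\gamma^{-1}(C)$ for the preimage in $\tilde N_m$ of $A\oplus B\oplus C$ under this isomorphism. Let $\tilde G_n=\{g\in\tilde G: g-1\in\Delta^n\}$, where $\Delta$ is the augmentation ideal of $\mathbb F_2[\tilde G]$, be the $2$-dimension series of $\tilde G$, and let $\operatorname{rank}(\tilde G_i/\tilde G_{i+1})=\dim_{\mathbb F_2}\big((\tilde G_i/\tilde G_{i+1})\otimes_{\mathbb Z}\mathbb F_2\big)$. Theorem. 1. For all $m\ge1$, $\tilde G_{2^m+1}=\tilde N_m$. 2. For all $m\ge1$ and $0\le r\le2^m$, $$\tilde G_{2^m+1+r}=\begin{cases}\tilde N_{m+1}\,\alpha^{-1}(V_m^r)\,\beta^{-1}(V_m^r)\,\gamma^{-1}(V_{m-1}^{r/2})&\text{if } r \text{ is even},\\ \tilde N_{m+1}\,\alpha^{-1}(V_m^r)\,\beta^{-1}(V_m^r)\,\gamma^{-1}(V_{m-1}^{(r-1)/2})&\text{if } r\text{ is odd}.\end{cases}$$ 3. For all $i\ge1$,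 $$\operatorname{rank}(\tilde G_i/\tilde G_{i+1})=\begin{cases}4&\text{if } i=1,\\3&\text{if } i>1\text{ is even},\\2&\text{if } i>1\text{ is odd}.\end{cases}$$ -/

import Mathlib

open scoped TensorProduct

noncomputable section

/-! ### Dimension subgroups -/

section Dimension

variable (k : Type*) [Field k] (G : Type*) [Group G]

/-- The augmentation map `k[G] → k`, `∑ kᵢ gᵢ ↦ ∑ kᵢ`. -/
def augmentation : MonoidAlgebra k G →ₐ[k] k := MonoidAlgebra.lift k k G 1

/-- The augmentation ideal `Δ` of `k[G]`. -/
def augmentationIdeal : Ideal (MonoidAlgebra k G) :=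
  RingHom.ker (augmentation k G : MonoidAlgebra k G →+* k)

instance augmentationIdeal_isTwoSided : (augmentationIdeal k G).IsTwoSided := by
  unfold augmentationIdeal; infer_instance

/-- The dimension subgroup `G_n = {g ∈ G | g - 1 ∈ Δ ^ n}` over the field `k`. -/
def dimensionSubgroup (n : ℕ) : Subgroup G where
  carrier := {g | MonoidAlgebra.of k G g - 1 ∈ augmentationIdeal k G ^ n}
  one_mem' := by
    change MonoidAlgebra.of k G 1 - 1 ∈ augmentationIdeal k G ^ n
    rw [map_one, sub_self]
    exact zero_mem _
  mul_mem' := by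
    intro g h hg hh
    have e : MonoidAlgebra.of k G (g * h) - 1 = MonoidAlgebra.of k G g *
        (MonoidAlgebra.of k G h - 1) + (MonoidAlgebra.of k G g - 1) := by
      rw [map_mul]; noncomm_ring
    change MonoidAlgebra.of k G (g * h) - 1 ∈ augmentationIdeal k G ^ n
    rw [e]
    exact add_mem (Ideal.mul_mem_left _ _ hh) hg
  inv_mem' := by
    intro g hg
    have e : MonoidAlgebra.of k G g⁻¹ - 1 = -(MonoidAlgebra.of k G g⁻¹) *
        (MonoidAlgebra.of k G g - 1) := by
      have : MonoidAlgebra.of k G g⁻¹ * MonoidAlgebra.of k G g = 1 := by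
        rw [← map_mul]; rw [inv_mul_cancel, map_one]
      rw [mul_sub, neg_mul, this]; noncomm_ring
    change MonoidAlgebra.of k G g⁻¹ - 1 ∈ augmentationIdeal k G ^ n
    rw [e]
    exact Ideal.mul_mem_left _ _ hg

variable {k G} in
theorem mem_dimensionSubgroup {n : ℕ} {g : G} : g ∈ dimensionSubgroup k G n ↔
    MonoidAlgebra.of k G g - 1 ∈ augmentationIdeal k G ^ n := Iff.rfl

instance dimensionSubgroup_normal (n : ℕ) : (dimensionSubgroup k G n).Normal where
  conj_mem := by
    intro g hg h
    rw [mem_dimensionSubgroup] at *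
    have e : MonoidAlgebra.of k G (h * g * h⁻¹) - 1 = MonoidAlgebra.of k G h *
        (MonoidAlgebra.of k G g - 1) * MonoidAlgebra.of k G h⁻¹ := by
      have : MonoidAlgebra.of k G h * MonoidAlgebra.of k G h⁻¹ = 1 := by
        rw [← map_mul]; rw [mul_inv_cancel, map_one]
      rw [map_mul, map_mul, mul_sub, sub_mul, mul_one, this]
    rw [e]
    exact Ideal.mul_mem_right _ _ (Ideal.mul_mem_left _ _ hg)

/-- The factor `G_n / G_{n+1}` of the dimension series. -/
abbrev DimensionFactor (n : ℕ) : Type _ :=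
  dimensionSubgroup k G n ⧸ (dimensionSubgroup k G (n + 1)).subgroupOf (dimensionSubgroup k G n)

/-- The factors of the dimension series are abelian. -/
instance DimensionFactor.commGroup (n : ℕ) : CommGroup (DimensionFactor k G n) :=
  { (inferInstance : Group (DimensionFactor k G n)) with
    mul_comm := by
      intro x y
      induction x using QuotientGroup.induction_on with | _ g => ?_
      induction y using QuotientGroup.induction_on with | _ h => ?_
      obtain ⟨g, hg⟩ := g
      obtain ⟨h, hh⟩ := h
      refine QuotientGroup.eq.2 ?_
      rw [Subgroup.mem_subgroupOf, mem_dimensionSubgroup]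
      have e : MonoidAlgebra.of k G ((g * h)⁻¹ * (h * g)) - 1 = MonoidAlgebra.of k G (g * h)⁻¹ *
          ((MonoidAlgebra.of k G h - 1) * (MonoidAlgebra.of k G g - 1) -
            (MonoidAlgebra.of k G g - 1) * (MonoidAlgebra.of k G h - 1)) := by
        have e1 : (MonoidAlgebra.of k G h - 1) * (MonoidAlgebra.of k G g - 1) -
            (MonoidAlgebra.of k G g - 1) * (MonoidAlgebra.of k G h - 1) =
            MonoidAlgebra.of k G (h * g) - MonoidAlgebra.of k G (g * h) := by
          rw [map_mul, map_mul]; noncomm_ring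
        rw [e1, mul_sub, ← map_mul, ← map_mul, inv_mul_cancel, map_one]
      change MonoidAlgebra.of k G ((g * h)⁻¹ * (h * g)) - 1 ∈ _
      rw [e]
      refine Ideal.mul_mem_left _ _ ?_
      rw [mem_dimensionSubgroup] at hg hh
      rcases Nat.eq_zero_or_pos n with rfl | hn
      · have hΔ : ∀ u : G, MonoidAlgebra.of k G u - 1 ∈ augmentationIdeal k G := by
          intro u
          simp [augmentationIdeal, augmentation, RingHom.mem_ker]
        rw [zero_add, Submodule.pow_one]
        exact sub_mem (Ideal.mul_mem_left _ _ (hΔ g)) (Ideal.mul_mem_left _ _ (hΔ h))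
      · have hle : augmentationIdeal k G ^ n * augmentationIdeal k G ^ n ≤
            augmentationIdeal k G ^ (n + 1) := by
          rw [← Ideal.IsTwoSided.pow_add]
          exact Ideal.pow_le_pow_right (by omega)
        exact sub_mem (hle (Ideal.mul_mem_mul hh hg)) (hle (Ideal.mul_mem_mul hg hh)) }

/-- The rank of `G_n / G_{n+1}`, i.e. `dim_k (G_n / G_{n+1} ⊗ k)`. -/
def dimensionRank (n : ℕ) : ℕ :=
  Module.finrank k (k ⊗[ℤ] Additive (DimensionFactor k G n))

end Dimension

namespace Overgroup

/-! ### The binary rooted tree and the group -/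

/-- The vertices of the binary rooted tree: finite words over the alphabet `𝔽₂`. -/
abbrev Word : Type := List (ZMod 2)

/-- `a (x σ) = x̄ σ`, where `x̄ = x + 1`. -/
def aFun : Word → Word
  | [] => []
  | x :: w => (x + 1) :: w

/-- Labels of the three directed generators `b̃`, `c̃`, `d̃`. -/
inductive Label
  | b
  | c
  | d

/-- The cyclic order `b̃ → c̃ → d̃ → b̃` in which the generators recur along the ray `111…`. -/
def Label.next : Label → Label
  | .b => .c
  | .c => .d
  | .d => .b

/-- The action of a directed generator on the words below the vertex `0`. -/
def Label.side : Label → Word → Word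
  | .b => aFun
  | .c => id
  | .d => id

/-- The action of the directed generators: below `0` the generator `b̃` acts as `a` and the
generators `c̃`, `d̃` act trivially, and below `1` each generator acts as the next one. -/
def Label.act : Label → Word → Word
  | _, [] => []
  | l, x :: w => if x = 0 then 0 :: l.side w else 1 :: l.next.act w

theorem act_b_zero (x : ZMod 2) (w : Word) :
    Label.b.act (0 :: x :: w) = 0 :: (x + 1) :: w := rfl
theorem act_b_one (w : Word) : Label.b.act (1 :: w) = 1 :: Label.c.act w := rfl
theorem act_c_zero (w : Word) : Label.c.act (0 :: w) = 0 :: w := rfl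
theorem act_c_one (w : Word) : Label.c.act (1 :: w) = 1 :: Label.d.act w := rfl
theorem act_d_zero (w : Word) : Label.d.act (0 :: w) = 0 :: w := rfl
theorem act_d_one (w : Word) : Label.d.act (1 :: w) = 1 :: Label.b.act w := rfl

theorem aFun_involutive : Function.Involutive aFun
  | [] => rfl
  | x :: w => by
    have : x + 1 + 1 = x := by revert x; decide
    simp [aFun, this]

theorem side_involutive (l : Label) : Function.Involutive l.side := by
  cases l
  · exact aFun_involutive
  · exact fun _ => rfl
  · exact fun _ => rfl

theorem act_involutive (l : Label) : Function.Involutive l.act := by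
  intro w
  induction w generalizing l with
  | nil => rfl
  | cons x w ih =>
    by_cases hx : x = 0
    · simp [Label.act, hx, side_involutive l w]
    · have h1 : x = 1 := by revert x; decide
      simp [Label.act, h1, ih]

def a : Equiv.Perm Word := aFun_involutive.toPerm
def bt : Equiv.Perm Word := (act_involutive .b).toPerm
def ct : Equiv.Perm Word := (act_involutive .c).toPerm
def dt : Equiv.Perm Word := (act_involutive .d).toPerm

/-- The overgroup `G̃ = ⟨a, b̃, c̃, d̃⟩`, acting on the left on the tree. -/
def Gt : Subgroup (Equiv.Perm Word) := Subgroup.closure {a, bt, ct, dt}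

/-! ### Subgroups of `G̃` -/

/-- `x = [a, b̃]`, where `[g, h] = g * h * g⁻¹ * h⁻¹`. -/
def x : Equiv.Perm Word := a * bt * a⁻¹ * bt⁻¹
/-- `y = [a, d̃]`. -/
def y : Equiv.Perm Word := a * dt * a⁻¹ * dt⁻¹

/-- The normal closure in `G̃` of a set of elements, i.e. the subgroup generated by all
the conjugates `g * s * g⁻¹` with `s ∈ S` and `g ∈ G̃`. -/
def normalClosureGt (S : Set (Equiv.Perm Word)) : Subgroup (Equiv.Perm Word) :=
  Subgroup.closure {u | ∃ g ∈ Gt, ∃ s ∈ S, u = g * s * g⁻¹}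

/-- `K̃ = ⟨x, y⟩^G̃`. -/
def Kt : Subgroup (Equiv.Perm Word) := normalClosureGt {x, y}

/-- `T̃ = ⟨x²⟩^G̃`. -/
def Tt : Subgroup (Equiv.Perm Word) := normalClosureGt {x ^ 2}

/-- The underlying function of `(g₀, g₁)`. -/
def pairFun (g : (Word → Word) × (Word → Word)) : Word → Word
  | [] => []
  | s :: w => if s = 0 then 0 :: g.1 w else 1 :: g.2 w

theorem pairFun_comp (g h : (Word → Word) × (Word → Word)) (w : Word) :
    pairFun g (pairFun h w) = pairFun (g.1 ∘ h.1, g.2 ∘ h.2) w := by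
  cases w with
  | nil => rfl
  | cons s w => by_cases hs : s = 0 <;> simp [pairFun, hs]

theorem pairFun_id (w : Word) : pairFun (id, id) w = w := by
  cases w with
  | nil => rfl
  | cons s w =>
    by_cases hs : s = 0
    · simp [pairFun, hs]
    · have h1 : s = 1 := by revert s; decide
      simp [pairFun, h1]

/-- The homomorphism that sends a pair `(g₀, g₁)` to the permutation which fixes the root, acts
as `g₀` on the subtree below `0` and as `g₁` on the subtree below `1`. -/
def pair : Equiv.Perm Word × Equiv.Perm Word →* Equiv.Perm Word where
  toFun g :=
    { toFun := pairFun (g.1, g.2)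
      invFun := pairFun (g.1.symm, g.2.symm)
      left_inv := fun w => by
        rw [pairFun_comp]; simpa using pairFun_id w
      right_inv := fun w => by
        rw [pairFun_comp]; simpa using pairFun_id w }
  map_one' := Equiv.ext pairFun_id
  map_mul' g h := Equiv.ext fun w => (pairFun_comp (g.1, g.2) (h.1, h.2) w).symm

/-- `Q_m = Q × ⋯ × Q` (`2 ^ m` copies), one copy acting below each vertex of level `m`. -/
def power (Q : Subgroup (Equiv.Perm Word)) : ℕ → Subgroup (Equiv.Perm Word)
  | 0 => Q
  | m + 1 => ((power Q m).prod (power Q m)).map pair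

/-- `(1, …, g, …, 1)`, with `g` in the position of the vertex `σ`. -/
def atVertex (g : Equiv.Perm Word) : Word → Equiv.Perm Word
  | [] => g
  | s :: w => if s = 0 then pair (atVertex g w, 1) else pair (1, atVertex g w)

/-- `Ñ_m = K̃_m · T̃_{m-1}`, for `m ≥ 1`. -/
def Nt (m : ℕ) : Subgroup (Equiv.Perm Word) := power Kt m ⊔ power Tt (m - 1)

/-! ### The modules `V_n` -/

/-- `V_n = 𝔽₂[X₁, …, X_n] / (X₁² - 1, …, X_n² - 1)`, realized as the group algebra over `𝔽₂` of
`𝔽₂ ^ n`: the monomial `X₁^σ₁ ⋯ X_n^σ_n` is the basis vector of `σ = σ₁ … σ_n`. -/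
abbrev V (n : ℕ) : Type := AddMonoidAlgebra (ZMod 2) (Fin n → ZMod 2)

/-- The monomial `X₁^σ₁ ⋯ X_n^σ_n` of the vertex `σ₁ … σ_n`. -/
def monomial {n : ℕ} (σ : Fin n → ZMod 2) : V n := AddMonoidAlgebra.single σ 1

/-- The variable `X_{i+1}`. -/
def X {n : ℕ} (i : Fin n) : V n := monomial (Pi.single i 1)

/-- `v_n^r = (1 - X₁)^r₁ ⋯ (1 - X_n)^r_n`, where `r = r_n … r₁` in base `2`. -/
def v (n r : ℕ) : V n := ∏ i : Fin n, (1 - X i) ^ (r / 2 ^ (i : ℕ) % 2)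

/-- `V_n^r`, the span of `v_n^r, …, v_n^{2^n-1}`; it is `0` for `r ≥ 2 ^ n`. -/
def Vsub (n r : ℕ) : Submodule (ZMod 2) (V n) :=
  Submodule.span (ZMod 2) {u | ∃ j, r ≤ j ∧ j < 2 ^ n ∧ u = v n j}

/-! ### The isomorphism `α ⊕ β ⊕ γ` -/

/-- `φ` induces the isomorphism `α ⊕ β ⊕ γ : Ñ_m / Ñ_{m+1} → V_m ⊕ V_m ⊕ V_{m-1}`: it is onto with
kernel `Ñ_{m+1}`, and it maps `(1, …, x, …, 1) ∈ K̃_m`, `(1, …, y, …, 1) ∈ K̃_m` and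
`(1, …, x², …, 1) ∈ T̃_{m-1}` to the corresponding monomials in the first, second and third
summand. -/
structure IsLayerIso (m : ℕ) (φ : Nt m →* Multiplicative (V m × V m × V (m - 1))) : Prop where
  surjective : Function.Surjective φ
  ker_eq : φ.ker.map (Nt m).subtype = Nt (m + 1)
  map_x : ∀ σ : Fin m → ZMod 2, ∃ h : atVertex x (List.ofFn σ) ∈ Nt m,
    φ ⟨atVertex x (List.ofFn σ), h⟩ = Multiplicative.ofAdd (monomial σ, 0, 0)
  map_y : ∀ σ : Fin m → ZMod 2, ∃ h : atVertex y (List.ofFn σ) ∈ Nt m,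
    φ ⟨atVertex y (List.ofFn σ), h⟩ = Multiplicative.ofAdd (0, monomial σ, 0)
  map_x_sq : ∀ σ : Fin (m - 1) → ZMod 2, ∃ h : atVertex (x ^ 2) (List.ofFn σ) ∈ Nt m,
    φ ⟨atVertex (x ^ 2) (List.ofFn σ), h⟩ = Multiplicative.ofAdd (0, 0, monomial σ)

/-- `Ñ_{m+1} α⁻¹(A) β⁻¹(B) γ⁻¹(C)`, the preimage of `A ⊕ B ⊕ C` under
`Ñ_m → V_m ⊕ V_m ⊕ V_{m-1}`. -/
def layerPreimage {m : ℕ} (φ : Nt m →* Multiplicative (V m × V m × V (m - 1)))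
    (A B : Submodule (ZMod 2) (V m)) (C : Submodule (ZMod 2) (V (m - 1))) :
    Subgroup (Equiv.Perm Word) :=
  ((AddSubgroup.toSubgroup (A.prod (B.prod C)).toAddSubgroup).comap φ).map (Nt m).subtype

/-- The term `G̃_n` of the `2`-dimension series of `G̃`. -/
def dimGt (n : ℕ) : Subgroup (Equiv.Perm Word) :=
  (dimensionSubgroup (ZMod 2) Gt n).map Gt.subtype

end Overgroup

end

/-! The proof writes down an explicit descending series and checks the recursion that characterizes
the `2`-dimension series (Jennings, Lazard): the `n`-th term comes from commutators of the whole
group with the previous term and from squares of elements of weight `j` with `j < n ≤ 2j`.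

Abstract half. `IsRestrictedSeries` asks for this recursion with squares only of finitely many
generators of each factor. The rules `[E i, E j] ≤ E (i + j)` and `u² ∈ E (2n)` for `u ∈ E n`
follow, and `IsRestrictedSeries.dimensionSubgroup_eq` identifies the series. That the dimension
subgroups contain it is a computation with `g - 1` in the group algebra. For the converse, `E 1` is
built up from `E n` by adjoining one generator `g`, of weight `w`, at a time: over `H = H' ∪ gH'` an
element of weight `n` has the form `u + (g - 1)v` with `u`, `v` over `H'` of weights `n` and `n -
w`, and comparing coefficients on the two cosets shows that `b - 1` has weight `n` only if `b ∈ E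
n`.

Concrete half. The series starts `G̃ > M̃ > Ñ₁`, where `M̃` is the normal closure of `x`, `y` and `z
= [a, c̃]`. The parities `chi 0`, `chi 1`, `chi 2` of a section are characters of `M̃`, invariant
under `G̃`, dual to `x`, `y`, `z`, with common kernel `Ñ₁` (`mem_Nt_one_of_chi`). Since `x² = (z,
z)`, the group `Ñ₁` consists of pairs in `M̃ × M̃` with equal `chi 2`; recording `chi 0` and `chi 1`
of both sections and this common value gives `α`, `β`, `γ` for `m = 1`. As `Ñ_{m+1} = (Ñ₁)_m`,
recording them at all vertices of a level gives `layer`, with kernel the next `Ñ`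
(`layer_eq_zero_iff`), and conjugation becomes the permutation action on functions on that level.

This action is uniserial along the basis `v_n^r`: the operators `s - 1`, for generators `s`, send
the `r`-th term of the filtration into the next one and together fill it (`actU_sub_mem`,
`Usub_succ_le`). So commutation moves `α` and `β` by exactly one step. The component `γ` is supplied
by squares: `x` spread along `v^j` on level `m - 1` has weight `2^(m-1) + 1 + j`, and its square, of
weight `2^m + 2 + 2j`, is `v^j` in `γ`. Hence `γ` moves at half speed, which explains `r/2` and the
alternation of the ranks. A new layer is entered through `(x, …, x)`, the last generator before it:
its commutator with a suitable directed generator is a single copy of `x⁻¹`, or of `y⁻¹` up to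
squares (`exists_comm_xAll_eq_x`, `exists_comm_xAll_eq_y`). -/

open scoped commutatorElement

/-! ### Restricted series: commutator and squaring rules from the recursion -/

section Series

variable {G : Type*} [Group G]

/-- If `g` normalizes `H` and `g ^ 2 ∈ H` then `⟨H, g⟩ = H ∪ g H`. -/
theorem Subgroup.mem_or_inv_mul_mem_of_mem_sup_closure_singleton {H : Subgroup G} {g : G}
    (hconj : ∀ h ∈ H, g * h * g⁻¹ ∈ H) (hsq : g * g ∈ H) {u : G}
    (hu : u ∈ H ⊔ Subgroup.closure {g}) : u ∈ H ∨ g⁻¹ * u ∈ H := by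
  have hconj' : ∀ h ∈ H, g⁻¹ * h * g ∈ H := by
    intro h hh
    have e : g⁻¹ * h * g = (g * g)⁻¹ * (g * h * g⁻¹) * (g * g) := by group
    rw [e]
    exact H.mul_mem (H.mul_mem (H.inv_mem hsq) (hconj h hh)) hsq
  let K : Subgroup G :=
    { carrier := {h | h ∈ H ∨ g⁻¹ * h ∈ H}
      one_mem' := Or.inl H.one_mem
      mul_mem' := by
        rintro p q (hp | hp) (hq | hq)
        · exact Or.inl (H.mul_mem hp hq)
        · right
          have e : g⁻¹ * (p * q) = (g⁻¹ * p * g) * (g⁻¹ * q) := by group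
          rw [e]
          exact H.mul_mem (hconj' p hp) hq
        · right
          rw [← mul_assoc]
          exact H.mul_mem hp hq
        · left
          have e : p * q = (g * (g⁻¹ * p) * g⁻¹) * (g * g) * (g⁻¹ * q) := by group
          rw [e]
          exact H.mul_mem (H.mul_mem (hconj _ hp) hsq) hq
      inv_mem' := by
        rintro p (hp | hp)
        · exact Or.inl (H.inv_mem hp)
        · right
          have e : g⁻¹ * p⁻¹ = (g⁻¹ * (g⁻¹ * p) * g)⁻¹ * (g * g)⁻¹ := by group
          rw [e]
          exact H.mul_mem (H.inv_mem (hconj' _ hp)) (H.inv_mem hsq) }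
  have hle : H ⊔ Subgroup.closure {g} ≤ K := by
    refine sup_le (fun h hh => Or.inl hh) ((Subgroup.closure_le _).2 ?_)
    rintro _ rfl
    exact Or.inr (by simp [H.one_mem])
  exact hle hu

/-- The three subgroups lemma modulo a normal subgroup. -/
theorem Subgroup.commutator_commutator_le_of_rotate {A B C N : Subgroup G} [N.Normal]
    (h1 : ⁅⁅B, C⁆, A⁆ ≤ N) (h2 : ⁅⁅C, A⁆, B⁆ ≤ N) : ⁅⁅A, B⁆, C⁆ ≤ N := by
  rw [← QuotientGroup.ker_mk' N, ← Subgroup.map_eq_bot_iff, Subgroup.map_commutator,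
    Subgroup.map_commutator] at *
  exact Subgroup.commutator_commutator_eq_bot_of_rotate h1 h2

/-- The elements that commute with `B` modulo `N`. -/
def centralizerMod (B N : Subgroup G) [N.Normal] : Subgroup G :=
  (Subgroup.centralizer ((B.map (QuotientGroup.mk' N) : Subgroup (G ⧸ N)) : Set (G ⧸ N))).comap
    (QuotientGroup.mk' N)

/-- Reduces a commutator inclusion to generators of `A`, since the elements commuting with `B`
modulo `N` form a subgroup. -/
theorem le_centralizerMod {A B N : Subgroup G} [N.Normal] :
    A ≤ centralizerMod B N ↔ ⁅A, B⁆ ≤ N := by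
  rw [centralizerMod, ← Subgroup.map_le_iff_le_comap,
    ← Subgroup.commutator_eq_bot_iff_le_centralizer, ← Subgroup.map_commutator,
    Subgroup.map_eq_bot_iff, QuotientGroup.ker_mk']

theorem mem_centralizerMod {B N : Subgroup G} [N.Normal] {u : G} :
    u ∈ centralizerMod B N ↔ ∀ v ∈ B, ⁅u, v⁆ ∈ N := by
  rw [centralizerMod, Subgroup.mem_comap, Subgroup.mem_centralizer_iff]
  constructor
  · intro h v hv
    rw [← QuotientGroup.eq_one_iff, ← QuotientGroup.mk'_apply, map_commutatorElement,
      commutatorElement_eq_one_iff_mul_comm]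
    exact (h _ (Subgroup.mem_map_of_mem _ hv)).symm
  · rintro h _ ⟨v, hv, rfl⟩
    have := h v hv
    rw [← QuotientGroup.eq_one_iff, ← QuotientGroup.mk'_apply, map_commutatorElement,
      commutatorElement_eq_one_iff_mul_comm] at this
    exact this.symm

/-- Needed because the squares in `IsRestrictedSeries.lower` enter through a normal closure. -/
theorem centralizerMod_normal (B N : Subgroup G) [N.Normal] [B.Normal] :
    (centralizerMod B N).Normal := by
  have : (B.map (QuotientGroup.mk' N)).Normal :=
    Subgroup.Normal.map inferInstance _ (QuotientGroup.mk'_surjective N)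
  unfold centralizerMod
  infer_instance

/-- A descending series `E` with sets `S n` of generators of `E n` modulo `E (n + 1)`, which obeys
the recursion that characterizes the `2`-dimension series. -/
structure IsRestrictedSeries (E : ℕ → Subgroup G) (S : ℕ → Set G) : Prop where
  one_eq : E 1 = ⊤
  anti : Antitone E
  comm : ∀ n, ⁅(⊤ : Subgroup G), E n⁆ ≤ E (n + 1)
  finite : ∀ n, (S n).Finite
  subset : ∀ n, S n ⊆ E n
  gen : ∀ n, E n ≤ E (n + 1) ⊔ Subgroup.closure (S n)
  sq : ∀ n, ∀ s ∈ S n, s * s ∈ E (2 * n)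
  lower : ∀ n, 2 ≤ n → E n ≤ ⁅(⊤ : Subgroup G), E (n - 1)⁆ ⊔
    Subgroup.normalClosure {t | ∃ j s, j < n ∧ n ≤ 2 * j ∧ s ∈ S j ∧ t = s * s}

namespace IsRestrictedSeries

variable {E : ℕ → Subgroup G} {S : ℕ → Set G}

theorem normal (hE : IsRestrictedSeries E S) (n : ℕ) : (E n).Normal where
  conj_mem u hu g := by
    have h := hE.anti n.le_succ (hE.comm n
      (Subgroup.commutator_mem_commutator (Subgroup.mem_top g) hu))
    have e : g * u * g⁻¹ = ⁅g, u⁆ * u := by rw [commutatorElement_def]; group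
    rw [e]
    exact (E n).mul_mem h hu

/-- Descending induction on the weight `l`, from `k + i`, where there is nothing to prove, down to
`k`. For `k ≤ l` squaring on `E l` is multiplicative up to `[E l, E l] ≤ [E i, E l] ≤ E (k + i)`,
and the generators in `S l` have squares in `E (2l) ≤ E (k + i)`. -/
theorem mul_self_mem_of_commutator_le (hE : IsRestrictedSeries E S) {i k : ℕ} (hik : i ≤ k)
    (h : ∀ l, ⁅E i, E l⁆ ≤ E (i + l)) {w : G} (hw : w ∈ E k) : w * w ∈ E (k + i) := by
  have key : ∀ t, t ≤ i → ∀ w ∈ E (k + i - t), w * w ∈ E (k + i) := by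
    intro t
    induction t with
    | zero => exact fun _ w hw => (E _).mul_mem hw hw
    | succ t ih =>
      intro ht w hw
      set l := k + i - (t + 1) with hl
      have hl1 : l + 1 = k + i - t := by omega
      have hcomm : ∀ p ∈ E l, ∀ q ∈ E l, ⁅p, q⁆ ∈ E (k + i) := fun p hp q hq =>
        hE.anti (by omega) (h l (Subgroup.commutator_mem_commutator
          (hE.anti (show i ≤ l by omega) hp) hq))
      have := hE.normal (k + i)
      let Q : Subgroup G :=
        { carrier := {w | w ∈ E l ∧ w * w ∈ E (k + i)}
          one_mem' := ⟨(E l).one_mem, by simp [(E (k + i)).one_mem]⟩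
          mul_mem' := by
            rintro p q ⟨hp, hp'⟩ ⟨hq, hq'⟩
            refine ⟨(E l).mul_mem hp hq, ?_⟩
            have e : p * q * (p * q) = p * p * ⁅p⁻¹, q⁆ * (q * q) := by
              rw [commutatorElement_def]; group
            rw [e]
            exact (E _).mul_mem ((E _).mul_mem hp' (hcomm _ ((E l).inv_mem hp) _ hq)) hq'
          inv_mem' := by
            rintro p ⟨hp, hp'⟩
            refine ⟨(E l).inv_mem hp, ?_⟩
            rw [← mul_inv_rev]
            exact (E _).inv_mem hp' }
      have hle : E (l + 1) ⊔ Subgroup.closure (S l) ≤ Q := by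
        refine sup_le (fun p hp => ⟨hE.anti l.le_succ hp, ih (by omega) p (hl1 ▸ hp)⟩)
          ((Subgroup.closure_le _).2 fun s hs => ⟨hE.subset l hs, ?_⟩)
        exact hE.anti (by omega) (hE.sq l s hs)
      exact (hle (hE.gen l hw)).2
  exact key i le_rfl w (by simpa using hw)

/-- Induction on `i` through the two kinds of generators of `E i`. Commutators are handled by the
three subgroups lemma; for squares, `[u², v] = [u, [u, v]] · [u, v]²`, where both factors are
controlled by the smaller weight of `u`. -/
theorem commutator_le_add (hE : IsRestrictedSeries E S) (i : ℕ) (hi : 1 ≤ i) : ∀ j, ⁅E i, E j⁆ ≤ E (i + j) := by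
  induction i using Nat.strong_induction_on with
  | _ i ih =>
    intro j
    rcases hi.eq_or_lt with rfl | hi
    · rw [hE.one_eq, add_comm]
      exact hE.comm j
    have := hE.normal (i + j)
    have := hE.normal j
    rw [← le_centralizerMod]
    refine (hE.lower i hi).trans (sup_le ?_ ?_)
    · rw [le_centralizerMod]
      refine Subgroup.commutator_commutator_le_of_rotate ?_ ?_
      · rw [Subgroup.commutator_comm]
        refine (Subgroup.commutator_mono le_rfl (ih (i - 1) (by omega) (by omega) j)).trans ?_
        exact (hE.comm _).trans (hE.anti (by omega))
      · rw [Subgroup.commutator_comm]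
        refine (Subgroup.commutator_mono le_rfl
          ((Subgroup.commutator_comm (E j) ⊤).le.trans (hE.comm j))).trans ?_
        exact (ih (i - 1) (by omega) (by omega) (j + 1)).trans (hE.anti (by omega))
    · have := centralizerMod_normal (E j) (E (i + j))
      refine Subgroup.normalClosure_le_normal ?_
      rintro _ ⟨k, u, hk, hk2, hu, rfl⟩
      have hu := hE.subset k hu
      rw [SetLike.mem_coe, mem_centralizerMod]
      intro v hv
      have e : ⁅u * u, v⁆ = ⁅u, ⁅u, v⁆⁆ * (⁅u, v⁆ * ⁅u, v⁆) := by
        simp only [commutatorElement_def]; group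
      have ihk := ih k hk (by omega)
      have hw : ⁅u, v⁆ ∈ E (k + j) := ihk j (Subgroup.commutator_mem_commutator hu hv)
      rw [e]
      refine (E _).mul_mem ?_ ?_
      · exact hE.anti (by omega) (ihk (k + j) (Subgroup.commutator_mem_commutator hu hw))
      · exact hE.anti (by omega) (hE.mul_self_mem_of_commutator_le (by omega) ihk hw)

theorem mul_self_mem (hE : IsRestrictedSeries E S) {n : ℕ} (hn : 1 ≤ n) {w : G} (hw : w ∈ E n) : w * w ∈ E (2 * n) :=
  hE.anti (by omega) (hE.mul_self_mem_of_commutator_le le_rfl (hE.commutator_le_add n hn) hw)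

theorem zero_eq (hE : IsRestrictedSeries E S) : E 0 = ⊤ := top_unique (hE.one_eq ▸ hE.anti zero_le_one)

theorem commutator_mem (hE : IsRestrictedSeries E S) {i j : ℕ} {u v : G} (hu : u ∈ E i) (hv : v ∈ E j) : ⁅u, v⁆ ∈ E (i + j) := by
  rcases Nat.eq_zero_or_pos i with rfl | hi
  · rw [zero_add]
    exact hE.anti j.le_succ (hE.comm j (Subgroup.commutator_mem_commutator (Subgroup.mem_top u) hv))
  · exact hE.commutator_le_add i hi j (Subgroup.commutator_mem_commutator hu hv)

end IsRestrictedSeries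

end Series

/-! ### Identification of a restricted series with the dimension series -/

section Jennings

variable {G : Type*} [Group G]

local notation "𝔽₂[G]" => MonoidAlgebra (ZMod 2) G

/-- `h - 1` in the group algebra. -/
noncomputable abbrev ofSubOne (h : G) : MonoidAlgebra (ZMod 2) G := MonoidAlgebra.of (ZMod 2) G h - 1

theorem ofSubOne_mul_self (g : G) : ofSubOne g * ofSubOne g = ofSubOne (g * g) := by
  have h2 : (2 : 𝔽₂[G]) = 0 := by
    rw [← map_ofNat (algebraMap (ZMod 2) 𝔽₂[G]) 2, show (OfNat.ofNat 2 : ZMod 2) = 0 from rfl,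
      map_zero]
  have e : ofSubOne g * ofSubOne g = ofSubOne (g * g) - 2 * ofSubOne g := by
    simp only [ofSubOne, map_mul]; noncomm_ring
  rw [e, h2, zero_mul, sub_zero]

/-- The products `(h₁ - 1) ⋯ (hₗ - 1)` with `hᵢ ∈ H ∩ E wᵢ`, of weight `w₁ + ⋯ + wₗ`. -/
inductive WeightedProduct (E : ℕ → Subgroup G) (H : Subgroup G) :
    ℕ → MonoidAlgebra (ZMod 2) G → Prop
  | one : WeightedProduct E H 0 1
  | mul {w n h p} : h ∈ H → h ∈ E w → WeightedProduct E H n p →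
      WeightedProduct E H (w + n) (ofSubOne h * p)

/-- The span of the products of weight at least `n`. -/
noncomputable def weightedSpan (E : ℕ → Subgroup G) (H : Subgroup G) (n : ℕ) :
    Submodule (ZMod 2) (MonoidAlgebra (ZMod 2) G) :=
  Submodule.span (ZMod 2) {p | ∃ k, n ≤ k ∧ WeightedProduct E H k p}

variable {E : ℕ → Subgroup G} {H : Subgroup G}

theorem weightedSpan_anti {m n : ℕ} (h : m ≤ n) : weightedSpan E H n ≤ weightedSpan E H m :=
  Submodule.span_mono fun _ ⟨k, hk, hp⟩ => ⟨k, h.trans hk, hp⟩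

theorem one_mem_weightedSpan : (1 : 𝔽₂[G]) ∈ weightedSpan E H 0 :=
  Submodule.subset_span ⟨0, le_rfl, .one⟩

theorem ofSubOne_mul_mem {w n : ℕ} {h : G} (hH : h ∈ H) (hw : h ∈ E w) {p : 𝔽₂[G]}
    (hp : p ∈ weightedSpan E H n) : ofSubOne h * p ∈ weightedSpan E H (w + n) := by
  induction hp using Submodule.span_induction with
  | mem p hp =>
    obtain ⟨k, hk, hp⟩ := hp
    exact Submodule.subset_span ⟨w + k, by omega, .mul hH hw hp⟩
  | zero => rw [mul_zero]; exact zero_mem _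
  | add p q _ _ hp hq => rw [mul_add]; exact add_mem hp hq
  | smul c p _ hp => rw [mul_smul_comm]; exact Submodule.smul_mem _ _ hp

theorem of_mul_mem {n w : ℕ} {h : G} (hH : h ∈ H) (hw : h ∈ E w) {p : 𝔽₂[G]}
    (hp : p ∈ weightedSpan E H n) : MonoidAlgebra.of (ZMod 2) G h * p ∈ weightedSpan E H n := by
  have e : MonoidAlgebra.of (ZMod 2) G h * p = ofSubOne h * p + p := by
    rw [ofSubOne]; noncomm_ring
  rw [e]
  exact add_mem (weightedSpan_anti (by omega) (ofSubOne_mul_mem hH hw hp)) hp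

/-- Products of factors `h - 1` with `h ∈ H` stay in the group algebra of `H`. This keeps the cosets
`H'` and `gH'` apart in `detectsWeight_extend`. -/
theorem coeff_eq_zero_of_mem_weightedSpan {n : ℕ} {p : 𝔽₂[G]} (hp : p ∈ weightedSpan E H n)
    {b : G} (hb : b ∉ H) : p.coeff b = 0 := by
  induction hp using Submodule.span_induction generalizing b with
  | mem p hp =>
    obtain ⟨k, -, hp⟩ := hp
    induction hp generalizing b with
    | one =>
      have : (1 : G) ≠ b := fun h => hb (h ▸ H.one_mem)
      simp [MonoidAlgebra.one_def, this]
    | @mul w n h p hH _ _ ih =>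
      have e : (ofSubOne h * p) = MonoidAlgebra.single h 1 * p - p := by
        rw [ofSubOne, MonoidAlgebra.of_apply]; noncomm_ring
      rw [e, MonoidAlgebra.coeff_sub, Finsupp.sub_apply, MonoidAlgebra.coeff_single_mul_apply,
        ih hb, ih (fun h' => hb (by simpa using H.mul_mem hH h'))]
      simp
  | zero => simp
  | add p q _ _ hp hq =>
    rw [MonoidAlgebra.coeff_add, Finsupp.add_apply, hp hb, hq hb, add_zero]
  | smul c p _ hp =>
    rw [MonoidAlgebra.coeff_smul, Finsupp.smul_apply, hp hb, smul_zero]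

theorem augmentation_ofSubOne (h : G) : augmentation (ZMod 2) G (ofSubOne h) = 0 := by
  simp [augmentation, ofSubOne]

theorem augmentation_eq_zero_of_mem_weightedSpan {n : ℕ} (hn : 1 ≤ n) {p : 𝔽₂[G]}
    (hp : p ∈ weightedSpan E H n) : augmentation (ZMod 2) G p = 0 := by
  induction hp using Submodule.span_induction with
  | mem p hp =>
    obtain ⟨k, hk, hp⟩ := hp
    cases hp with
    | one => omega
    | mul => rw [map_mul, augmentation_ofSubOne, zero_mul]
  | zero => simp
  | add p q _ _ hp hq => rw [map_add, hp, hq, add_zero]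
  | smul c p _ hp => rw [map_smul, hp, smul_zero]

theorem mem_span_ofSubOne {p : 𝔽₂[G]} (hp : p ∈ augmentationIdeal (ZMod 2) G) :
    p ∈ Submodule.span (ZMod 2) (Set.range (ofSubOne : G → 𝔽₂[G])) := by
  have key : ∀ q : 𝔽₂[G], q - algebraMap (ZMod 2) 𝔽₂[G] (augmentation (ZMod 2) G q) ∈
      Submodule.span (ZMod 2) (Set.range (ofSubOne : G → 𝔽₂[G])) := by
    intro q
    induction q using MonoidAlgebra.induction_on with
    | of g =>
      have : augmentation (ZMod 2) G (MonoidAlgebra.of (ZMod 2) G g) = 1 := by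
        simp [augmentation]
      rw [this, map_one]
      exact Submodule.subset_span ⟨g, rfl⟩
    | add p q hp hq =>
      rw [map_add, map_add, add_sub_add_comm]
      exact add_mem hp hq
    | smul c q hq =>
      have e : c • q - algebraMap (ZMod 2) 𝔽₂[G] (augmentation (ZMod 2) G (c • q)) =
          c • (q - algebraMap (ZMod 2) 𝔽₂[G] (augmentation (ZMod 2) G q)) := by
        rw [map_smul, smul_sub, smul_eq_mul, map_mul, Algebra.smul_def c, Algebra.smul_def c]
      rw [e]
      exact Submodule.smul_mem _ _ hq
  have h0 : augmentation (ZMod 2) G p = 0 := hp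
  simpa [h0] using key p

/-- As `E 1` is the whole group, each of the `n` factors `g - 1` may be given weight `1`. -/
theorem augmentationIdeal_pow_le (h1 : E 1 = ⊤) (n : ℕ) {p : 𝔽₂[G]}
    (hp : p ∈ augmentationIdeal (ZMod 2) G ^ n) : p ∈ weightedSpan E ⊤ n := by
  induction n generalizing p with
  | zero =>
    have hall : ∀ q : 𝔽₂[G], q ∈ weightedSpan E ⊤ 0 := by
      intro q
      induction q using MonoidAlgebra.induction_on with
      | of g =>
        simpa using of_mul_mem (Subgroup.mem_top g) (h1 ▸ Subgroup.mem_top g : g ∈ E 1)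
          (one_mem_weightedSpan (E := E))
      | add p q hp hq => exact add_mem hp hq
      | smul c q hq => exact Submodule.smul_mem _ _ hq
    exact hall p
  | succ n ih =>
    rw [Ideal.IsTwoSided.pow_succ] at hp
    induction hp using Submodule.mul_induction_on' with
    | mem_mul_mem u hu q hq =>
      have hu' := mem_span_ofSubOne hu
      clear hu
      induction hu' using Submodule.span_induction with
      | mem u hu =>
        obtain ⟨h, rfl⟩ := hu
        rw [add_comm]
        exact ofSubOne_mul_mem (Subgroup.mem_top h) (h1 ▸ Subgroup.mem_top h) (ih hq)
      | zero => rw [zero_mul]; exact zero_mem _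
      | add u v _ _ hu hv => rw [add_mul]; exact add_mem hu hv
      | smul c u _ hu => rw [smul_mul_assoc]; exact Submodule.smul_mem _ _ hu
    | add u _ v _ hu hv => exact add_mem hu hv

/-- `h - 1` of weight at least `n` over `H` lies over `E n`. -/
def DetectsWeight (E : ℕ → Subgroup G) (N : ℕ) (H : Subgroup G) : Prop :=
  ∀ n ≤ N, ∀ h ∈ H, ofSubOne h ∈ weightedSpan E H n → h ∈ E n

namespace IsRestrictedSeries

variable {S : ℕ → Set G}

/-- All factors `g - 1` can be moved to the left. Passing `h - 1` of weight `k` creates `c = [h⁻¹,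
g⁻¹]`, whose weight `k + w` makes up for a lost factor `g - 1`; and `(g - 1)² = g² - 1` in
characteristic `2` has weight `2w` over `H'`. So at most one factor `g - 1` survives. -/
theorem weightedSpan_le (hE : IsRestrictedSeries E S) {w : ℕ} (hw : 1 ≤ w) {H' : Subgroup G}
    {g : G} (hg : g ∈ E w) (h1 : E (w + 1) ≤ H') (h2 : H' ≤ E w)
    (hH : ∀ u ∈ H, u ∈ H' ∨ g⁻¹ * u ∈ H') {n : ℕ} {p : 𝔽₂[G]} (hp : p ∈ weightedSpan E H n) :
    ∃ u ∈ weightedSpan E H' n, ∃ v ∈ weightedSpan E H' (n - w), p = u + ofSubOne g * v := by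
  have hgg := ofSubOne_mul_self g
  have hgg1 : g * g ∈ E (2 * w) := hE.mul_self_mem hw hg
  have hgg2 : g * g ∈ H' := h1 (hE.anti (by omega) hgg1)
  -- left multiplication by an element of `H'`
  have step : ∀ k, ∀ h ∈ H', h ∈ E k → ∀ n, ∀ u ∈ weightedSpan E H' n,
      ∀ v ∈ weightedSpan E H' (n - w), ∃ u' ∈ weightedSpan E H' (k + n),
      ∃ v' ∈ weightedSpan E H' (k + n - w),
      ofSubOne h * (u + ofSubOne g * v) = u' + ofSubOne g * v' := by
    intro k h hh hk n u hu v hv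
    set c := ⁅h⁻¹, g⁻¹⁆ with hc
    have hcE : c ∈ E (k + w) := hE.commutator_mem ((E k).inv_mem hk) ((E w).inv_mem hg)
    have hcH : c ∈ H' := h1 (hE.anti (by omega)
      (hE.commutator_mem ((E w).inv_mem (h2 hh)) ((E w).inv_mem hg)))
    have hh' : g⁻¹ * h * g = h * c := by
      rw [hc, commutatorElement_def]; group
    have hcv : ofSubOne c * v ∈ weightedSpan E H' (k + n) :=
      weightedSpan_anti (by omega) (ofSubOne_mul_mem hcH hcE hv)
    have hcv' : ofSubOne c * v ∈ weightedSpan E H' (k + n - w) :=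
      weightedSpan_anti (by omega) (ofSubOne_mul_mem hcH hcE hv)
    have hhv : ofSubOne h * v ∈ weightedSpan E H' (k + n - w) :=
      weightedSpan_anti (by omega) (ofSubOne_mul_mem hh hk hv)
    refine ⟨ofSubOne h * u + MonoidAlgebra.of (ZMod 2) G h * (ofSubOne c * v),
      add_mem (ofSubOne_mul_mem hh hk hu) (of_mul_mem hh hk hcv),
      ofSubOne h * v + MonoidAlgebra.of (ZMod 2) G h * (ofSubOne c * v),
      add_mem hhv (of_mul_mem hh hk hcv'), ?_⟩
    have e : MonoidAlgebra.of (ZMod 2) G h * MonoidAlgebra.of (ZMod 2) G g =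
        MonoidAlgebra.of (ZMod 2) G g * (MonoidAlgebra.of (ZMod 2) G h *
          MonoidAlgebra.of (ZMod 2) G c) := by
      rw [← map_mul, ← map_mul, ← map_mul, ← hh']
      congr 1
      group
    have e2 : ofSubOne h * (u + ofSubOne g * v) = ofSubOne h * u +
        (MonoidAlgebra.of (ZMod 2) G h * MonoidAlgebra.of (ZMod 2) G g -
          MonoidAlgebra.of (ZMod 2) G h - MonoidAlgebra.of (ZMod 2) G g + 1) * v := by
      simp only [ofSubOne]; noncomm_ring
    rw [e2, e]
    simp only [ofSubOne]
    noncomm_ring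
  -- left multiplication by `g`
  have stepg : ∀ n, ∀ u ∈ weightedSpan E H' n, ∀ v ∈ weightedSpan E H' (n - w),
      ∃ u' ∈ weightedSpan E H' (w + n), ∃ v' ∈ weightedSpan E H' (w + n - w),
      ofSubOne g * (u + ofSubOne g * v) = u' + ofSubOne g * v' := by
    intro n u hu v hv
    refine ⟨ofSubOne (g * g) * v,
      weightedSpan_anti (by omega) (ofSubOne_mul_mem hgg2 hgg1 hv), u, by simpa using hu, ?_⟩
    rw [mul_add, ← mul_assoc, hgg, add_comm]
  have base : ∀ k q, WeightedProduct E H k q → ∃ u ∈ weightedSpan E H' k,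
      ∃ v ∈ weightedSpan E H' (k - w), q = u + ofSubOne g * v := by
    intro k q hk
    induction hk with
    | one => exact ⟨1, one_mem_weightedSpan, 0, zero_mem _, by simp⟩
    | @mul k n h p hh hk _ ih =>
      obtain ⟨u, hu, v, hv, rfl⟩ := ih
      rcases hH h hh with hh' | hh'
      · exact step k h hh' hk n u hu v hv
      -- Writing `h = g · (g⁻¹h)` gives only weight `w`, which suffices if `k ≤ w`; if `k > w` then
      -- `h` already lies in `E (w + 1) ≤ H'`.
      · by_cases hkw : k ≤ w
        · obtain ⟨u1, hu1, v1, hv1, e1⟩ := step w _ hh' (h2 hh') n u hu v hv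
          obtain ⟨u2, hu2, v2, hv2, e2⟩ := stepg n u hu v hv
          obtain ⟨u3, hu3, v3, hv3, e3⟩ := stepg (w + n) u1 hu1 v1 hv1
          refine ⟨u1 + u2 + u3, weightedSpan_anti (by omega) (add_mem (add_mem hu1 hu2)
            (weightedSpan_anti (by omega) hu3)), v1 + v2 + v3, weightedSpan_anti (by omega)
            (add_mem (add_mem hv1 hv2) (weightedSpan_anti (by omega) hv3)), ?_⟩
          have e : ofSubOne h = ofSubOne g * ofSubOne (g⁻¹ * h) + ofSubOne g
              + ofSubOne (g⁻¹ * h) := by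
            have : MonoidAlgebra.of (ZMod 2) G h = MonoidAlgebra.of (ZMod 2) G g *
                MonoidAlgebra.of (ZMod 2) G (g⁻¹ * h) := by
              rw [← map_mul, mul_inv_cancel_left]
            simp only [ofSubOne, this]
            noncomm_ring
          rw [e, add_mul, add_mul, mul_assoc, e1, e2, e3]
          noncomm_ring
        · have hh1 : h ∈ H' := h1 (hE.anti (by omega) hk)
          exact step k h hh1 hk n u hu v hv
  clear step stepg
  induction hp using Submodule.span_induction with
  | mem p hp =>
    obtain ⟨k, hk, hp⟩ := hp
    obtain ⟨u, hu, v, hv, e⟩ := base k p hp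
    exact ⟨u, weightedSpan_anti hk hu, v, weightedSpan_anti (by omega) hv, e⟩
  | zero => exact ⟨0, zero_mem _, 0, zero_mem _, by simp⟩
  | add p q _ _ hp hq =>
    obtain ⟨u, hu, v, hv, rfl⟩ := hp
    obtain ⟨u', hu', v', hv', rfl⟩ := hq
    exact ⟨u + u', add_mem hu hu', v + v', add_mem hv hv', by rw [mul_add]; abel⟩
  | smul c p _ hp =>
    obtain ⟨u, hu, v, hv, rfl⟩ := hp
    exact ⟨c • u, Submodule.smul_mem _ _ hu, c • v, Submodule.smul_mem _ _ hv,
      by rw [smul_add, mul_smul_comm]⟩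

/-- Compare coefficients in `b - 1 = u + (g - 1)v` on the coset `gH'`. If `b ∈ H'`, then `v = 0` and
`b - 1 = u` has weight `n` over `H'`. If `b ∈ gH'`, then `v` is the group element `g⁻¹b`, of
augmentation `1`, so its weight `n - w` cannot be positive; hence `n ≤ w` and `b ∈ E w ≤ E n`. -/
theorem detectsWeight_extend (hE : IsRestrictedSeries E S) {w N : ℕ} (hw : 1 ≤ w)
    {H H' : Subgroup G} {g : G} (hg : g ∈ E w) (h1 : E (w + 1) ≤ H') (h2 : H ≤ E w)
    (hH' : H' ≤ H) (hH : ∀ u ∈ H, u ∈ H' ∨ g⁻¹ * u ∈ H') (h : DetectsWeight E N H') :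
    DetectsWeight E N H := by
  intro n hn b hb hbn
  by_cases hgH : g ∈ H'
  · refine h n hn b ?_ ?_
    · rcases hH b hb with hb | hb
      · exact hb
      · simpa using H'.mul_mem hgH hb
    · have : H = H' := le_antisymm (fun u hu => (hH u hu).elim id
        (fun hu => by simpa using H'.mul_mem hgH hu)) hH'
      rwa [← this]
  obtain ⟨u, hu, v, hv, e⟩ := hE.weightedSpan_le hw hg h1 (hH'.trans h2) hH hbn
  have hgnot : ∀ a ∈ H', g * a ∉ H' := fun a ha hga => hgH (by
    simpa using H'.mul_mem hga (H'.inv_mem ha))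
  have e' : MonoidAlgebra.single b (1 : ZMod 2) = 1 + u - v + MonoidAlgebra.single g 1 * v := by
    simp only [ofSubOne, MonoidAlgebra.of_apply] at e
    rw [sub_eq_iff_eq_add] at e
    rw [e]
    noncomm_ring
  have hcoef : ∀ a ∈ H', (MonoidAlgebra.single b (1 : ZMod 2)).coeff (g * a) = v.coeff a := by
    intro a ha
    have hone : (1 : 𝔽₂[G]).coeff (g * a) = 0 := by
      have : (1 : G) ≠ g * a := fun h' => hgnot a ha (h' ▸ H'.one_mem)
      simp [MonoidAlgebra.one_def, this]
    rw [e', MonoidAlgebra.coeff_add, MonoidAlgebra.coeff_sub, MonoidAlgebra.coeff_add,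
      Finsupp.add_apply, Finsupp.sub_apply, Finsupp.add_apply, hone,
      coeff_eq_zero_of_mem_weightedSpan hu (hgnot a ha),
      coeff_eq_zero_of_mem_weightedSpan hv (hgnot a ha), MonoidAlgebra.coeff_single_mul_apply]
    simp
  rcases hH b hb with hb' | hb'
  · have hv0 : v = 0 := by
      ext a
      by_cases ha : a ∈ H'
      · rw [← hcoef a ha]
        have : b ≠ g * a := fun h' => hgnot a ha (h' ▸ hb')
        simp [this]
      · rw [coeff_eq_zero_of_mem_weightedSpan hv ha]
        simp
    refine h n hn b hb' ?_
    rw [e, hv0, mul_zero, add_zero]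
    exact hu
  · have hv0 : v = MonoidAlgebra.of (ZMod 2) G (g⁻¹ * b) := by
      ext a
      by_cases ha : a ∈ H'
      · rw [← hcoef a ha]
        classical
        rw [MonoidAlgebra.of_apply, MonoidAlgebra.coeff_single, MonoidAlgebra.coeff_single,
          Finsupp.single_apply, Finsupp.single_apply]
        simp only [inv_mul_eq_iff_eq_mul]
      · rw [coeff_eq_zero_of_mem_weightedSpan hv ha]
        have : g⁻¹ * b ≠ a := fun h' => ha (h' ▸ hb')
        simp [this]
    by_cases hnw : n ≤ w
    · exact hE.anti hnw (h2 hb)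
    · have := augmentation_eq_zero_of_mem_weightedSpan (by omega) hv
      rw [hv0] at this
      simp [augmentation] at this

/-- The finitely many generators of `E w` modulo `E (w + 1)` are adjoined one by one; each step has
index at most two, because commutators and squares of weight `w` fall into `E (w + 1)`. -/
theorem detectsWeight_step (hE : IsRestrictedSeries E S) {w N : ℕ} (hw : 1 ≤ w)
    (h : DetectsWeight E N (E (w + 1))) : DetectsWeight E N (E w) := by
  have key : ∀ F : Set G, F.Finite → F ⊆ E w →
      DetectsWeight E N (E (w + 1) ⊔ Subgroup.closure F) := by
    intro F hF
    induction F, hF using Set.Finite.induction_on with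
    | empty => intro _; simpa using h
    | @insert g F _ _ ih =>
      intro hgF
      have hg : g ∈ E w := hgF (Set.mem_insert _ _)
      have hF : F ⊆ E w := (Set.subset_insert _ _).trans hgF
      have hle : E (w + 1) ⊔ Subgroup.closure F ≤ E w :=
        sup_le (hE.anti w.le_succ) ((Subgroup.closure_le _).2 hF)
      have hle' : E (w + 1) ⊔ Subgroup.closure (insert g F) ≤ E w :=
        sup_le (hE.anti w.le_succ) ((Subgroup.closure_le _).2 hgF)
      refine hE.detectsWeight_extend hw hg le_sup_left hle' ?_ ?_ (ih hF)
      · exact sup_le_sup le_rfl (Subgroup.closure_mono (Set.subset_insert _ _))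
      · intro u hu
        have e : E (w + 1) ⊔ Subgroup.closure (insert g F) =
            (E (w + 1) ⊔ Subgroup.closure F) ⊔ Subgroup.closure {g} := by
          rw [Set.insert_eq, Subgroup.closure_union, sup_assoc, sup_comm (Subgroup.closure {g})]
        rw [e] at hu
        refine Subgroup.mem_or_inv_mul_mem_of_mem_sup_closure_singleton (fun k hk => ?_) ?_ hu
        · have e : g * k * g⁻¹ = ⁅g, k⁆ * k := by rw [commutatorElement_def]; group
          rw [e]
          refine Subgroup.mul_mem _ (le_sup_left (a := E (w + 1)) ?_) hk
          exact hE.anti (by omega) (hE.commutator_mem hg (hle hk))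
        · exact le_sup_left (a := E (w + 1)) (hE.anti (by omega) (hE.mul_self_mem hw hg))
  have e : E w = E (w + 1) ⊔ Subgroup.closure (S w) :=
    le_antisymm (hE.gen w) (sup_le (hE.anti w.le_succ) ((Subgroup.closure_le _).2 (hE.subset w)))
  rw [e]
  exact key (S w) (hE.finite w) (hE.subset w)

theorem dimensionSubgroup_le (hE : IsRestrictedSeries E S) (n : ℕ) :
    dimensionSubgroup (ZMod 2) G n ≤ E n := by
  rcases Nat.eq_zero_or_pos n with rfl | hn
  · rw [hE.zero_eq]
    exact le_top
  -- Climb from `E n`, where detecting weights up to `n` is trivial, to `E 1`.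
  have key : ∀ t, t + 1 ≤ n → DetectsWeight E n (E (n - t)) := by
    intro t
    induction t with
    | zero => exact fun _ m hm h hh _ => hE.anti hm hh
    | succ t ih =>
      intro ht
      refine hE.detectsWeight_step (by omega) ?_
      rw [show n - (t + 1) + 1 = n - t by omega]
      exact ih (by omega)
  have h1 := key (n - 1) (by omega)
  rw [show n - (n - 1) = 1 by omega, hE.one_eq] at h1
  exact fun g hg => h1 n le_rfl g (Subgroup.mem_top g) (augmentationIdeal_pow_le hE.one_eq n hg)

end IsRestrictedSeries

theorem ofSubOne_mem_augmentationIdeal (g : G) :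
    ofSubOne g ∈ augmentationIdeal (ZMod 2) G := augmentation_ofSubOne g

theorem dimensionSubgroup_one : dimensionSubgroup (ZMod 2) G 1 = ⊤ := by
  refine top_unique fun g _ => ?_
  rw [mem_dimensionSubgroup, Submodule.pow_one]
  exact ofSubOne_mem_augmentationIdeal g

/-- From `gu - ug = (g - 1)(u - 1) - (u - 1)(g - 1)`. -/
theorem commutator_mem_dimensionSubgroup {n : ℕ} (g : G) {u : G}
    (hu : u ∈ dimensionSubgroup (ZMod 2) G n) :
    ⁅g, u⁆ ∈ dimensionSubgroup (ZMod 2) G (n + 1) := by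
  rw [mem_dimensionSubgroup] at *
  have e : MonoidAlgebra.of (ZMod 2) G ⁅g, u⁆ - 1 = (ofSubOne g * ofSubOne u -
      ofSubOne u * ofSubOne g) * MonoidAlgebra.of (ZMod 2) G (g⁻¹ * u⁻¹) := by
    have e1 : ofSubOne g * ofSubOne u - ofSubOne u * ofSubOne g =
        MonoidAlgebra.of (ZMod 2) G (g * u) - MonoidAlgebra.of (ZMod 2) G (u * g) := by
      simp only [ofSubOne, map_mul]; noncomm_ring
    rw [e1, sub_mul, ← map_mul, ← map_mul, commutatorElement_def]
    congr 1
    · congr 1; group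
    · rw [show u * g * (g⁻¹ * u⁻¹) = 1 by group, map_one]
  rw [e]
  refine Ideal.mul_mem_right _ _ (sub_mem ?_ ?_)
  · rw [Ideal.IsTwoSided.pow_succ]
    exact Ideal.mul_mem_mul (ofSubOne_mem_augmentationIdeal g) hu
  · have h1 : augmentationIdeal (ZMod 2) G ^ (n + 1) =
        augmentationIdeal (ZMod 2) G ^ n * augmentationIdeal (ZMod 2) G ^ 1 :=
      Ideal.IsTwoSided.pow_add _ _
    rw [h1, Submodule.pow_one]
    exact Ideal.mul_mem_mul hu (ofSubOne_mem_augmentationIdeal g)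

theorem mul_self_mem_dimensionSubgroup {n : ℕ} {u : G}
    (hu : u ∈ dimensionSubgroup (ZMod 2) G n) :
    u * u ∈ dimensionSubgroup (ZMod 2) G (2 * n) := by
  rw [mem_dimensionSubgroup] at *
  have e : MonoidAlgebra.of (ZMod 2) G (u * u) - 1 = ofSubOne u * ofSubOne u := by
    rw [ofSubOne_mul_self]
  rw [e, two_mul, Ideal.IsTwoSided.pow_add]
  exact Ideal.mul_mem_mul hu hu

theorem dimensionSubgroup_anti : Antitone (dimensionSubgroup (ZMod 2) G) :=
  fun _ _ h _ hg => Ideal.pow_le_pow_right h hg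

/-- A series that satisfies the recursion is the `2`-dimension series. -/
theorem IsRestrictedSeries.dimensionSubgroup_eq {S : ℕ → Set G} (hE : IsRestrictedSeries E S)
    {n : ℕ} (hn : 1 ≤ n) : dimensionSubgroup (ZMod 2) G n = E n := by
  refine le_antisymm (hE.dimensionSubgroup_le n) ?_
  induction n using Nat.strong_induction_on with
  | _ n ih =>
    rcases hn.eq_or_lt with rfl | hn
    · rw [dimensionSubgroup_one]
      exact le_top
    refine (hE.lower n hn).trans (sup_le ?_ (Subgroup.normalClosure_le_normal ?_))
    · rw [Subgroup.commutator_le]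
      intro g _ u hu
      have := commutator_mem_dimensionSubgroup g (ih (n - 1) (by omega) (by omega) hu)
      rwa [show n - 1 + 1 = n by omega] at this
    · rintro _ ⟨j, u, hj, hj2, hu, rfl⟩
      exact dimensionSubgroup_anti hj2
        (mul_self_mem_dimensionSubgroup (ih j hj (by omega) (hE.subset j hu)))

end Jennings

namespace Overgroup

/-! ### Functions on a level of the tree -/

/-- The `𝔽₂`-valued functions on the vertices of level `m`. -/
abbrev U (m : ℕ) : Type := (Fin m → ZMod 2) → ZMod 2

theorem ZMod.eq_zero_or_one (s : ZMod 2) : s = 0 ∨ s = 1 := by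
  revert s; decide

/-- The restriction to the subtree below `0`. -/
def lo (m : ℕ) : U (m + 1) →ₗ[ZMod 2] U m :=
  LinearMap.funLeft _ _ fun σ => (Fin.cons 0 σ : Fin (m + 1) → ZMod 2)

/-- The restriction to the subtree below `1`. -/
def hi (m : ℕ) : U (m + 1) →ₗ[ZMod 2] U m :=
  LinearMap.funLeft _ _ fun σ => (Fin.cons 1 σ : Fin (m + 1) → ZMod 2)

/-- The function with given restrictions to the two subtrees. -/
def join (m : ℕ) : U m × U m →ₗ[ZMod 2] U (m + 1) where
  toFun u σ := if σ 0 = 0 then u.1 (Fin.tail σ) else u.2 (Fin.tail σ)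
  map_add' u v := by ext σ; by_cases h : σ 0 = 0 <;> simp [h]
  map_smul' c u := by ext σ; by_cases h : σ 0 = 0 <;> simp [h]

@[simp] theorem lo_join {m : ℕ} (u : U m × U m) : lo m (join m u) = u.1 := by
  ext σ; simp [lo, join, LinearMap.funLeft]

@[simp] theorem hi_join {m : ℕ} (u : U m × U m) : hi m (join m u) = u.2 := by
  ext σ; simp [hi, join, LinearMap.funLeft]

theorem U_ext {m : ℕ} {u w : U (m + 1)} (h0 : lo m u = lo m w) (h1 : hi m u = hi m w) :
    u = w := by
  ext σ
  rw [← Fin.cons_self_tail σ]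
  rcases ZMod.eq_zero_or_one (σ 0) with h | h <;> rw [h]
  · exact congrFun h0 (Fin.tail σ)
  · exact congrFun h1 (Fin.tail σ)

/-- The coordinates in the basis `basisU`. -/
def coef : (m : ℕ) → ℕ → (U m →ₗ[ZMod 2] ZMod 2)
  | 0, j => if j = 0 then LinearMap.proj default else 0
  | m + 1, j => if j % 2 = 0 then coef m (j / 2) ∘ₗ (lo m + hi m) else coef m (j / 2) ∘ₗ hi m

/-- The functions that correspond to the elements `v m r` of `V m`. -/
def basisU : (m : ℕ) → ℕ → U m
  | 0, _ => fun _ => 1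
  | m + 1, r => join m (basisU m (r / 2), if r % 2 = 0 then 0 else basisU m (r / 2))

/-- On a pair of halves, the basis `(1, 0)`, `(1, 1)` has dual coordinates `u₀ + u₁` and `u₁` in
characteristic `2`; the lowest binary digit selects between them. -/
theorem coef_even (m k : ℕ) (u : U (m + 1)) :
    coef (m + 1) (2 * k) u = coef m k (lo m u) + coef m k (hi m u) := by
  simp [coef]

theorem coef_odd (m k : ℕ) (u : U (m + 1)) : coef (m + 1) (2 * k + 1) u = coef m k (hi m u) := by
  have h : (2 * k + 1) / 2 = k := by omega
  simp [coef, Nat.add_mod, h]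

theorem basisU_even (m k : ℕ) : basisU (m + 1) (2 * k) = join m (basisU m k, 0) := by
  simp [basisU]

theorem basisU_odd (m k : ℕ) : basisU (m + 1) (2 * k + 1) = join m (basisU m k, basisU m k) := by
  have h : (2 * k + 1) / 2 = k := by omega
  simp [basisU, Nat.add_mod, h]

theorem ZMod.add_self_two (s : ZMod 2) : s + s = 0 := by
  revert s; decide

theorem coef_basisU (m : ℕ) : ∀ i < 2 ^ m, ∀ j,
    coef m j (basisU m i) = if i = j then 1 else 0 := by
  induction m with
  | zero =>
    intro i hi j
    have : i = 0 := by simpa using hi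
    subst this
    by_cases hj : j = 0
    · simp [coef, basisU, hj]
    · simp [coef, hj, Ne.symm hj]
  | succ m ih =>
    intro i hi j
    have hi2 : i / 2 < 2 ^ m := by rw [pow_succ] at hi; omega
    rcases Nat.even_or_odd' i with ⟨k, rfl | rfl⟩ <;> rcases Nat.even_or_odd' j with ⟨l, rfl | rfl⟩
    · rw [basisU_even, coef_even, lo_join, hi_join, map_zero, add_zero,
        ih k (by omega)]
      simp
    · rw [basisU_even, coef_odd, hi_join, map_zero, if_neg (by omega)]
    · rw [basisU_odd, coef_even, lo_join, hi_join, ZMod.add_self_two, if_neg (by omega)]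
    · rw [basisU_odd, coef_odd, hi_join, ih k (by omega)]
      simp

theorem coef_eq_zero (m : ℕ) : ∀ j, 2 ^ m ≤ j → ∀ u, coef m j u = 0 := by
  induction m with
  | zero =>
    intro j hj u
    have : j ≠ 0 := by rintro rfl; simp at hj
    simp [coef, this]
  | succ m ih =>
    intro j hj u
    rw [pow_succ] at hj
    rcases Nat.even_or_odd' j with ⟨k, rfl | rfl⟩
    · rw [coef_even, ih k (by omega), ih k (by omega), add_zero]
    · rw [coef_odd, ih k (by omega)]

theorem eq_zero_of_coef (m : ℕ) : ∀ u : U m, (∀ j, coef m j u = 0) → u = 0 := by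
  induction m with
  | zero =>
    intro u h
    ext σ
    have := h 0
    simp only [coef, if_true, LinearMap.proj_apply] at this
    rw [Subsingleton.elim σ default, this]
    rfl
  | succ m ih =>
    intro u h
    have h1 : hi m u = 0 := ih _ fun j => by rw [← coef_odd]; exact h _
    have h0 : lo m u = 0 := ih _ fun j => by
      have := h (2 * j)
      rwa [coef_even, h1, map_zero, add_zero] at this
    exact U_ext (by rw [h0, map_zero]) (by rw [h1, map_zero])

/-- The span of the `basisU m j` with `j ≥ r`. -/
def Usub (m r : ℕ) : Submodule (ZMod 2) (U m) where
  carrier := {u | ∀ j < r, coef m j u = 0}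
  add_mem' hu hv j hj := by rw [map_add, hu j hj, hv j hj, add_zero]
  zero_mem' j _ := map_zero _
  smul_mem' c u hu j hj := by rw [map_smul, hu j hj, smul_zero]

theorem Usub_anti (m : ℕ) : Antitone (Usub m) := fun _ _ h _ hu j hj => hu j (hj.trans_le h)

theorem Usub_zero (m : ℕ) : Usub m 0 = ⊤ :=
  top_unique fun _ _ j hj => absurd hj j.not_lt_zero

theorem Usub_eq_bot {m r : ℕ} (h : 2 ^ m ≤ r) : Usub m r = ⊥ := by
  refine bot_unique fun u hu => ?_
  rw [Submodule.mem_bot]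
  refine eq_zero_of_coef m u fun j => ?_
  by_cases hj : j < 2 ^ m
  · exact hu j (by omega)
  · exact coef_eq_zero m j (by omega) u

theorem mem_Usub_succ {m r : ℕ} {u : U m} :
    u ∈ Usub m (r + 1) ↔ u ∈ Usub m r ∧ coef m r u = 0 := by
  refine ⟨fun h => ⟨Usub_anti m r.le_succ h, h r r.lt_succ_self⟩, fun ⟨h, h'⟩ j hj => ?_⟩
  rcases Nat.lt_succ_iff_lt_or_eq.1 hj with hj | rfl
  · exact h j hj
  · exact h'

theorem basisU_mem {m r i : ℕ} (hi : i < 2 ^ m) (hr : r ≤ i) : basisU m i ∈ Usub m r :=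
  fun j hj => by rw [coef_basisU m i hi, if_neg (by omega)]

theorem sub_smul_basisU_mem {m r : ℕ} (hr : r < 2 ^ m) {u : U m} (hu : u ∈ Usub m r) :
    u - coef m r u • basisU m r ∈ Usub m (r + 1) := by
  refine mem_Usub_succ.2 ⟨sub_mem hu (Submodule.smul_mem _ _ (basisU_mem hr le_rfl)), ?_⟩
  rw [map_sub, map_smul, coef_basisU m r hr, if_pos rfl, smul_eq_mul, mul_one, sub_self]

/-- A submodule contains `Usub m r` as soon as, for each `j ≥ r`, it contains an element of
`Usub m j` with nonzero `j`-th coordinate. -/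
theorem Usub_le_of_forall_exists {m r : ℕ} {W : Submodule (ZMod 2) (U m)}
    (h : ∀ j, r ≤ j → j < 2 ^ m → ∃ w ∈ W, w ∈ Usub m j ∧ coef m j w = 1) : Usub m r ≤ W := by
  have key : ∀ t, ∀ j, r ≤ j → 2 ^ m ≤ j + t → Usub m j ≤ W := by
    intro t
    induction t with
    | zero =>
      intro j _ hj
      rw [Usub_eq_bot (by simpa using hj)]
      exact bot_le
    | succ t ih =>
      intro j hj ht
      by_cases hj2 : j < 2 ^ m
      · intro u hu
        obtain ⟨w, hwW, hw, hw1⟩ := h j hj hj2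
        have : u - coef m j u • w ∈ Usub m (j + 1) := by
          refine mem_Usub_succ.2 ⟨sub_mem hu (Submodule.smul_mem _ _ hw), ?_⟩
          rw [map_sub, map_smul, hw1, smul_eq_mul, mul_one, sub_self]
        have := ih (j + 1) (by omega) (by omega) this
        have := add_mem this (Submodule.smul_mem W (coef m j u) hwW)
        rwa [sub_add_cancel] at this
      · rw [Usub_eq_bot (by omega)]
        exact bot_le
  exact key (2 ^ m) r le_rfl (by omega)

theorem Usub_eq_span (m r : ℕ) :
    Usub m r = Submodule.span (ZMod 2) {u | ∃ j, r ≤ j ∧ j < 2 ^ m ∧ u = basisU m j} := by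
  refine le_antisymm (Usub_le_of_forall_exists fun j hj hj2 => ?_) (Submodule.span_le.2 ?_)
  · exact ⟨basisU m j, Submodule.subset_span ⟨j, hj, hj2, rfl⟩, basisU_mem hj2 le_rfl, by
      rw [coef_basisU m j hj2, if_pos rfl]⟩
  · rintro _ ⟨j, hj, hj2, rfl⟩
    exact basisU_mem hj2 hj

/-! ### The action of the generators on the functions on a level -/

/-- The action of `a`. -/
def actA : (m : ℕ) → (U m →ₗ[ZMod 2] U m)
  | 0 => LinearMap.id
  | m + 1 => join m ∘ₗ (hi m).prod (lo m)

/-- The action of a directed generator on the functions below the vertex `0`. -/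
def sideAct (m : ℕ) : Label → (U m →ₗ[ZMod 2] U m)
  | .b => actA m
  | .c => LinearMap.id
  | .d => LinearMap.id

/-- The action of a directed generator. -/
def actL : (m : ℕ) → Label → (U m →ₗ[ZMod 2] U m)
  | 0, _ => LinearMap.id
  | m + 1, l => join m ∘ₗ (sideAct m l ∘ₗ lo m).prod (actL m l.next ∘ₗ hi m)

/-- The action of a generator, where `none` stands for `a`. -/
def actU (m : ℕ) : Option Label → (U m →ₗ[ZMod 2] U m)
  | none => actA m
  | some l => actL m l

theorem actA_succ {m : ℕ} (u : U (m + 1)) : actA (m + 1) u = join m (hi m u, lo m u) := rfl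

theorem actL_succ {m : ℕ} (l : Label) (u : U (m + 1)) :
    actL (m + 1) l u = join m (sideAct m l (lo m u), actL m l.next (hi m u)) := rfl

theorem sideAct_eq (m : ℕ) (l : Label) : sideAct m l = actA m ∨ sideAct m l = LinearMap.id := by
  cases l
  · exact Or.inl rfl
  · exact Or.inr rfl
  · exact Or.inr rfl

/-- Even coordinates are symmetric in the two halves. For odd `j = 2k + 1 ≤ r`, coordinate `2k`
vanishes, so the halves have equal `k`-th coordinates and exchanging them changes nothing. Thus `a`
is unitriangular in the basis `basisU`. -/
theorem coef_actA (m : ℕ) {r : ℕ} {u : U m} (hu : u ∈ Usub m r) {j : ℕ} (hj : j ≤ r) :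
    coef m j (actA m u) = coef m j u := by
  cases m with
  | zero => rfl
  | succ m =>
    rw [actA_succ]
    rcases Nat.even_or_odd' j with ⟨k, rfl | rfl⟩
    · rw [coef_even, coef_even, lo_join, hi_join, add_comm]
    · have := hu (2 * k) (by omega)
      rw [coef_even] at this
      rw [coef_odd, coef_odd, hi_join]
      have e : ∀ p q : ZMod 2, p + q = 0 → p = q := by decide
      exact e _ _ this

/-- Both halves of `u` lie in `Usub m k` whenever `2k ≤ r`, so unitriangularity passes down the
tree, where the generator acts by `a` or the identity on one half and by the next generator on the
other. -/
theorem coef_actL (m : ℕ) : ∀ (l : Label) {r : ℕ} {u : U m}, u ∈ Usub m r → ∀ {j : ℕ}, j ≤ r →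
    coef m j (actL m l u) = coef m j u := by
  induction m with
  | zero => intros; rfl
  | succ m ih =>
    intro l r u hu j hj
    have hhi : ∀ k, 2 * k ≤ r → hi m u ∈ Usub m k := fun k hk i hi => by
      rw [← coef_odd]; exact hu _ (by omega)
    have hlo : ∀ k, 2 * k ≤ r → lo m u ∈ Usub m k := fun k hk i hi => by
      have := hu (2 * i) (by omega)
      rwa [coef_even, hhi k hk i hi, add_zero] at this
    have hside : ∀ k, 2 * k ≤ r → coef m k (sideAct m l (lo m u)) = coef m k (lo m u) := by
      intro k hk
      rcases sideAct_eq m l with h | h <;> rw [h]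
      · exact coef_actA m (hlo k hk) le_rfl
      · rfl
    rw [actL_succ]
    rcases Nat.even_or_odd' j with ⟨k, rfl | rfl⟩
    · rw [coef_even, coef_even, lo_join, hi_join, hside k hj, ih _ (hhi k hj) le_rfl]
    · rw [coef_odd, coef_odd, hi_join, ih _ (hhi k (by omega)) le_rfl]

theorem coef_actU {m : ℕ} (s : Option Label) {r : ℕ} {u : U m} (hu : u ∈ Usub m r) {j : ℕ}
    (hj : j ≤ r) : coef m j (actU m s u) = coef m j u := by
  cases s
  · exact coef_actA m hu hj
  · exact coef_actL m _ hu hj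

theorem actU_sub_mem {m : ℕ} (s : Option Label) {r : ℕ} {u : U m} (hu : u ∈ Usub m r) :
    actU m s u - u ∈ Usub m (r + 1) := fun j hj => by
  rw [map_sub, coef_actU s hu (Nat.lt_succ_iff.1 hj), sub_self]

theorem Label.exists_next (l : Label) : ∃ l' : Label, l'.next = l := by
  cases l
  · exact ⟨.d, rfl⟩
  · exact ⟨.b, rfl⟩
  · exact ⟨.c, rfl⟩

/-- The subdiagonal entries that make the action uniserial. For `r = 2k`, `a` sends `(v_k, 0)` to
`(0, v_k)`. For `r = 2k + 1` the vector is `(v_k, v_k)` and exactly one half must be moved. If `k`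
is even, `b̃` works: `a` moves the half below `0`, while `c̃` fixes `v_k`, which is supported below
`0`. If `k` is odd, `a` fixes `v_k`, and the label is chosen so that its successor moves the half
below `1`. -/
theorem exists_coef_act_eq_one (m : ℕ) : ∀ r, r + 1 < 2 ^ m →
    (Even r → coef m (r + 1) (actA m (basisU m r)) = 1) ∧
    (Odd r → ∃ l, coef m (r + 1) (actL m l (basisU m r)) = 1) := by
  induction m with
  | zero => intro r hr; simp at hr
  | succ m ih =>
    intro r hr
    rw [pow_succ] at hr
    constructor
    · rintro ⟨k, hk⟩
      obtain rfl : r = 2 * k := by omega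
      rw [basisU_even, actA_succ, coef_odd, lo_join, hi_join, hi_join,
        coef_basisU m k (by omega), if_pos rfl]
    · rintro ⟨k, rfl⟩
      have hk : k + 1 < 2 ^ m := by omega
      rw [basisU_odd]
      simp only [actL_succ, lo_join, hi_join]
      rw [show 2 * k + 1 + 1 = 2 * (k + 1) by ring]
      simp only [coef_even, lo_join, hi_join]
      have h0 : coef m (k + 1) (basisU m k) = 0 := by
        rw [coef_basisU m k (by omega), if_neg (by omega)]
      obtain ⟨m, rfl⟩ : ∃ m', m = m' + 1 :=
        Nat.exists_eq_succ_of_ne_zero (by rintro rfl; simp at hk)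
      rcases Nat.even_or_odd k with hk2 | hk2
      · refine ⟨.b, ?_⟩
        have h1 : coef (m + 1) (k + 1) (sideAct (m + 1) .b (basisU (m + 1) k)) = 1 :=
          (ih k hk).1 hk2
        have h2 : actL (m + 1) (Label.next .b) (basisU (m + 1) k) = basisU (m + 1) k := by
          obtain ⟨i, rfl⟩ := hk2
          rw [← two_mul, basisU_even, actL_succ, lo_join, hi_join, map_zero]
          rfl
        rw [h1, h2, h0, add_zero]
      · obtain ⟨l', hl'⟩ := (ih k hk).2 hk2
        obtain ⟨l, rfl⟩ := l'.exists_next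
        refine ⟨l, ?_⟩
        have h1 : sideAct (m + 1) l (basisU (m + 1) k) = basisU (m + 1) k := by
          rcases sideAct_eq (m + 1) l with h | h <;> rw [h]
          · obtain ⟨i, rfl⟩ := hk2
            rw [basisU_odd, actA_succ, lo_join, hi_join]
          · rfl
        rw [h1, h0, hl', zero_add]

/-- A submodule that contains `(s - 1) Usub m r` for all generators `s` contains
`Usub m (r + 1)`. -/
theorem Usub_succ_le {m r : ℕ} {W : Submodule (ZMod 2) (U m)}
    (h : ∀ s, ∀ u ∈ Usub m r, actU m s u - u ∈ W) : Usub m (r + 1) ≤ W := by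
  refine Usub_le_of_forall_exists fun j hj hj2 => ?_
  obtain ⟨i, rfl⟩ : ∃ i, j = i + 1 := ⟨j - 1, by omega⟩
  have hmem : basisU m i ∈ Usub m i := basisU_mem (by omega) le_rfl
  have key : ∀ s, coef m (i + 1) (actU m s (basisU m i)) = 1 → ∃ w ∈ W, w ∈ Usub m (i + 1) ∧
      coef m (i + 1) w = 1 := by
    intro s hs
    refine ⟨_, h s _ (Usub_anti m (by omega) hmem), actU_sub_mem s hmem, ?_⟩
    rw [map_sub, hs, coef_basisU m i (by omega), if_neg (by omega), sub_zero]
  rcases Nat.even_or_odd i with hi | hi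
  · exact key none ((exists_coef_act_eq_one m i hj2).1 hi)
  · obtain ⟨l, hl⟩ := (exists_coef_act_eq_one m i hj2).2 hi
    exact key (some l) hl

/-! ### Generators and pairs -/

/-- The directed generator with a given label. -/
def dir (l : Label) : Equiv.Perm Word := (act_involutive l).toPerm

/-- The action of a directed generator below the vertex `0`. -/
def sidePerm : Label → Equiv.Perm Word
  | .b => a
  | .c => 1
  | .d => 1

/-- The generators, where `none` stands for `a`. -/
def gen : Option Label → Equiv.Perm Word
  | none => a
  | some l => dir l

theorem pair_apply_zero (g : Equiv.Perm Word × Equiv.Perm Word) (w : Word) :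
    pair g (0 :: w) = 0 :: g.1 w := rfl

theorem pair_apply_one (g : Equiv.Perm Word × Equiv.Perm Word) (w : Word) :
    pair g (1 :: w) = 1 :: g.2 w := rfl

theorem perm_ext {g h : Equiv.Perm Word} (hn : g [] = h []) (h0 : ∀ w, g (0 :: w) = h (0 :: w))
    (h1 : ∀ w, g (1 :: w) = h (1 :: w)) : g = h := by
  ext1 w
  cases w with
  | nil => exact hn
  | cons s w =>
    rcases ZMod.eq_zero_or_one s with rfl | rfl
    · exact h0 w
    · exact h1 w

theorem pair_injective : Function.Injective pair := by
  rintro ⟨g0, g1⟩ ⟨h0, h1⟩ h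
  have e0 : g0 = h0 := by
    ext1 w
    have := congrArg (fun f : Equiv.Perm Word => f (0 :: w)) h
    simpa [pair_apply_zero] using this
  have e1 : g1 = h1 := by
    ext1 w
    have := congrArg (fun f : Equiv.Perm Word => f (1 :: w)) h
    simpa [pair_apply_one] using this
  rw [e0, e1]

theorem pair_mul (g0 g1 h0 h1 : Equiv.Perm Word) :
    pair (g0, g1) * pair (h0, h1) = pair (g0 * h0, g1 * h1) := by
  rw [← map_mul]; rfl

theorem pair_inv (g0 g1 : Equiv.Perm Word) : (pair (g0, g1))⁻¹ = pair (g0⁻¹, g1⁻¹) := by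
  rw [← map_inv]; rfl

theorem pair_one : pair (1, 1) = 1 := map_one pair

theorem a_mul_self : a * a = 1 := Equiv.ext aFun_involutive

theorem a_inv : a⁻¹ = a := inv_eq_of_mul_eq_one_right a_mul_self

theorem dir_mul_self (l : Label) : dir l * dir l = 1 := Equiv.ext (act_involutive l)

theorem dir_inv (l : Label) : (dir l)⁻¹ = dir l := inv_eq_of_mul_eq_one_right (dir_mul_self l)

theorem a_mul_pair (g0 g1 : Equiv.Perm Word) : a * pair (g0, g1) = pair (g1, g0) * a :=
  perm_ext rfl (fun _ => rfl) (fun _ => rfl)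

theorem a_mul_a_mul (g : Equiv.Perm Word) : a * (a * g) = g := by
  rw [← mul_assoc, a_mul_self, one_mul]

theorem a_conj_pair (g0 g1 : Equiv.Perm Word) : a * pair (g0, g1) * a⁻¹ = pair (g1, g0) := by
  rw [a_mul_pair, mul_inv_cancel_right]

theorem dir_eq (l : Label) : dir l = pair (sidePerm l, dir l.next) := by
  refine perm_ext (by cases l <;> rfl) (fun w => ?_) (fun w => ?_)
  · rw [pair_apply_zero]
    cases l <;> rfl
  · rw [pair_apply_one]
    cases l <;> rfl

theorem bt_eq : bt = pair (a, ct) := dir_eq .b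
theorem ct_eq : ct = pair (1, dt) := dir_eq .c
theorem dt_eq : dt = pair (1, bt) := dir_eq .d

theorem sidePerm_eq (l : Label) : sidePerm l = a ∨ sidePerm l = 1 := by
  cases l
  · exact Or.inl rfl
  · exact Or.inr rfl
  · exact Or.inr rfl

theorem act_comm (l l' : Label) (w : Word) : l.act (l'.act w) = l'.act (l.act w) := by
  have hside : ∀ (l l' : Label) (w : Word), l.side (l'.side w) = l'.side (l.side w) := by
    intro l l' w
    cases l <;> cases l' <;> rfl
  induction w generalizing l l' with
  | nil => cases l <;> cases l' <;> rfl
  | cons s w ih =>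
    rcases ZMod.eq_zero_or_one s with rfl | rfl
    · simp [Label.act, hside l l' w]
    · simp [Label.act, ih l.next l'.next]

theorem dir_comm (l l' : Label) : dir l * dir l' = dir l' * dir l := Equiv.ext (act_comm l l')

theorem gen_inv (s : Option Label) : (gen s)⁻¹ = gen s := by
  cases s
  · exact a_inv
  · exact dir_inv _

theorem Gt_eq : Gt = Subgroup.closure (Set.range gen) := by
  rw [Gt]
  congr 1
  ext g
  simp only [Set.mem_insert_iff, Set.mem_singleton_iff, Set.mem_range]
  constructor
  · rintro (rfl | rfl | rfl | rfl)
    exacts [⟨none, rfl⟩, ⟨some .b, rfl⟩, ⟨some .c, rfl⟩, ⟨some .d, rfl⟩]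
  · rintro ⟨_ | l, rfl⟩
    · exact Or.inl rfl
    · cases l
      exacts [Or.inr (Or.inl rfl), Or.inr (Or.inr (Or.inl rfl)), Or.inr (Or.inr (Or.inr rfl))]

theorem gen_mem (s : Option Label) : gen s ∈ Gt := by
  rw [Gt_eq]
  exact Subgroup.subset_closure ⟨s, rfl⟩

theorem a_mem : a ∈ Gt := gen_mem none

theorem dir_mem (l : Label) : dir l ∈ Gt := gen_mem (some l)

theorem sidePerm_mem (l : Label) : sidePerm l ∈ Gt := by
  rcases sidePerm_eq l with h | h <;> rw [h]
  · exact a_mem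
  · exact Gt.one_mem

/-- Induction over the products of generators. -/
theorem Gt_induction {p : ∀ g : Equiv.Perm Word, g ∈ Gt → Prop} (one : p 1 Gt.one_mem)
    (mul : ∀ s g (hg : g ∈ Gt), p g hg → p (gen s * g) (Gt.mul_mem (gen_mem s) hg))
    {g : Equiv.Perm Word} (hg : g ∈ Gt) : p g hg := by
  have key : ∀ g ∈ Subgroup.closure (Set.range gen), ∃ hg : g ∈ Gt, p g hg := by
    intro g hg
    induction hg using Subgroup.closure_induction_left with
    | one => exact ⟨_, one⟩
    | mul_left s hs g hg ih =>
      obtain ⟨s, rfl⟩ := hs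
      obtain ⟨h, ih⟩ := ih
      exact ⟨_, mul s g h ih⟩
    | inv_mul_cancel s hs g hg ih =>
      obtain ⟨s, rfl⟩ := hs
      obtain ⟨h, ih⟩ := ih
      rw [gen_inv]
      exact ⟨_, mul s g h ih⟩
  exact (key g (Gt_eq ▸ hg)).2

theorem exists_pair {g : Equiv.Perm Word} (hg : g ∈ Gt) : ∃ g0 ∈ Gt, ∃ g1 ∈ Gt,
    g = pair (g0, g1) ∨ g = a * pair (g0, g1) := by
  induction hg using Gt_induction with
  | one => exact ⟨1, Gt.one_mem, 1, Gt.one_mem, Or.inl pair_one.symm⟩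
  | mul s g _ ih =>
    obtain ⟨g0, h0, g1, h1, hg⟩ := ih
    cases s with
    | none =>
      refine ⟨g0, h0, g1, h1, ?_⟩
      rcases hg with rfl | rfl
      · exact Or.inr rfl
      · exact Or.inl (a_mul_a_mul _)
    | some l =>
      change ∃ g0 ∈ Gt, ∃ g1 ∈ Gt, dir l * g = pair (g0, g1) ∨ dir l * g = a * pair (g0, g1)
      rcases hg with rfl | rfl
      · refine ⟨_, Gt.mul_mem (sidePerm_mem l) h0, _, Gt.mul_mem (dir_mem l.next) h1, Or.inl ?_⟩
        rw [dir_eq, pair_mul]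
      · refine ⟨_, Gt.mul_mem (dir_mem l.next) h0, _, Gt.mul_mem (sidePerm_mem l) h1, Or.inr ?_⟩
        rw [dir_eq, ← pair_mul, ← mul_assoc, ← mul_assoc, a_mul_pair]

/-! ### Sections and the parities of the levels -/

/-- The section of a map at a vertex of the first level. -/
def sec (s : ZMod 2) (f : Word → Word) : Word → Word := fun w => (f (s :: w)).tail

/-- The parity of the number of vertices of level `l` at which a map exchanges the subtrees. -/
def eps : ℕ → (Word → Word) → ZMod 2
  | 0, f => (f [0]).headD 0
  | l + 1, f => eps l (sec 0 f) + eps l (sec 1 f)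

theorem eps_zero_pair (g0 g1 : Equiv.Perm Word) : eps 0 (pair (g0, g1)) = 0 := rfl

theorem eps_zero_a_mul_pair (g0 g1 : Equiv.Perm Word) : eps 0 (a * pair (g0, g1) :) = 1 := rfl

theorem eps_succ_pair (l : ℕ) (g0 g1 : Equiv.Perm Word) :
    eps (l + 1) (pair (g0, g1)) = eps l g0 + eps l g1 := rfl

theorem eps_succ_a_mul_pair (l : ℕ) (g0 g1 : Equiv.Perm Word) :
    eps (l + 1) (a * pair (g0, g1) :) = eps l g0 + eps l g1 := rfl

/-- The sections of a product are products of sections, those of `g` being exchanged when `h` moves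
the first letter, and the sum over a level ignores the exchange. -/
theorem eps_mul (l : ℕ) {g h : Equiv.Perm Word} (hg : g ∈ Gt) (hh : h ∈ Gt) :
    eps l (g * h : Equiv.Perm Word) = eps l g + eps l h := by
  induction l generalizing g h with
  | zero =>
    obtain ⟨g0, _, g1, _, rfl | rfl⟩ := exists_pair hg <;>
    obtain ⟨h0, _, h1, _, rfl | rfl⟩ := exists_pair hh
    · rw [pair_mul]; rfl
    · rw [← mul_assoc, ← a_mul_pair, mul_assoc, pair_mul]; rfl
    · rw [mul_assoc, pair_mul]; rfl
    · rw [← mul_assoc, mul_assoc a, ← a_mul_pair, a_mul_a_mul, pair_mul]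
      exact (by decide : (0 : ZMod 2) = 1 + 1)
  | succ l ih =>
    obtain ⟨g0, hg0, g1, hg1, rfl | rfl⟩ := exists_pair hg <;>
    obtain ⟨h0, hh0, h1, hh1, rfl | rfl⟩ := exists_pair hh
    · rw [pair_mul, eps_succ_pair, eps_succ_pair, eps_succ_pair, ih hg0 hh0, ih hg1 hh1]
      abel
    · rw [← mul_assoc, ← a_mul_pair, mul_assoc, pair_mul, eps_succ_pair, eps_succ_a_mul_pair,
        eps_succ_a_mul_pair, ih hg1 hh0, ih hg0 hh1]
      abel
    · rw [mul_assoc, pair_mul, eps_succ_pair, eps_succ_a_mul_pair, eps_succ_a_mul_pair,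
        ih hg0 hh0, ih hg1 hh1]
      abel
    · rw [← mul_assoc, mul_assoc a, ← a_mul_pair, a_mul_a_mul, pair_mul, eps_succ_pair,
        eps_succ_a_mul_pair, eps_succ_a_mul_pair, ih hg1 hh0, ih hg0 hh1]
      abel

theorem eps_one (l : ℕ) : eps l (1 : Equiv.Perm Word) = 0 := by
  induction l with
  | zero => rfl
  | succ l ih => rw [← pair_one, eps_succ_pair, ih, add_zero]

theorem eps_inv (l : ℕ) {g : Equiv.Perm Word} (hg : g ∈ Gt) :
    eps l (g⁻¹ : Equiv.Perm Word) = eps l g := by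
  have := eps_mul l hg (Gt.inv_mem hg)
  rw [mul_inv_cancel, eps_one] at this
  have e : ∀ p q : ZMod 2, 0 = p + q → q = p := by decide
  exact e _ _ this

theorem eps_conj (l : ℕ) {g h : Equiv.Perm Word} (hg : g ∈ Gt) (hh : h ∈ Gt) :
    eps l (g * h * g⁻¹ : Equiv.Perm Word) = eps l h := by
  rw [eps_mul l (Gt.mul_mem hg hh) (Gt.inv_mem hg), eps_mul l hg hh, eps_inv l hg, add_comm,
    ← add_assoc, ZMod.add_self_two, zero_add]

theorem eps_commutator (l : ℕ) {g h : Equiv.Perm Word} (hg : g ∈ Gt) (hh : h ∈ Gt) :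
    eps l (g * h * g⁻¹ * h⁻¹ : Equiv.Perm Word) = 0 := by
  rw [eps_mul l (Gt.mul_mem (Gt.mul_mem hg hh) (Gt.inv_mem hg)) (Gt.inv_mem hh), eps_conj l hg hh,
    eps_inv l hh, ZMod.add_self_two]

theorem eps_zero_a : eps 0 a = 1 := rfl

theorem eps_succ_a (l : ℕ) : eps (l + 1) a = 0 := by
  have e : a = a * pair (1, 1) := by rw [pair_one, mul_one]
  rw [e, eps_succ_a_mul_pair, eps_one, add_zero]

theorem eps_zero_dir (l : Label) : eps 0 (dir l) = 0 := by
  rw [dir_eq, eps_zero_pair]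

theorem eps_succ_dir (n : ℕ) (l : Label) :
    eps (n + 1) (dir l) = eps n (sidePerm l) + eps n (dir l.next) := by
  rw [dir_eq, eps_succ_pair]

theorem eps_id (l : ℕ) : eps l id = 0 := eps_one l

/-- `b̃ = (a, c̃)` exchanges subtrees on level `1`; `d̃ = (1, b̃)` and `c̃ = (1, d̃)` delay this by
one and two levels. So levels `0`, `1`, `2`, `3` detect `a`, `b̃`, `d̃`, `c̃`, in this order. -/
theorem eps_b : eps 0 (dir .b) = 0 ∧ eps 1 (dir .b) = 1 ∧ eps 2 (dir .b) = 0 ∧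
    eps 3 (dir .b) = 0 := by
  simp [eps_succ_dir, eps_zero_dir, sidePerm, Label.next, eps_id, eps_zero_a, eps_succ_a]

theorem eps_c : eps 0 (dir .c) = 0 ∧ eps 1 (dir .c) = 0 ∧ eps 2 (dir .c) = 0 ∧
    eps 3 (dir .c) = 1 := by
  simp [eps_succ_dir, eps_zero_dir, sidePerm, Label.next, eps_id, eps_zero_a]

theorem eps_d : eps 0 (dir .d) = 0 ∧ eps 1 (dir .d) = 0 ∧ eps 2 (dir .d) = 1 ∧
    eps 3 (dir .d) = 0 := by
  simp [eps_succ_dir, eps_zero_dir, sidePerm, Label.next, eps_id, eps_zero_a, eps_succ_a]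

/-! ### Moving a section from one vertex to another -/

/-- Every generator is a section at `1` of an element fixing the first letter: `a b̃ a⁻¹ = (c̃, a)`,
and each directed generator is the successor of another. -/
theorem exists_pair_snd {g : Equiv.Perm Word} (hg : g ∈ Gt) : ∃ k, pair (k, g) ∈ Gt := by
  induction hg using Gt_induction with
  | one => exact ⟨1, by rw [pair_one]; exact Gt.one_mem⟩
  | mul s g _ ih =>
    obtain ⟨k, hk⟩ := ih
    have hs : ∃ k', pair (k', gen s) ∈ Gt := by
      cases s with
      | none =>
        refine ⟨ct, ?_⟩
        have := Gt.mul_mem (Gt.mul_mem a_mem (dir_mem .b)) (Gt.inv_mem a_mem)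
        rwa [dir_eq, a_conj_pair] at this
      | some l =>
        obtain ⟨l, rfl⟩ := l.exists_next
        refine ⟨sidePerm l, ?_⟩
        have := dir_mem l
        rwa [dir_eq] at this
    obtain ⟨k', hk'⟩ := hs
    exact ⟨k' * k, by rw [← pair_mul]; exact Gt.mul_mem hk' hk⟩

theorem atVertex_one (w : Word) : atVertex 1 w = 1 := by
  induction w with
  | nil => rfl
  | cons s w ih => simp [atVertex, ih, pair_one]

theorem atVertex_zero_cons (g : Equiv.Perm Word) (w : Word) :
    atVertex g (0 :: w) = pair (atVertex g w, 1) := rfl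

theorem atVertex_one_cons (g : Equiv.Perm Word) (w : Word) :
    atVertex g (1 :: w) = pair (1, atVertex g w) := rfl

theorem a_conj_atVertex (g : Equiv.Perm Word) (s : ZMod 2) (w : Word) :
    a * atVertex g (s :: w) * a⁻¹ = atVertex g ((s + 1) :: w) := by
  rcases ZMod.eq_zero_or_one s with rfl | rfl
  · rw [atVertex_zero_cons, a_conj_pair, zero_add, atVertex_one_cons]
  · rw [atVertex_one_cons, a_conj_pair, show (1 : ZMod 2) + 1 = 0 from rfl, atVertex_zero_cons]

/-- The group acts transitively on each level, and the stabilizer of a vertex acts on the subtree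
below it as the whole group. -/
theorem exists_conj_atVertex {g : Equiv.Perm Word} (hg : g ∈ Gt) :
    ∀ {σ τ : Word}, σ.length = τ.length → ∃ k ∈ Gt, ∀ h,
      k * atVertex h σ * k⁻¹ = atVertex (g * h * g⁻¹) τ := by
  intro σ
  induction σ with
  | nil =>
    intro τ hτ
    obtain rfl : τ = [] := List.length_eq_zero_iff.1 hτ.symm
    exact ⟨g, hg, fun h => rfl⟩
  | cons s σ ih =>
    rintro (_ | ⟨t, τ⟩) hτ
    · simp at hτ
    obtain ⟨k, hk, hkh⟩ := ih (Nat.succ_injective hτ)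
    have hmove : ∀ s t : ZMod 2, ∃ k ∈ Gt, ∀ h w,
        k * atVertex h (s :: w) * k⁻¹ = atVertex h (t :: w) := by
      intro s t
      by_cases hst : s = t
      · subst hst
        exact ⟨1, Gt.one_mem, fun h w => by simp⟩
      · refine ⟨a, a_mem, fun h w => ?_⟩
        rw [a_conj_atVertex]
        congr 2
        revert s t; decide
    -- Move the vertex below `1`, where `k` is available as a section, act there, and move the
    -- result below `t`.
    obtain ⟨p, hp, hph⟩ := hmove s 1
    obtain ⟨q, hq, hqh⟩ := hmove 1 t
    obtain ⟨j, hj⟩ := exists_pair_snd hk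
    refine ⟨q * pair (j, k) * p, Gt.mul_mem (Gt.mul_mem hq hj) hp, fun h => ?_⟩
    have e : q * pair (j, k) * p * atVertex h (s :: σ) * (q * pair (j, k) * p)⁻¹ =
        q * (pair (j, k) * (p * atVertex h (s :: σ) * p⁻¹) * (pair (j, k))⁻¹) * q⁻¹ := by
      group
    rw [e, hph, atVertex_one_cons, pair_inv, pair_mul, pair_mul, hkh, mul_one, mul_inv_cancel,
      ← atVertex_one_cons, hqh]

/-! ### Subgroups normalized by the generators -/

/-- `Q` is normalized by the generators, hence by the whole group. -/
def ConjInv (Q : Subgroup (Equiv.Perm Word)) : Prop :=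
  ∀ s, ∀ q ∈ Q, gen s * q * (gen s)⁻¹ ∈ Q

theorem ConjInv.conj_mem {Q : Subgroup (Equiv.Perm Word)} (h : ConjInv Q) {g : Equiv.Perm Word}
    (hg : g ∈ Gt) : ∀ q ∈ Q, g * q * g⁻¹ ∈ Q := by
  induction hg using Gt_induction with
  | one => intro q hq; simpa using hq
  | mul s g _ ih =>
    intro q hq
    have := h s _ (ih q hq)
    simpa only [mul_inv_rev, mul_assoc] using this

theorem ConjInv.sup {Q R : Subgroup (Equiv.Perm Word)} (hQ : ConjInv Q) (hR : ConjInv R) :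
    ConjInv (Q ⊔ R) := by
  intro s q hq
  have : Q ⊔ R ≤ (Q ⊔ R).comap (MulAut.conj (gen s)).toMonoidHom :=
    sup_le (fun q hq => (le_sup_left : Q ≤ Q ⊔ R) (hQ s q hq))
      (fun q hq => (le_sup_right : R ≤ Q ⊔ R) (hR s q hq))
  exact this hq

theorem ConjInv.sup_closure_singleton {Q : Subgroup (Equiv.Perm Word)} (hQ : ConjInv Q)
    {g : Equiv.Perm Word} (hg : ∀ s, gen s * g * (gen s)⁻¹ * g⁻¹ ∈ Q) :
    ConjInv (Q ⊔ Subgroup.closure {g}) := by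
  intro s q hq
  have : Q ⊔ Subgroup.closure {g} ≤
      (Q ⊔ Subgroup.closure {g}).comap (MulAut.conj (gen s)).toMonoidHom := by
    refine sup_le (fun q hq => (le_sup_left : Q ≤ _) (hQ s q hq)) ((Subgroup.closure_le _).2 ?_)
    rw [Set.singleton_subset_iff]
    have h1 := (le_sup_left : Q ≤ Q ⊔ Subgroup.closure {g}) (hg s)
    have h2 := (le_sup_right : _ ≤ Q ⊔ Subgroup.closure {g})
      (Subgroup.subset_closure (Set.mem_singleton g))
    have := Subgroup.mul_mem _ h1 h2
    simpa using this
  exact this hq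

theorem normalClosureGt_le {S : Set (Equiv.Perm Word)} {Q : Subgroup (Equiv.Perm Word)}
    (hQ : ConjInv Q) (h : S ⊆ Q) : normalClosureGt S ≤ Q := by
  refine (Subgroup.closure_le _).2 ?_
  rintro _ ⟨g, hg, s, hs, rfl⟩
  exact hQ.conj_mem hg s (h hs)

theorem subset_normalClosureGt (S : Set (Equiv.Perm Word)) : S ⊆ normalClosureGt S :=
  fun s hs => Subgroup.subset_closure ⟨1, Gt.one_mem, s, hs, by simp⟩

theorem conjInv_normalClosureGt (S : Set (Equiv.Perm Word)) : ConjInv (normalClosureGt S) := by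
  intro s q hq
  have : normalClosureGt S ≤ (normalClosureGt S).comap (MulAut.conj (gen s)).toMonoidHom := by
    refine (Subgroup.closure_le _).2 ?_
    rintro _ ⟨g, hg, q, hq, rfl⟩
    refine Subgroup.subset_closure ⟨gen s * g, Gt.mul_mem (gen_mem s) hg, q, hq, ?_⟩
    change gen s * (g * q * g⁻¹) * (gen s)⁻¹ = _
    group
  exact this hq

theorem conjInv_Gt : ConjInv Gt := fun s _ hq =>
  Gt.mul_mem (Gt.mul_mem (gen_mem s) hq) (Gt.inv_mem (gen_mem s))

/-! ### Powers -/

theorem mem_power_succ {Q : Subgroup (Equiv.Perm Word)} {m : ℕ} {g : Equiv.Perm Word} :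
    g ∈ power Q (m + 1) ↔ ∃ g0 ∈ power Q m, ∃ g1 ∈ power Q m, g = pair (g0, g1) := by
  constructor
  · rintro ⟨⟨g0, g1⟩, ⟨h0, h1⟩, rfl⟩
    exact ⟨g0, h0, g1, h1, rfl⟩
  · rintro ⟨g0, h0, g1, h1, rfl⟩
    exact ⟨(g0, g1), ⟨h0, h1⟩, rfl⟩

theorem pair_mem_power {Q : Subgroup (Equiv.Perm Word)} {m : ℕ} {g0 g1 : Equiv.Perm Word}
    (h0 : g0 ∈ power Q m) (h1 : g1 ∈ power Q m) : pair (g0, g1) ∈ power Q (m + 1) :=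
  mem_power_succ.2 ⟨g0, h0, g1, h1, rfl⟩

theorem pair_mem_power_iff {Q : Subgroup (Equiv.Perm Word)} {m : ℕ} {g0 g1 : Equiv.Perm Word} :
    pair (g0, g1) ∈ power Q (m + 1) ↔ g0 ∈ power Q m ∧ g1 ∈ power Q m := by
  refine ⟨fun h => ?_, fun h => pair_mem_power h.1 h.2⟩
  obtain ⟨h0, hh0, h1, hh1, e⟩ := mem_power_succ.1 h
  have := pair_injective e
  simp only [Prod.mk.injEq] at this
  rw [this.1, this.2]
  exact ⟨hh0, hh1⟩

theorem power_mono {Q R : Subgroup (Equiv.Perm Word)} (h : Q ≤ R) (m : ℕ) :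
    power Q m ≤ power R m := by
  induction m with
  | zero => exact h
  | succ m ih =>
    intro g hg
    obtain ⟨g0, h0, g1, h1, rfl⟩ := mem_power_succ.1 hg
    exact pair_mem_power (ih h0) (ih h1)

theorem power_power_one (Q : Subgroup (Equiv.Perm Word)) (m : ℕ) :
    power (power Q 1) m = power Q (m + 1) := by
  induction m with
  | zero => rfl
  | succ m ih =>
    ext g
    rw [mem_power_succ, mem_power_succ, ih]

theorem power_sup (Q R : Subgroup (Equiv.Perm Word)) (m : ℕ) :
    power (Q ⊔ R) m = power Q m ⊔ power R m := by
  refine le_antisymm ?_ (sup_le (power_mono le_sup_left m) (power_mono le_sup_right m))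
  induction m with
  | zero => exact le_rfl
  | succ m ih =>
    have h0 : ∀ g ∈ power Q m ⊔ power R m, pair (g, 1) ∈ power Q (m + 1) ⊔ power R (m + 1) := by
      intro g hg
      have : power Q m ⊔ power R m ≤ (power Q (m + 1) ⊔ power R (m + 1)).comap
          (pair.comp (MonoidHom.inl _ _)) :=
        sup_le (fun g hg => (le_sup_left : power Q (m + 1) ≤ _)
            (pair_mem_power hg (Subgroup.one_mem _)))
          (fun g hg => (le_sup_right : power R (m + 1) ≤ _)
            (pair_mem_power hg (Subgroup.one_mem _)))
      exact this hg
    have h1 : ∀ g ∈ power Q m ⊔ power R m, pair (1, g) ∈ power Q (m + 1) ⊔ power R (m + 1) := by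
      intro g hg
      have : power Q m ⊔ power R m ≤ (power Q (m + 1) ⊔ power R (m + 1)).comap
          (pair.comp (MonoidHom.inr _ _)) :=
        sup_le (fun g hg => (le_sup_left : power Q (m + 1) ≤ _)
            (pair_mem_power (Subgroup.one_mem _) hg))
          (fun g hg => (le_sup_right : power R (m + 1) ≤ _)
            (pair_mem_power (Subgroup.one_mem _) hg))
      exact this hg
    intro g hg
    obtain ⟨g0, hg0, g1, hg1, rfl⟩ := mem_power_succ.1 hg
    have e : pair (g0, g1) = pair (g0, 1) * pair (1, g1) := by rw [pair_mul, mul_one, one_mul]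
    rw [e]
    exact Subgroup.mul_mem _ (h0 _ (ih hg0)) (h1 _ (ih hg1))

theorem dir_conj_pair (l : Label) (g0 g1 : Equiv.Perm Word) :
    dir l * pair (g0, g1) * (dir l)⁻¹ =
      pair (sidePerm l * g0 * (sidePerm l)⁻¹, dir l.next * g1 * (dir l.next)⁻¹) := by
  rw [dir_eq, pair_inv, pair_mul, pair_mul]

theorem ConjInv.sidePerm_conj {Q : Subgroup (Equiv.Perm Word)} (h : ConjInv Q) (l : Label)
    {q : Equiv.Perm Word} (hq : q ∈ Q) : sidePerm l * q * (sidePerm l)⁻¹ ∈ Q :=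
  h.conj_mem (sidePerm_mem l) q hq

theorem ConjInv.power {Q : Subgroup (Equiv.Perm Word)} (h : ConjInv Q) (m : ℕ) :
    ConjInv (power Q m) := by
  induction m with
  | zero => exact h
  | succ m ih =>
    intro s g hg
    obtain ⟨g0, h0, g1, h1, rfl⟩ := mem_power_succ.1 hg
    cases s with
    | none => exact (a_conj_pair g0 g1).symm ▸ pair_mem_power h1 h0
    | some l =>
      exact (dir_conj_pair l g0 g1).symm ▸
        pair_mem_power (ih.sidePerm_conj l h0) (ih (some l.next) _ h1)

theorem atVertex_mul (p q : Equiv.Perm Word) (w : Word) :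
    atVertex (p * q) w = atVertex p w * atVertex q w := by
  induction w with
  | nil => rfl
  | cons s w ih =>
    rcases ZMod.eq_zero_or_one s with rfl | rfl
    · simp only [atVertex_zero_cons, pair_mul, ih, mul_one]
    · simp only [atVertex_one_cons, pair_mul, ih, mul_one]

theorem atVertex_inv (p : Equiv.Perm Word) (w : Word) : atVertex p⁻¹ w = (atVertex p w)⁻¹ := by
  rw [eq_inv_iff_mul_eq_one, ← atVertex_mul, inv_mul_cancel, atVertex_one]

/-- A subgroup that is normalized by the group and contains one copy of each `s ∈ S` on a level
contains the power of the normal closure of `S`. -/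
theorem power_normalClosureGt_le {S : Set (Equiv.Perm Word)} {R : Subgroup (Equiv.Perm Word)}
    (hR : ConjInv R) {m : ℕ} (h : ∀ s ∈ S, ∃ σ : Word, σ.length = m ∧ atVertex s σ ∈ R) :
    power (normalClosureGt S) m ≤ R := by
  have key : ∀ τ : Word, τ.length = m → ∀ q ∈ normalClosureGt S, atVertex q τ ∈ R := by
    intro τ hτ q hq
    induction hq using Subgroup.closure_induction with
    | mem q hq =>
      obtain ⟨g, hg, s, hs, rfl⟩ := hq
      obtain ⟨σ, hσ, hσR⟩ := h s hs
      obtain ⟨k, hk, hkh⟩ := exists_conj_atVertex hg (hσ.trans hτ.symm)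
      rw [← hkh]
      exact hR.conj_mem hk _ hσR
    | one => rw [atVertex_one]; exact R.one_mem
    | mul p q _ _ hp hq => rw [atVertex_mul]; exact R.mul_mem hp hq
    | inv p _ hp => rw [atVertex_inv]; exact R.inv_mem hp
  have key2 : ∀ (m : ℕ) (Q R : Subgroup (Equiv.Perm Word)),
      (∀ τ : Word, τ.length = m → ∀ q ∈ Q, atVertex q τ ∈ R) → power Q m ≤ R := by
    clear key h hR
    intro m
    induction m with
    | zero => exact fun Q R h q hq => h [] rfl q hq
    | succ m ih =>
      intro Q R h g hg
      obtain ⟨g0, h0, g1, h1, rfl⟩ := mem_power_succ.1 hg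
      have i0 := ih Q (R.comap (pair.comp (MonoidHom.inl _ _)))
        (fun τ hτ q hq => h (0 :: τ) (by simp [hτ]) q hq) h0
      have i1 := ih Q (R.comap (pair.comp (MonoidHom.inr _ _)))
        (fun τ hτ q hq => h (1 :: τ) (by simp [hτ]) q hq) h1
      have e : pair (g0, g1) = pair (g0, 1) * pair (1, g1) := by rw [pair_mul, mul_one, one_mul]
      rw [e]
      exact R.mul_mem i0 i1
  exact key2 m _ R key

/-! ### The commutators `x`, `y`, `z` -/

/-- `z = [a, c̃]`. -/
def z : Equiv.Perm Word := a * ct * a⁻¹ * ct⁻¹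

theorem dir_b : dir .b = bt := rfl
theorem dir_c : dir .c = ct := rfl
theorem dir_d : dir .d = dt := rfl

theorem bt_inv : bt⁻¹ = bt := dir_inv .b
theorem ct_inv : ct⁻¹ = ct := dir_inv .c
theorem dt_inv : dt⁻¹ = dt := dir_inv .d

theorem x_eq : x = pair (ct * a, a * ct) := by
  rw [x, bt_eq, a_conj_pair, pair_inv, pair_mul, a_inv, ct_inv]

theorem y_eq : y = pair (bt, bt) := by
  rw [y, dt_eq, a_conj_pair, pair_inv, pair_mul, bt_inv, inv_one, mul_one, one_mul]

theorem z_eq : z = pair (dt, dt) := by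
  rw [z, ct_eq, a_conj_pair, pair_inv, pair_mul, dt_inv, inv_one, mul_one, one_mul]

/-- The sections of `x²` are `(c̃a)²` and `(ac̃)² = z`; they agree because `z = (d̃, d̃)` commutes
with `a`. This is the source of the third summand: `chi 2` vanishes on `K̃` but not on `z`. -/
theorem x_mul_x : x * x = pair (z, z) := by
  have h1 : a * ct * (a * ct) = z := by rw [z, a_inv, ct_inv]; group
  have h2 : ct * a * (ct * a) = z := by
    have e : a * z * a = z := by
      conv_lhs => rw [z_eq, ← a_inv, a_inv, a_mul_pair, mul_assoc, a_mul_self, mul_one]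
      rw [z_eq]
    have e2 : ct * a * (ct * a) = a * (a * ct * (a * ct)) * a := by
      simp only [mul_assoc, a_mul_a_mul]
    rw [e2, h1, e]
  rw [x_eq, pair_mul, h1, h2]

theorem y_mul_y : y * y = 1 := by
  rw [y_eq, pair_mul, ← dir_b, dir_mul_self, pair_one]

theorem z_mul_z : z * z = 1 := by
  rw [z_eq, pair_mul, ← dir_d, dir_mul_self, pair_one]

theorem x_mem_Gt : x ∈ Gt := Gt.mul_mem (Gt.mul_mem (Gt.mul_mem a_mem (dir_mem .b))
  (Gt.inv_mem a_mem)) (Gt.inv_mem (dir_mem .b))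
theorem y_mem_Gt : y ∈ Gt := Gt.mul_mem (Gt.mul_mem (Gt.mul_mem a_mem (dir_mem .d))
  (Gt.inv_mem a_mem)) (Gt.inv_mem (dir_mem .d))
theorem z_mem_Gt : z ∈ Gt := Gt.mul_mem (Gt.mul_mem (Gt.mul_mem a_mem (dir_mem .c))
  (Gt.inv_mem a_mem)) (Gt.inv_mem (dir_mem .c))

/-- Each of the involutions `a`, `b̃` inverts their commutator `x` by conjugation. -/
theorem a_comm_x : a * x * a⁻¹ * x⁻¹ = (x * x)⁻¹ := by
  rw [x, mul_inv_rev, a_inv, bt_inv]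
  simp only [mul_inv_rev, a_inv, bt_inv]
  simp only [mul_assoc, a_mul_a_mul]

theorem b_comm_x : bt * x * bt⁻¹ * x⁻¹ = (x * x)⁻¹ := by
  have hb : ∀ g, bt * (bt * g) = g := fun g => by
    rw [← mul_assoc, ← dir_b, dir_mul_self, one_mul]
  rw [x, mul_inv_rev, a_inv, bt_inv]
  simp only [mul_inv_rev, a_inv, bt_inv]
  simp only [mul_assoc, hb]

/-- `[l, l' a] = [l, a]` up to a conjugation that is trivial as `l` and `l'` commute. -/
theorem dir_comm_x_snd (l : Label) : dir l * (a * ct) * (dir l)⁻¹ * (a * ct)⁻¹ =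
    (a * dir l * a⁻¹ * (dir l)⁻¹)⁻¹ := by
  have h : ct * (dir l * ct) = dir l := by
    rw [← dir_c, dir_comm l, ← mul_assoc, dir_mul_self, one_mul]
  simp only [mul_inv_rev, dir_inv, a_inv, ct_inv, mul_assoc]
  rw [← mul_assoc (dir l) ct a, ← mul_assoc ct, h]

/-- As `x = (c̃a, ac̃)` and `c̃ = (1, d̃)`, only the section at `1` contributes, namely `[d̃, ac̃] =
[d̃, a]`. Replacing `c̃` by `d̃ = (1, b̃)` gives a copy of `x⁻¹`. -/
theorem c_comm_x : ct * x * ct⁻¹ * x⁻¹ = pair (1, y⁻¹) := by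
  have := dir_comm_x_snd .d
  rw [dir_d, ← y] at this
  rw [x_eq, ← dir_c, dir_conj_pair, pair_inv, pair_mul, ← this]
  simp [sidePerm, Label.next, dir_c, dir_d]

theorem d_comm_x : dt * x * dt⁻¹ * x⁻¹ = pair (1, x⁻¹) := by
  have := dir_comm_x_snd .b
  rw [dir_b, ← x] at this
  have h : dt * x * dt⁻¹ * x⁻¹ = pair (1, bt * (a * ct) * bt⁻¹ * (a * ct)⁻¹) := by
    rw [x_eq, ← dir_d, dir_conj_pair, pair_inv, pair_mul]
    simp [sidePerm, Label.next, dir_b]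
  rw [h, this]

theorem comm_pair_dir (s l : Label) : dir s * pair (dir l, dir l) * (dir s)⁻¹ *
    (pair (dir l, dir l))⁻¹ = pair (sidePerm s * dir l * (sidePerm s)⁻¹ * (dir l)⁻¹, 1) := by
  rw [dir_conj_pair, pair_inv, pair_mul, dir_comm s.next l, mul_inv_cancel_right, mul_inv_cancel]

theorem a_comm_pair_self (g : Equiv.Perm Word) :
    a * pair (g, g) * a⁻¹ * (pair (g, g))⁻¹ = 1 := by
  rw [a_conj_pair, mul_inv_cancel]

/-- `y = (b̃, b̃)` commutes with `a`, and directed generators commute with each other, so only the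
section `a` of `b̃` at `0` is felt. -/
theorem gen_comm_y (s : Option Label) : gen s * y * (gen s)⁻¹ * y⁻¹ = 1 ∨
    gen s * y * (gen s)⁻¹ * y⁻¹ = pair (x, 1) := by
  rw [y_eq]
  rcases s with _ | s
  · exact Or.inl (a_comm_pair_self bt)
  · change dir s * _ * (dir s)⁻¹ * _ = _ ∨ dir s * _ * (dir s)⁻¹ * _ = _
    rw [← dir_b, comm_pair_dir]
    cases s
    · exact Or.inr rfl
    · exact Or.inl (by rw [sidePerm, one_mul, inv_one, mul_one, mul_inv_cancel, pair_one])
    · exact Or.inl (by rw [sidePerm, one_mul, inv_one, mul_one, mul_inv_cancel, pair_one])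

theorem gen_comm_z (s : Option Label) : gen s * z * (gen s)⁻¹ * z⁻¹ = 1 ∨
    gen s * z * (gen s)⁻¹ * z⁻¹ = pair (y, 1) := by
  rw [z_eq]
  rcases s with _ | s
  · exact Or.inl (a_comm_pair_self dt)
  · change dir s * _ * (dir s)⁻¹ * _ = _ ∨ dir s * _ * (dir s)⁻¹ * _ = _
    rw [← dir_d, comm_pair_dir]
    cases s
    · exact Or.inr rfl
    · exact Or.inl (by rw [sidePerm, one_mul, inv_one, mul_one, mul_inv_cancel, pair_one])
    · exact Or.inl (by rw [sidePerm, one_mul, inv_one, mul_one, mul_inv_cancel, pair_one])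

/-! ### The subgroups `M̃ ≥ K̃ ≥ Ñ₁ ≥ T̃` -/

/-- `M̃ = ⟨x, y, z⟩^G̃`. -/
def Mt : Subgroup (Equiv.Perm Word) := normalClosureGt {x, y, z}

theorem conjInv_Mt : ConjInv Mt := conjInv_normalClosureGt _
theorem conjInv_Kt : ConjInv Kt := conjInv_normalClosureGt _
theorem conjInv_Tt : ConjInv Tt := conjInv_normalClosureGt _

theorem x_mem_Kt : x ∈ Kt := subset_normalClosureGt _ (by simp)
theorem y_mem_Kt : y ∈ Kt := subset_normalClosureGt _ (by simp)
theorem z_mem_Mt : z ∈ Mt := subset_normalClosureGt _ (by simp)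

theorem Kt_le_Mt : Kt ≤ Mt := by
  refine normalClosureGt_le conjInv_Mt ?_
  rintro _ (rfl | rfl)
  · exact subset_normalClosureGt _ (by simp)
  · exact subset_normalClosureGt _ (by simp)

theorem Mt_le_Gt : Mt ≤ Gt := by
  refine normalClosureGt_le conjInv_Gt ?_
  rintro _ (rfl | rfl | rfl)
  exacts [x_mem_Gt, y_mem_Gt, z_mem_Gt]

theorem x_mul_x_mem_Tt : x * x ∈ Tt := by
  rw [← pow_two]
  exact subset_normalClosureGt _ rfl

theorem Tt_le_of {Q : Subgroup (Equiv.Perm Word)} (hQ : ConjInv Q) (h : x * x ∈ Q) : Tt ≤ Q := by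
  refine normalClosureGt_le hQ ?_
  rintro _ rfl
  rwa [pow_two]

theorem Tt_le_Kt : Tt ≤ Kt := Tt_le_of conjInv_Kt (Kt.mul_mem x_mem_Kt x_mem_Kt)

/-- The branching property: `d_comm_x` and `c_comm_x` place single copies of `x` and `y` on level
`1` inside `K̃`, and conjugation spreads them. -/
theorem power_Kt_one_le : power Kt 1 ≤ Kt := by
  refine power_normalClosureGt_le conjInv_Kt ?_
  rintro _ (rfl | rfl)
  · refine ⟨[1], rfl, ?_⟩
    have h : pair (1, x⁻¹) ∈ Kt := by
      rw [← d_comm_x]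
      exact Kt.mul_mem (conjInv_Kt (some .d) _ x_mem_Kt) (Kt.inv_mem x_mem_Kt)
    have := Kt.inv_mem h
    rwa [pair_inv, inv_inv, inv_one] at this
  · refine ⟨[1], rfl, ?_⟩
    have h : pair (1, y⁻¹) ∈ Kt := by
      rw [← c_comm_x]
      exact Kt.mul_mem (conjInv_Kt (some .c) _ x_mem_Kt) (Kt.inv_mem x_mem_Kt)
    have := Kt.inv_mem h
    rwa [pair_inv, inv_inv, inv_one] at this

theorem Nt_one_eq : Nt 1 = power Kt 1 ⊔ Tt := rfl

/-- Self-similarity: reduces statements about `Ñ_m` to `Ñ₁` by induction on the level. -/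
theorem Nt_succ (m : ℕ) : Nt (m + 1) = power (Nt 1) m := by
  rw [Nt_one_eq, power_sup, power_power_one]
  rfl

theorem conjInv_Nt_one : ConjInv (Nt 1) := (conjInv_Kt.power 1).sup conjInv_Tt

theorem Nt_one_le_Kt : Nt 1 ≤ Kt := sup_le power_Kt_one_le Tt_le_Kt

theorem Nt_one_le_Mt : Nt 1 ≤ Mt := Nt_one_le_Kt.trans Kt_le_Mt

theorem pair_mem_Nt_one {p q : Equiv.Perm Word} (hp : p ∈ Kt) (hq : q ∈ Kt) :
    pair (p, q) ∈ Nt 1 :=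
  (le_sup_left : power Kt 1 ≤ Nt 1) (pair_mem_power hp hq)

theorem x_mul_x_mem : x * x ∈ Nt 1 := (le_sup_right : Tt ≤ Nt 1) x_mul_x_mem_Tt

theorem power_Nt_one_one_le : power (Nt 1) 1 ≤ Nt 1 := fun g hg => by
  obtain ⟨g0, h0, g1, h1, rfl⟩ := mem_power_succ.1 hg
  exact pair_mem_Nt_one (Nt_one_le_Kt h0) (Nt_one_le_Kt h1)

theorem Nt_succ_le {m : ℕ} (hm : 1 ≤ m) : Nt (m + 1) ≤ Nt m := by
  obtain ⟨k, rfl⟩ : ∃ k, m = k + 1 := ⟨m - 1, by omega⟩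
  rw [Nt_succ (k + 1), Nt_succ k, ← power_power_one]
  exact power_mono power_Nt_one_one_le k

theorem eps_eq_zero_of_mem_Mt {g : Equiv.Perm Word} (hg : g ∈ Mt) (l : ℕ) : eps l g = 0 := by
  have hS : ∀ s ∈ ({x, y, z} : Set (Equiv.Perm Word)), s ∈ Gt ∧ eps l s = 0 := by
    rintro _ (rfl | rfl | rfl)
    · exact ⟨x_mem_Gt, eps_commutator l a_mem (dir_mem .b)⟩
    · exact ⟨y_mem_Gt, eps_commutator l a_mem (dir_mem .d)⟩
    · exact ⟨z_mem_Gt, eps_commutator l a_mem (dir_mem .c)⟩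
  have key : g ∈ Gt ∧ eps l g = 0 := by
    induction hg using Subgroup.closure_induction with
    | mem g hg =>
      obtain ⟨k, hk, s, hs, rfl⟩ := hg
      exact ⟨Gt.mul_mem (Gt.mul_mem hk (hS s hs).1) (Gt.inv_mem hk), by
        rw [eps_conj l hk (hS s hs).1, (hS s hs).2]⟩
    | one => exact ⟨Gt.one_mem, eps_one l⟩
    | mul p q _ _ hp hq =>
      exact ⟨Gt.mul_mem hp.1 hq.1, by rw [eps_mul l hp.1 hq.1, hp.2, hq.2, add_zero]⟩
    | inv p _ hp => exact ⟨Gt.inv_mem hp.1, by rw [eps_inv l hp.1, hp.2]⟩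
  exact key.2

theorem exists_pair_of_mem_Mt {g : Equiv.Perm Word} (hg : g ∈ Mt) :
    ∃ g0 ∈ Gt, ∃ g1 ∈ Gt, g = pair (g0, g1) := by
  obtain ⟨g0, h0, g1, h1, rfl | rfl⟩ := exists_pair (Mt_le_Gt hg)
  · exact ⟨g0, h0, g1, h1, rfl⟩
  · have := eps_eq_zero_of_mem_Mt hg 0
    rw [eps_zero_a_mul_pair] at this
    exact absurd this (by decide)

/-! ### The characters of `M̃` -/

/-- The parity of level `i` of the section at `0`. -/
def chi (i : ℕ) (f : Word → Word) : ZMod 2 := eps i (sec 0 f)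

theorem chi_pair (i : ℕ) (g0 g1 : Equiv.Perm Word) : chi i (pair (g0, g1)) = eps i g0 := rfl

/-- `e` is additive on `Q`. -/
def AddOn (Q : Subgroup (Equiv.Perm Word)) (e : (Word → Word) → ZMod 2) : Prop :=
  ∀ g ∈ Q, ∀ h ∈ Q, e (g * h : Equiv.Perm Word) = e g + e h

/-- `e` is invariant on `Q` under conjugation by the generators. -/
def InvOn (Q : Subgroup (Equiv.Perm Word)) (e : (Word → Word) → ZMod 2) : Prop :=
  ∀ s, ∀ q ∈ Q, e (gen s * q * (gen s)⁻¹ : Equiv.Perm Word) = e q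

theorem AddOn.map_one {Q : Subgroup (Equiv.Perm Word)} {e : (Word → Word) → ZMod 2}
    (h : AddOn Q e) : e (1 : Equiv.Perm Word) = 0 := by
  have := h 1 Q.one_mem 1 Q.one_mem
  rw [mul_one] at this
  exact left_eq_add.1 this

theorem AddOn.map_inv {Q : Subgroup (Equiv.Perm Word)} {e : (Word → Word) → ZMod 2}
    (h : AddOn Q e) {g : Equiv.Perm Word} (hg : g ∈ Q) : e (g⁻¹ : Equiv.Perm Word) = e g := by
  have := h g hg _ (Q.inv_mem hg)
  rw [mul_inv_cancel, h.map_one] at this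
  have e : ∀ p q : ZMod 2, 0 = p + q → q = p := by decide
  exact e _ _ this

theorem InvOn.conj {Q : Subgroup (Equiv.Perm Word)} {e : (Word → Word) → ZMod 2}
    (h : InvOn Q e) (hQ : ConjInv Q) {g : Equiv.Perm Word} (hg : g ∈ Gt) :
    ∀ q ∈ Q, e (g * q * g⁻¹ : Equiv.Perm Word) = e q := by
  induction hg using Gt_induction with
  | one => intro q _; simp
  | mul s g hg ih =>
    intro q hq
    rw [← ih q hq, ← h s _ (hQ.conj_mem hg q hq)]
    simp only [mul_inv_rev, mul_assoc]

theorem addOn_chi (i : ℕ) : AddOn Mt (chi i) := by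
  intro g hg h hh
  obtain ⟨g0, hg0, g1, hg1, rfl⟩ := exists_pair_of_mem_Mt hg
  obtain ⟨h0, hh0, h1, hh1, rfl⟩ := exists_pair_of_mem_Mt hh
  rw [pair_mul, chi_pair, chi_pair, chi_pair, eps_mul i hg0 hh0]

/-- Conjugation by `a` exchanges the two sections; their parities agree because the total parity of
level `i + 1` vanishes on `M̃`. -/
theorem invOn_chi (i : ℕ) : InvOn Mt (chi i) := by
  intro s g hg
  have h0 := eps_eq_zero_of_mem_Mt hg (i + 1)
  obtain ⟨g0, hg0, g1, hg1, rfl⟩ := exists_pair_of_mem_Mt hg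
  cases s with
  | none =>
    rw [gen, a_conj_pair, chi_pair, chi_pair]
    rw [eps_succ_pair] at h0
    have e : ∀ p q : ZMod 2, p + q = 0 → q = p := by decide
    exact e _ _ h0
  | some l => rw [gen, dir_conj_pair, chi_pair, chi_pair, eps_conj i (sidePerm_mem l) hg0]

theorem chi_x : chi 0 x = 1 ∧ chi 1 x = 0 ∧ chi 2 x = 0 := by
  have h : ∀ i, chi i x = eps i ct + eps i a := fun i => by
    rw [x_eq, chi_pair]
    exact eps_mul i (dir_mem .c) a_mem
  have hc := eps_c
  rw [dir_c] at hc
  rw [h, h, h, hc.1, hc.2.1, hc.2.2.1, eps_zero_a, eps_succ_a, eps_succ_a]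
  simp

theorem chi_y : chi 0 y = 0 ∧ chi 1 y = 1 ∧ chi 2 y = 0 := by
  have h : ∀ i, chi i y = eps i bt := fun i => by rw [y_eq, chi_pair]
  have hb := eps_b
  rw [dir_b] at hb
  rw [h, h, h, hb.1, hb.2.1, hb.2.2.1]
  simp

theorem chi_z : chi 0 z = 0 ∧ chi 1 z = 0 ∧ chi 2 z = 1 := by
  have h : ∀ i, chi i z = eps i dt := fun i => by rw [z_eq, chi_pair]
  have hd := eps_d
  rw [dir_d] at hd
  rw [h, h, h, hd.1, hd.2.1, hd.2.2.1]
  simp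

/-- The invariant character `chi 2` vanishes on `x` and `y`; it measures the exponent of `z` in `M̃`
modulo `Ñ₁`. -/
theorem chi_two_of_mem_Kt {g : Equiv.Perm Word} (hg : g ∈ Kt) : chi 2 g = 0 := by
  have hS : ∀ s ∈ ({x, y} : Set (Equiv.Perm Word)), s ∈ Mt ∧ chi 2 s = 0 := by
    rintro _ (rfl | rfl)
    · exact ⟨Kt_le_Mt x_mem_Kt, chi_x.2.2⟩
    · exact ⟨Kt_le_Mt y_mem_Kt, chi_y.2.2⟩
  have key : g ∈ Mt ∧ chi 2 g = 0 := by
    induction hg using Subgroup.closure_induction with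
    | mem g hg =>
      obtain ⟨k, hk, s, hs, rfl⟩ := hg
      exact ⟨conjInv_Mt.conj_mem hk _ (hS s hs).1, by
        rw [(invOn_chi 2).conj conjInv_Mt hk _ (hS s hs).1, (hS s hs).2]⟩
    | one => exact ⟨Mt.one_mem, (addOn_chi 2).map_one⟩
    | mul p q _ _ hp hq =>
      exact ⟨Mt.mul_mem hp.1 hq.1, by rw [addOn_chi 2 p hp.1 q hq.1, hp.2, hq.2, add_zero]⟩
    | inv p _ hp => exact ⟨Mt.inv_mem hp.1, by rw [(addOn_chi 2).map_inv hp.1, hp.2]⟩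
  exact key.2

/-- The pairs of elements of `M̃` with equal values of `chi 2`. -/
def fiberMt : Subgroup (Equiv.Perm Word) where
  carrier := {g | ∃ g0 ∈ Mt, ∃ g1 ∈ Mt, g = pair (g0, g1) ∧ chi 2 g0 = chi 2 g1}
  one_mem' := ⟨1, Mt.one_mem, 1, Mt.one_mem, pair_one.symm, rfl⟩
  mul_mem' := by
    rintro _ _ ⟨g0, hg0, g1, hg1, rfl, e⟩ ⟨h0, hh0, h1, hh1, rfl, e'⟩
    refine ⟨_, Mt.mul_mem hg0 hh0, _, Mt.mul_mem hg1 hh1, pair_mul _ _ _ _, ?_⟩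
    rw [addOn_chi 2 _ hg0 _ hh0, addOn_chi 2 _ hg1 _ hh1, e, e']
  inv_mem' := by
    rintro _ ⟨g0, hg0, g1, hg1, rfl, e⟩
    refine ⟨_, Mt.inv_mem hg0, _, Mt.inv_mem hg1, pair_inv _ _, ?_⟩
    rw [(addOn_chi 2).map_inv hg0, (addOn_chi 2).map_inv hg1, e]

theorem conjInv_fiberMt : ConjInv fiberMt := by
  rintro s _ ⟨g0, hg0, g1, hg1, rfl, e⟩
  cases s with
  | none => exact ⟨g1, hg1, g0, hg0, a_conj_pair _ _, e.symm⟩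
  | some l =>
    refine ⟨_, conjInv_Mt.sidePerm_conj l hg0, _, conjInv_Mt (some l.next) _ hg1,
      dir_conj_pair _ _ _, ?_⟩
    rw [(invOn_chi 2).conj conjInv_Mt (sidePerm_mem l) _ hg0, invOn_chi 2 _ _ hg1, e]

/-- `chi 2` is zero on both factors of `K̃ × K̃`, and `x² = (z, z)` has equal values. This makes
`chiSq` independent of the chosen section, hence invariant under `a`. -/
theorem Nt_one_le_fiberMt : Nt 1 ≤ fiberMt := by
  refine sup_le (fun g hg => ?_) (Tt_le_of conjInv_fiberMt
    ⟨z, z_mem_Mt, z, z_mem_Mt, x_mul_x, rfl⟩)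
  obtain ⟨g0, h0, g1, h1, rfl⟩ := mem_power_succ.1 hg
  exact ⟨g0, Kt_le_Mt h0, g1, Kt_le_Mt h1, rfl, by
    rw [chi_two_of_mem_Kt h0, chi_two_of_mem_Kt h1]⟩

theorem Nt_one_le_power_Mt : Nt 1 ≤ power Mt 1 := fun g hg => by
  obtain ⟨g0, h0, g1, h1, rfl, _⟩ := Nt_one_le_fiberMt hg
  exact pair_mem_power h0 h1

theorem chi_of_mem_Nt_one {g : Equiv.Perm Word} (hg : g ∈ Nt 1) (i : ℕ) : chi i g = 0 := by
  obtain ⟨g0, h0, g1, h1, rfl, _⟩ := Nt_one_le_fiberMt hg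
  rw [chi_pair, eps_eq_zero_of_mem_Mt h0]

theorem comm_x_mem (s : Option Label) : gen s * x * (gen s)⁻¹ * x⁻¹ ∈ Nt 1 := by
  rcases s with _ | _ | _ | _
  · change a * x * a⁻¹ * x⁻¹ ∈ _
    rw [a_comm_x]
    exact (Nt 1).inv_mem x_mul_x_mem
  · change bt * x * bt⁻¹ * x⁻¹ ∈ _
    rw [b_comm_x]
    exact (Nt 1).inv_mem x_mul_x_mem
  · change ct * x * ct⁻¹ * x⁻¹ ∈ _
    rw [c_comm_x]
    exact pair_mem_Nt_one Kt.one_mem (Kt.inv_mem y_mem_Kt)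
  · change dt * x * dt⁻¹ * x⁻¹ ∈ _
    rw [d_comm_x]
    exact pair_mem_Nt_one Kt.one_mem (Kt.inv_mem x_mem_Kt)

theorem comm_y_mem (s : Option Label) : gen s * y * (gen s)⁻¹ * y⁻¹ ∈ Nt 1 := by
  rcases gen_comm_y s with h | h <;> rw [h]
  · exact (Nt 1).one_mem
  · exact pair_mem_Nt_one x_mem_Kt Kt.one_mem

theorem comm_z_mem (s : Option Label) : gen s * z * (gen s)⁻¹ * z⁻¹ ∈ Nt 1 := by
  rcases gen_comm_z s with h | h <;> rw [h]
  · exact (Nt 1).one_mem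
  · exact pair_mem_Nt_one y_mem_Kt Kt.one_mem

/-- `M̃` is generated by `x`, `y`, `z` modulo `Ñ₁`, and each step has index at most two. -/
theorem exists_mul_of_mem_Mt {g : Equiv.Perm Word} (hg : g ∈ Mt) :
    ∃ i j k : ℕ, ∃ n ∈ Nt 1, g = x ^ i * (y ^ j * (z ^ k * n)) := by
  set A := Nt 1 ⊔ Subgroup.closure {z} with hA
  set B := A ⊔ Subgroup.closure {y} with hB
  set C := B ⊔ Subgroup.closure {x} with hC
  have leA : Nt 1 ≤ A := le_sup_left
  have leB : A ≤ B := le_sup_left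
  have cA : ConjInv A := conjInv_Nt_one.sup_closure_singleton comm_z_mem
  have cB : ConjInv B := cA.sup_closure_singleton fun s => leA (comm_y_mem s)
  have cC : ConjInv C := cB.sup_closure_singleton fun s => leB (leA (comm_x_mem s))
  have hMC : Mt ≤ C := by
    refine normalClosureGt_le cC ?_
    have hx : x ∈ C := (le_sup_right : _ ≤ C) (Subgroup.subset_closure rfl)
    have hy : y ∈ C := (le_sup_left : B ≤ C) ((le_sup_right : _ ≤ B) (Subgroup.subset_closure rfl))
    have hz : z ∈ C := (le_sup_left : B ≤ C) (leB ((le_sup_right : _ ≤ A)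
      (Subgroup.subset_closure rfl)))
    rintro _ (rfl | rfl | rfl)
    exacts [hx, hy, hz]
  have sA : ∀ g ∈ A, ∃ k : ℕ, ∃ n ∈ Nt 1, g = z ^ k * n := by
    intro g hg
    rcases Subgroup.mem_or_inv_mul_mem_of_mem_sup_closure_singleton
      (conjInv_Nt_one.conj_mem z_mem_Gt) (by rw [z_mul_z]; exact Subgroup.one_mem _) hg with h | h
    · exact ⟨0, g, h, by simp⟩
    · exact ⟨1, _, h, by simp⟩
  have sB : ∀ g ∈ B, ∃ j k : ℕ, ∃ n ∈ Nt 1, g = y ^ j * (z ^ k * n) := by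
    intro g hg
    rcases Subgroup.mem_or_inv_mul_mem_of_mem_sup_closure_singleton
      (cA.conj_mem y_mem_Gt) (by rw [y_mul_y]; exact Subgroup.one_mem _) hg with h | h
    · obtain ⟨k, n, hn, e⟩ := sA _ h
      exact ⟨0, k, n, hn, by simpa using e⟩
    · obtain ⟨k, n, hn, e⟩ := sA _ h
      exact ⟨1, k, n, hn, by rw [← e]; simp⟩
  rcases Subgroup.mem_or_inv_mul_mem_of_mem_sup_closure_singleton
    (cB.conj_mem x_mem_Gt) (leB (leA x_mul_x_mem)) (hMC hg) with h | h
  · obtain ⟨j, k, n, hn, e⟩ := sB _ h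
    exact ⟨0, j, k, n, hn, by simpa using e⟩
  · obtain ⟨j, k, n, hn, e⟩ := sB _ h
    exact ⟨1, j, k, n, hn, by rw [← e]; simp⟩

theorem AddOn.map_pow {Q : Subgroup (Equiv.Perm Word)} {e : (Word → Word) → ZMod 2}
    (h : AddOn Q e) {g : Equiv.Perm Word} (hg : g ∈ Q) (n : ℕ) :
    e (g ^ n : Equiv.Perm Word) = n * e g := by
  induction n with
  | zero => rw [pow_zero, h.map_one, Nat.cast_zero, zero_mul]
  | succ n ih =>
    rw [pow_succ, h _ (Q.pow_mem hg n) _ hg, ih, Nat.cast_succ, add_mul, one_mul]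

theorem pow_mem_of_cast_eq_zero {Q : Subgroup (Equiv.Perm Word)} {g : Equiv.Perm Word}
    (h : g * g ∈ Q) {n : ℕ} (hn : (n : ZMod 2) = 0) : g ^ n ∈ Q := by
  obtain ⟨k, rfl⟩ := (ZMod.natCast_eq_zero_iff n 2).1 hn
  rw [pow_mul, pow_two]
  exact Q.pow_mem h k

/-- Since `x`, `y`, `z` generate `M̃` modulo `Ñ₁`, have squares in `Ñ₁`, and are dual to the three
characters, vanishing characters force even exponents. So `M̃ / Ñ₁` is `𝔽₂³`. -/
theorem mem_Nt_one_of_chi {g : Equiv.Perm Word} (hg : g ∈ Mt) (h0 : chi 0 g = 0)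
    (h1 : chi 1 g = 0) (h2 : chi 2 g = 0) : g ∈ Nt 1 := by
  obtain ⟨i, j, k, n, hn, rfl⟩ := exists_mul_of_mem_Mt hg
  have hx := Kt_le_Mt x_mem_Kt
  have hy := Kt_le_Mt y_mem_Kt
  have hz := z_mem_Mt
  have hnM := Nt_one_le_Mt hn
  have key : ∀ t, chi t (x ^ i * (y ^ j * (z ^ k * n)) : Equiv.Perm Word) =
      i * chi t x + (j * chi t y + k * chi t z) := by
    intro t
    have hadd := addOn_chi t
    rw [hadd _ (Mt.pow_mem hx i) _ (Mt.mul_mem (Mt.pow_mem hy j) (Mt.mul_mem (Mt.pow_mem hz k) hnM)),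
      hadd _ (Mt.pow_mem hy j) _ (Mt.mul_mem (Mt.pow_mem hz k) hnM),
      hadd _ (Mt.pow_mem hz k) _ hnM, chi_of_mem_Nt_one hn, hadd.map_pow hx, hadd.map_pow hy,
      hadd.map_pow hz, add_zero]
  rw [key] at h0 h1 h2
  simp only [chi_x.1, chi_y.1, chi_z.1, mul_one, mul_zero, add_zero] at h0
  simp only [chi_x.2.1, chi_y.2.1, chi_z.2.1, mul_one, mul_zero, add_zero, zero_add] at h1
  simp only [chi_x.2.2, chi_y.2.2, chi_z.2.2, mul_one, mul_zero, zero_add] at h2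
  refine (Nt 1).mul_mem (pow_mem_of_cast_eq_zero x_mul_x_mem h0)
    ((Nt 1).mul_mem (pow_mem_of_cast_eq_zero ?_ h1)
      ((Nt 1).mul_mem (pow_mem_of_cast_eq_zero ?_ h2) hn))
  · rw [y_mul_y]; exact (Nt 1).one_mem
  · rw [z_mul_z]; exact (Nt 1).one_mem

/-! ### The functions on a level given by a character of the sections -/

/-- The values of `e` on the sections at the vertices of level `m`. -/
def levelFun (e : (Word → Word) → ZMod 2) : (m : ℕ) → (Word → Word) → U m
  | 0, f => fun _ => e f
  | m + 1, f => join m (levelFun e m (sec 0 f), levelFun e m (sec 1 f))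

variable {e : (Word → Word) → ZMod 2} {Q : Subgroup (Equiv.Perm Word)}

theorem levelFun_pair (e : (Word → Word) → ZMod 2) (m : ℕ) (g0 g1 : Equiv.Perm Word) :
    levelFun e (m + 1) (pair (g0, g1)) = join m (levelFun e m g0, levelFun e m g1) := rfl

theorem join_eq_zero {m : ℕ} {u0 u1 : U m} : join m (u0, u1) = 0 ↔ u0 = 0 ∧ u1 = 0 := by
  constructor
  · intro h
    exact ⟨by simpa using congrArg (lo m) h, by simpa using congrArg (hi m) h⟩
  · rintro ⟨rfl, rfl⟩
    exact map_zero (join m)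

theorem levelFun_mul (h : AddOn Q e) {m : ℕ} {g k : Equiv.Perm Word} (hg : g ∈ power Q m)
    (hk : k ∈ power Q m) :
    levelFun e m (g * k : Equiv.Perm Word) = levelFun e m g + levelFun e m k := by
  induction m generalizing g k with
  | zero => exact funext fun _ => h g hg k hk
  | succ m ih =>
    obtain ⟨g0, h0, g1, h1, rfl⟩ := mem_power_succ.1 hg
    obtain ⟨k0, hk0, k1, hk1, rfl⟩ := mem_power_succ.1 hk
    rw [pair_mul, levelFun_pair, levelFun_pair, levelFun_pair, ih h0 hk0, ih h1 hk1, ← map_add]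
    rfl

theorem levelFun_one (h : AddOn Q e) (m : ℕ) : levelFun e m (1 : Equiv.Perm Word) = 0 := by
  induction m with
  | zero => exact funext fun _ => h.map_one
  | succ m ih => rw [← pair_one, levelFun_pair, ih, join_eq_zero]; exact ⟨rfl, rfl⟩

theorem neg_eq_self_U {m : ℕ} (u : U m) : -u = u := by
  ext σ
  have : ∀ s : ZMod 2, -s = s := by decide
  exact this _

theorem levelFun_inv (h : AddOn Q e) {m : ℕ} {g : Equiv.Perm Word} (hg : g ∈ power Q m) :
    levelFun e m (g⁻¹ : Equiv.Perm Word) = levelFun e m g := by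
  have := levelFun_mul h hg (Subgroup.inv_mem _ hg)
  rw [mul_inv_cancel, levelFun_one h] at this
  rw [← neg_eq_self_U (levelFun e m g)]
  exact eq_neg_of_add_eq_zero_right this.symm

/-- Conjugation permutes the sections on level `m` and conjugates them; an invariant character sees
only the permutation. -/
theorem levelFun_conj (h : InvOn Q e) {m : ℕ} (s : Option Label)
    {g : Equiv.Perm Word} (hg : g ∈ power Q m) :
    levelFun e m (gen s * g * (gen s)⁻¹ : Equiv.Perm Word) = actU m s (levelFun e m g) := by
  induction m generalizing g s with
  | zero =>
    have : actU 0 s = LinearMap.id := by cases s <;> rfl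
    rw [this]
    exact funext fun _ => h s g hg
  | succ m ih =>
    obtain ⟨g0, h0, g1, h1, rfl⟩ := mem_power_succ.1 hg
    cases s with
    | none => rw [gen, a_conj_pair, levelFun_pair, levelFun_pair, actU, actA_succ, lo_join, hi_join]
    | some l =>
      rw [gen, dir_conj_pair, levelFun_pair, levelFun_pair, actU, actL_succ, lo_join, hi_join]
      have e1 : levelFun e m (dir l.next * g1 * (dir l.next)⁻¹ : Equiv.Perm Word) =
          actL m l.next (levelFun e m g1) := ih (some l.next) h1
      have e0 : levelFun e m (sidePerm l * g0 * (sidePerm l)⁻¹ : Equiv.Perm Word) =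
          sideAct m l (levelFun e m g0) := by
        have hid : levelFun e m (1 * g0 * 1⁻¹ : Equiv.Perm Word) = levelFun e m g0 := by simp
        cases l
        · exact ih none h0
        · exact hid
        · exact hid
      rw [e0, e1]

/-- The element with section `h` at the vertices `σ` of level `m` with `u σ = 1`, and with trivial
sections at the other vertices of level `m`. -/
def spread (h : Equiv.Perm Word) : (m : ℕ) → U m → Equiv.Perm Word
  | 0, u => if u default = 0 then 1 else h
  | m + 1, u => pair (spread h m (lo m u), spread h m (hi m u))

theorem spread_mem {h : Equiv.Perm Word} (hh : h ∈ Q) (m : ℕ) (u : U m) :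
    spread h m u ∈ power Q m := by
  induction m with
  | zero =>
    rw [spread]
    split_ifs
    · exact Subgroup.one_mem _
    · exact hh
  | succ m ih => exact pair_mem_power (ih _) (ih _)

theorem spread_mul_self (h : Equiv.Perm Word) (m : ℕ) (u : U m) :
    spread h m u * spread h m u = spread (h * h) m u := by
  induction m with
  | zero =>
    simp only [spread]
    split_ifs
    · exact mul_one 1
    · rfl
  | succ m ih => rw [spread, pair_mul, ih, ih]; rfl

theorem spread_one (m : ℕ) (u : U m) : spread 1 m u = 1 := by
  induction m with
  | zero => simp [spread]
  | succ m ih => rw [spread, ih, ih, pair_one]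

theorem spread_zero (h : Equiv.Perm Word) (m : ℕ) : spread h m 0 = 1 := by
  induction m with
  | zero => simp [spread]
  | succ m ih => rw [spread, map_zero, map_zero, ih, pair_one]

theorem levelFun_spread (he : e (1 : Equiv.Perm Word) = 0) (h : Equiv.Perm Word) (m : ℕ) (u : U m) :
    levelFun e m (spread h m u) = e h • u := by
  induction m with
  | zero =>
    ext σ
    rw [Subsingleton.elim σ default]
    change e (spread h 0 u) = e h * u default
    rcases ZMod.eq_zero_or_one (u default) with hu | hu
    · rw [spread, if_pos hu, he, hu, mul_zero]
    · rw [spread, if_neg (by rw [hu]; exact one_ne_zero), hu, mul_one]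
  | succ m ih =>
    rw [spread, levelFun_pair, ih, ih]
    exact U_ext (by simp) (by simp)

/-- The indicator of a vertex. -/
def delta {m : ℕ} (σ : Fin m → ZMod 2) : U m := Pi.single σ 1

theorem delta_cons_zero {m : ℕ} (σ : Fin m → ZMod 2) :
    delta (Fin.cons 0 σ : Fin (m + 1) → ZMod 2) = join m (delta σ, 0) := by
  refine U_ext ?_ ?_
  · rw [lo_join]
    ext τ
    simp [lo, LinearMap.funLeft, delta, Pi.single_apply]
  · rw [hi_join]
    ext τ
    simp [hi, LinearMap.funLeft, delta, Fin.cons_inj]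

theorem delta_cons_one {m : ℕ} (σ : Fin m → ZMod 2) :
    delta (Fin.cons 1 σ : Fin (m + 1) → ZMod 2) = join m (0, delta σ) := by
  refine U_ext ?_ ?_
  · rw [lo_join]
    ext τ
    simp [lo, LinearMap.funLeft, delta, Fin.cons_inj]
  · rw [hi_join]
    ext τ
    simp [hi, LinearMap.funLeft, delta, Pi.single_apply]

theorem spread_delta (h : Equiv.Perm Word) {m : ℕ} (σ : Fin m → ZMod 2) :
    spread h m (delta σ) = atVertex h (List.ofFn σ) := by
  induction m with
  | zero =>
    rw [Subsingleton.elim σ default]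
    simp [spread, delta, atVertex]
  | succ m ih =>
    rw [← Fin.cons_self_tail σ, List.ofFn_cons]
    rcases ZMod.eq_zero_or_one (σ 0) with hs | hs <;> rw [hs]
    · rw [delta_cons_zero, spread, lo_join, hi_join, ih, spread_zero, atVertex_zero_cons]
    · rw [delta_cons_one, spread, lo_join, hi_join, ih, spread_zero, atVertex_one_cons]

/-! ### The three layer maps -/

/-- The third character of `Ñ₁`. -/
def chiSq (f : Word → Word) : ZMod 2 := chi 2 (sec 0 f)

theorem chiSq_pair (g0 g1 : Equiv.Perm Word) : chiSq (pair (g0, g1)) = chi 2 g0 := rfl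

theorem addOn_chiSq : AddOn (Nt 1) chiSq := by
  intro g hg h hh
  obtain ⟨g0, hg0, g1, hg1, rfl, -⟩ := Nt_one_le_fiberMt hg
  obtain ⟨h0, hh0, h1, hh1, rfl, -⟩ := Nt_one_le_fiberMt hh
  rw [pair_mul, chiSq_pair, chiSq_pair, chiSq_pair, addOn_chi 2 _ hg0 _ hh0]

theorem invOn_chiSq : InvOn (Nt 1) chiSq := by
  intro s g hg
  obtain ⟨g0, hg0, g1, hg1, rfl, h⟩ := Nt_one_le_fiberMt hg
  cases s with
  | none => rw [gen, a_conj_pair, chiSq_pair, chiSq_pair, h]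
  | some l =>
    rw [gen, dir_conj_pair, chiSq_pair, chiSq_pair,
      (invOn_chi 2).conj conjInv_Mt (sidePerm_mem l) _ hg0]

theorem power_Nt_one_le (k : ℕ) : power (Nt 1) k ≤ power Mt (k + 1) := by
  rw [← power_power_one]
  exact power_mono Nt_one_le_power_Mt k

/-- The three layer maps on `Ñ_{k+1}`. -/
def layer (k : ℕ) (f : Word → Word) : U (k + 1) × U (k + 1) × U k :=
  (levelFun (chi 0) (k + 1) f, levelFun (chi 1) (k + 1) f, levelFun chiSq k f)

theorem layer_mul {k : ℕ} {g h : Equiv.Perm Word} (hg : g ∈ power (Nt 1) k)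
    (hh : h ∈ power (Nt 1) k) :
    layer k (g * h : Equiv.Perm Word) = layer k g + layer k h := by
  simp only [layer, levelFun_mul (addOn_chi _) (power_Nt_one_le k hg) (power_Nt_one_le k hh),
    levelFun_mul addOn_chiSq hg hh, Prod.mk_add_mk]

theorem layer_one (k : ℕ) : layer k (1 : Equiv.Perm Word) = 0 := by
  simp only [layer, levelFun_one (addOn_chi _), levelFun_one addOn_chiSq]
  rfl

theorem layer_inv {k : ℕ} {g : Equiv.Perm Word} (hg : g ∈ power (Nt 1) k) :
    layer k (g⁻¹ : Equiv.Perm Word) = layer k g := by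
  simp only [layer, levelFun_inv (addOn_chi _) (power_Nt_one_le k hg), levelFun_inv addOn_chiSq hg]

theorem layer_conj {k : ℕ} (s : Option Label) {g : Equiv.Perm Word} (hg : g ∈ power (Nt 1) k) :
    layer k (gen s * g * (gen s)⁻¹ : Equiv.Perm Word) =
      (actU (k + 1) s (layer k g).1, actU (k + 1) s (layer k g).2.1, actU k s (layer k g).2.2) := by
  simp only [layer, levelFun_conj (invOn_chi _) s (power_Nt_one_le k hg),
    levelFun_conj invOn_chiSq s hg]

/-- For `g = (g₀, g₁) ∈ Ñ₁` the three maps record `chi 0` and `chi 1` of both sections and the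
common value of `chi 2`; they vanish exactly when both sections lie in `Ñ₁`. Deeper levels follow by
induction. -/
theorem layer_eq_zero_iff {k : ℕ} {g : Equiv.Perm Word} (hg : g ∈ power (Nt 1) k) :
    layer k g = 0 ↔ g ∈ power (Nt 1) (k + 1) := by
  have hsplit : ∀ {k : ℕ} {f : Word → Word}, layer k f = 0 ↔ levelFun (chi 0) (k + 1) f = 0 ∧
      levelFun (chi 1) (k + 1) f = 0 ∧ levelFun chiSq k f = 0 := by
    intro k f
    simp only [layer, Prod.mk_eq_zero]
  rw [hsplit]
  induction k generalizing g with
  | zero =>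
    obtain ⟨g0, h0, g1, h1, rfl, h⟩ := Nt_one_le_fiberMt hg
    rw [pair_mem_power_iff, levelFun_pair, levelFun_pair, join_eq_zero, join_eq_zero]
    have hconst : ∀ s : ZMod 2, ((fun _ => s : U 0) = 0) ↔ s = 0 :=
      fun s => ⟨fun h => congrFun h default, fun h => by rw [h]; rfl⟩
    simp only [levelFun, hconst, chiSq_pair]
    constructor
    · rintro ⟨⟨h00, h01⟩, ⟨h10, h11⟩, h2⟩
      exact ⟨mem_Nt_one_of_chi h0 h00 h10 h2, mem_Nt_one_of_chi h1 h01 h11 (h ▸ h2)⟩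
    · rintro ⟨h0, h1⟩
      exact ⟨⟨chi_of_mem_Nt_one h0 0, chi_of_mem_Nt_one h1 0⟩,
        ⟨chi_of_mem_Nt_one h0 1, chi_of_mem_Nt_one h1 1⟩, chi_of_mem_Nt_one h0 2⟩
  | succ k ih =>
    obtain ⟨g0, h0, g1, h1, rfl⟩ := mem_power_succ.1 hg
    rw [pair_mem_power_iff, levelFun_pair, levelFun_pair, levelFun_pair, join_eq_zero,
      join_eq_zero, join_eq_zero]
    have e0 := ih h0
    have e1 := ih h1
    tauto

theorem levelFun_of_mem_power_zero (h : ∀ g ∈ Q, e g = 0) {m : ℕ} {g : Equiv.Perm Word}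
    (hg : g ∈ power Q m) : levelFun e m g = 0 := by
  induction m generalizing g with
  | zero => exact funext fun _ => h g hg
  | succ m ih =>
    obtain ⟨g0, h0, g1, h1, rfl⟩ := mem_power_succ.1 hg
    rw [levelFun_pair, ih h0, ih h1, join_eq_zero]
    exact ⟨rfl, rfl⟩

theorem power_Kt_le (k : ℕ) : power Kt (k + 1) ≤ power (Nt 1) k := by
  rw [← power_power_one]
  exact power_mono (le_sup_left : power Kt 1 ≤ Nt 1) k

theorem chiSq_of_mem {g : Equiv.Perm Word} (hg : g ∈ power Kt 1) : chiSq g = 0 := by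
  obtain ⟨g0, h0, g1, h1, rfl⟩ := mem_power_succ.1 hg
  exact chi_two_of_mem_Kt h0

theorem layer_of_mem_power_Kt {k : ℕ} {g : Equiv.Perm Word} (hg : g ∈ power Kt (k + 1)) :
    (layer k g).2.2 = 0 := by
  rw [← power_power_one] at hg
  exact levelFun_of_mem_power_zero (fun _ => chiSq_of_mem) hg

theorem layer_spread_x (k : ℕ) (u : U (k + 1)) : layer k (spread x (k + 1) u) = (u, 0, 0) := by
  have h := layer_of_mem_power_Kt (spread_mem x_mem_Kt (k + 1) u)
  have h1 : levelFun chiSq k (spread x (k + 1) u) = 0 := h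
  simp only [layer, levelFun_spread (addOn_chi _).map_one, chi_x.1, chi_x.2.1, h1]
  simp

theorem layer_spread_y (k : ℕ) (u : U (k + 1)) : layer k (spread y (k + 1) u) = (0, u, 0) := by
  have h := layer_of_mem_power_Kt (spread_mem y_mem_Kt (k + 1) u)
  have h1 : levelFun chiSq k (spread y (k + 1) u) = 0 := h
  simp only [layer, levelFun_spread (addOn_chi _).map_one, chi_y.1, chi_y.2.1, h1]
  simp

/-- The sections of `x²` are `z`, on which `chi 0` and `chi 1` vanish and `chi 2` is `1`. -/
theorem layer_spread_sq (k : ℕ) (u : U k) : layer k (spread (x * x) k u) = (0, 0, u) := by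
  have h2 : chiSq (x * x : Equiv.Perm Word) = 1 := by
    rw [x_mul_x, chiSq_pair, chi_z.2.2]
  have key : ∀ i, chi i z = 0 → levelFun (chi i) (k + 1) (spread (x * x) k u) = 0 := by
    intro i hi
    induction k with
    | zero =>
      rcases ZMod.eq_zero_or_one (u default) with hu | hu
      · simp only [spread, hu, if_true]
        exact levelFun_one (addOn_chi i) 1
      · simp only [spread, hu, one_ne_zero, if_false]
        rw [x_mul_x, levelFun_pair, join_eq_zero]
        exact ⟨funext fun _ => hi, funext fun _ => hi⟩
    | succ k ih =>
      rw [spread, levelFun_pair, ih, ih, join_eq_zero]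
      exact ⟨rfl, rfl⟩
  simp only [layer, levelFun_spread addOn_chiSq.map_one, h2, key 0 chi_z.1, key 1 chi_z.2.1,
    one_smul]

theorem spread_x_mem (k : ℕ) (u : U (k + 1)) : spread x (k + 1) u ∈ power (Nt 1) k :=
  power_Kt_le k (spread_mem x_mem_Kt _ u)

theorem spread_y_mem (k : ℕ) (u : U (k + 1)) : spread y (k + 1) u ∈ power (Nt 1) k :=
  power_Kt_le k (spread_mem y_mem_Kt _ u)

theorem spread_sq_mem (k : ℕ) (u : U k) : spread (x * x) k u ∈ power (Nt 1) k :=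
  spread_mem x_mul_x_mem k u

/-! ### The explicit series -/

/-- The preimage of `Usub (k+1) r × Usub (k+1) r × Usub k (r/2)` under the layer maps of
`Ñ_{k+1}`. -/
def layerSub (k r : ℕ) : Subgroup (Equiv.Perm Word) where
  carrier := {g | g ∈ power (Nt 1) k ∧ (layer k g).1 ∈ Usub (k + 1) r ∧
    (layer k g).2.1 ∈ Usub (k + 1) r ∧ (layer k g).2.2 ∈ Usub k (r / 2)}
  one_mem' := by
    refine ⟨Subgroup.one_mem _, ?_⟩
    rw [layer_one]
    exact ⟨zero_mem _, zero_mem _, zero_mem _⟩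
  mul_mem' := by
    rintro g h ⟨hg, g1, g2, g3⟩ ⟨hh, h1, h2, h3⟩
    refine ⟨Subgroup.mul_mem _ hg hh, ?_⟩
    rw [layer_mul hg hh]
    exact ⟨add_mem g1 h1, add_mem g2 h2, add_mem g3 h3⟩
  inv_mem' := by
    rintro g ⟨hg, h⟩
    refine ⟨Subgroup.inv_mem _ hg, ?_⟩
    rwa [layer_inv hg]

theorem mem_layerSub {k r : ℕ} {g : Equiv.Perm Word} : g ∈ layerSub k r ↔
    g ∈ power (Nt 1) k ∧ (layer k g).1 ∈ Usub (k + 1) r ∧ (layer k g).2.1 ∈ Usub (k + 1) r ∧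
      (layer k g).2.2 ∈ Usub k (r / 2) := Iff.rfl

theorem layerSub_zero (k : ℕ) : layerSub k 0 = power (Nt 1) k := by
  ext g
  simp [mem_layerSub, Usub_zero]

/-- All three filtrations are exhausted together, the halved index reaching `2 ^ k`, so consecutive
layers fit without a gap. -/
theorem layerSub_top (k : ℕ) : layerSub k (2 ^ (k + 1)) = power (Nt 1) (k + 1) := by
  ext g
  have h : (2 ^ (k + 1)) / 2 = 2 ^ k := by rw [pow_succ]; omega
  rw [mem_layerSub, Usub_eq_bot le_rfl, h, Usub_eq_bot le_rfl]
  have e : ((layer k g).1 ∈ (⊥ : Submodule (ZMod 2) (U (k + 1))) ∧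
      (layer k g).2.1 ∈ (⊥ : Submodule (ZMod 2) (U (k + 1))) ∧
      (layer k g).2.2 ∈ (⊥ : Submodule (ZMod 2) (U k))) ↔ layer k g = 0 := by
    simp only [Submodule.mem_bot, Prod.ext_iff]
    rfl
  rw [e]
  constructor
  · rintro ⟨h1, h2⟩
    exact (layer_eq_zero_iff h1).1 h2
  · intro hg
    have h1 : g ∈ power (Nt 1) k := by
      rw [← power_power_one] at hg
      exact power_mono power_Nt_one_one_le k hg
    exact ⟨h1, (layer_eq_zero_iff h1).2 hg⟩

theorem layerSub_succ_le (k r : ℕ) : layerSub k (r + 1) ≤ layerSub k r := by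
  rintro g ⟨h, h1, h2, h3⟩
  exact ⟨h, Usub_anti _ r.le_succ h1, Usub_anti _ r.le_succ h2, Usub_anti _ (by omega) h3⟩

theorem layerSub_comm {k r : ℕ} (s : Option Label) {g : Equiv.Perm Word} (hg : g ∈ layerSub k r) :
    gen s * g * (gen s)⁻¹ * g⁻¹ ∈ layerSub k (r + 1) := by
  obtain ⟨h, h1, h2, h3⟩ := hg
  have hc := conjInv_Nt_one.power k s g h
  refine ⟨Subgroup.mul_mem _ hc (Subgroup.inv_mem _ h), ?_⟩
  rw [layer_mul hc (Subgroup.inv_mem _ h), layer_inv h, layer_conj s h]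
  have key : ∀ {m t : ℕ} {u : U m}, u ∈ Usub m t → actU m s u + u ∈ Usub m (t + 1) := by
    intro m t u hu
    have e : actU m s u + u = actU m s u - u := by rw [sub_eq_add_neg, neg_eq_self_U]
    rw [e]
    exact actU_sub_mem s hu
  -- Each component advances by one step, and `(r + 1) / 2 ≤ r / 2 + 1` is all that the third needs.
  exact ⟨key h1, key h2, Usub_anti k (by omega) (key h3)⟩

/-- The explicit description of the `2`-dimension series. -/
def series (n : ℕ) : Subgroup (Equiv.Perm Word) :=
  if n ≤ 1 then Gt else if n = 2 then Mt else
    -- For `n ≥ 3`, write `n - 1 = 2 ^ m + r` with `r < 2 ^ m`; the layer of `Ñ_m` is indexed by `k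
    -- = m - 1`.
    layerSub (Nat.log 2 (n - 1) - 1) (n - 1 - 2 ^ Nat.log 2 (n - 1))

theorem series_one : series 1 = Gt := rfl

theorem series_layer_of_lt {k r : ℕ} (hr : r < 2 ^ (k + 1)) :
    series (2 ^ (k + 1) + 1 + r) = layerSub k r := by
  have h1 : 1 ≤ 2 ^ k := Nat.one_le_two_pow
  have h2 : 2 ^ (k + 1) = 2 * 2 ^ k := by rw [pow_succ, mul_comm]
  have hlog : Nat.log 2 (2 ^ (k + 1) + 1 + r - 1) = k + 1 := by
    refine Nat.log_eq_of_pow_le_of_lt_pow (by omega) ?_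
    rw [pow_succ 2 (k + 1)]
    omega
  rw [series, if_neg (by omega), if_neg (by omega), hlog]
  congr 1
  omega

theorem series_pow (k : ℕ) : series (2 ^ (k + 1) + 1) = power (Nt 1) k := by
  rw [← layerSub_zero, ← series_layer_of_lt (Nat.two_pow_pos _), add_zero]

theorem series_layer {k r : ℕ} (hr : r ≤ 2 ^ (k + 1)) :
    series (2 ^ (k + 1) + 1 + r) = layerSub k r := by
  rcases hr.eq_or_lt with rfl | hr
  · rw [layerSub_top, ← series_pow]
    congr 1
    rw [pow_succ 2 (k + 1)]
    ring
  · exact series_layer_of_lt hr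

theorem exists_layer_index {n : ℕ} (hn : 3 ≤ n) :
    ∃ k r, r < 2 ^ (k + 1) ∧ n = 2 ^ (k + 1) + 1 + r := by
  have h1 : 1 ≤ Nat.log 2 (n - 1) := Nat.log_pos (by omega) (by omega)
  obtain ⟨k, hk⟩ : ∃ k, Nat.log 2 (n - 1) = k + 1 := ⟨_, (Nat.sub_add_cancel h1).symm⟩
  have h2 := Nat.pow_log_le_self 2 (show n - 1 ≠ 0 by omega)
  have h3 := Nat.lt_pow_succ_log_self (b := 2) (by omega) (n - 1)
  rw [hk] at h2 h3
  rw [pow_succ 2 (k + 1)] at h3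
  exact ⟨k, n - 1 - 2 ^ (k + 1), by omega, by omega⟩

theorem series_cases {p : ℕ → Prop} (h0 : p 0) (h1 : p 1) (h2 : p 2)
    (h : ∀ k r, r < 2 ^ (k + 1) → p (2 ^ (k + 1) + 1 + r)) (n : ℕ) : p n := by
  by_cases hn : 3 ≤ n
  · obtain ⟨k, r, hr, rfl⟩ := exists_layer_index hn
    exact h k r hr
  · interval_cases n
    exacts [h0, h1, h2]

theorem series_three : series 3 = Nt 1 := series_pow 0

theorem series_succ_le (n : ℕ) : series (n + 1) ≤ series n := by
  induction n using series_cases with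
  | h0 => exact le_rfl
  | h1 => exact Mt_le_Gt
  | h2 => rw [series_three]; exact Nt_one_le_Mt
  | h k r hr =>
    rw [add_assoc _ r 1, series_layer hr, series_layer hr.le]
    exact layerSub_succ_le k r

theorem series_anti : Antitone series := antitone_nat_of_succ_le series_succ_le

theorem series_le_Gt (n : ℕ) : series n ≤ Gt := series_anti n.zero_le

theorem comm_mem_Mt (s : Option Label) {g : Equiv.Perm Word} (hg : g ∈ Gt) :
    gen s * g * (gen s)⁻¹ * g⁻¹ ∈ Mt := by
  have ha : ∀ l, a * dir l * a⁻¹ * (dir l)⁻¹ ∈ Mt := by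
    intro l
    cases l
    · exact Kt_le_Mt x_mem_Kt
    · exact z_mem_Mt
    · exact Kt_le_Mt y_mem_Kt
  have hgen : ∀ s t, gen s * gen t * (gen s)⁻¹ * (gen t)⁻¹ ∈ Mt := by
    rintro (_ | l) (_ | l')
    · simp [Mt.one_mem]
    · exact ha l'
    · have := Mt.inv_mem (ha l)
      simpa [gen, mul_assoc] using this
    · rw [gen, gen, dir_comm, mul_inv_cancel_right, mul_inv_cancel]
      exact Mt.one_mem
  induction hg using Gt_induction with
  | one => simp [Mt.one_mem]
  | mul t g hg ih =>
    have e : gen s * (gen t * g) * (gen s)⁻¹ * (gen t * g)⁻¹ =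
        (gen s * gen t * (gen s)⁻¹ * (gen t)⁻¹) *
          (gen t * (gen s * g * (gen s)⁻¹ * g⁻¹) * (gen t)⁻¹) := by group
    rw [e]
    exact Mt.mul_mem (hgen s t) (conjInv_Mt t _ ih)

/-- The characters separating `M̃ / Ñ₁` are invariant, so this quotient is centralized by `G̃`. -/
theorem comm_mem_Nt_one (s : Option Label) {g : Equiv.Perm Word} (hg : g ∈ Mt) :
    gen s * g * (gen s)⁻¹ * g⁻¹ ∈ Nt 1 := by
  have hc := conjInv_Mt s g hg
  have key : ∀ i, chi i (gen s * g * (gen s)⁻¹ * g⁻¹ : Equiv.Perm Word) = 0 := fun i => by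
    rw [addOn_chi i _ hc _ (Mt.inv_mem hg), invOn_chi i s g hg, (addOn_chi i).map_inv hg,
      ZMod.add_self_two]
  exact mem_Nt_one_of_chi (Mt.mul_mem hc (Mt.inv_mem hg)) (key 0) (key 1) (key 2)

theorem series_comm_gen (n : ℕ) (s : Option Label) {g : Equiv.Perm Word} (hg : g ∈ series n) :
    gen s * g * (gen s)⁻¹ * g⁻¹ ∈ series (n + 1) := by
  induction n using series_cases with
  | h0 => exact Mt_le_Gt (comm_mem_Mt s hg)
  | h1 => exact comm_mem_Mt s hg
  | h2 => rw [series_three]; exact comm_mem_Nt_one s hg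
  | h k r hr =>
    rw [series_layer hr.le] at hg
    rw [add_assoc _ r 1, series_layer hr]
    exact layerSub_comm s hg

theorem conjInv_series (n : ℕ) : ConjInv (series n) := fun s g hg => by
  have := (series n).mul_mem (series_succ_le n (series_comm_gen n s hg)) hg
  simpa using this

theorem series_comm (n : ℕ) {g h : Equiv.Perm Word} (hg : g ∈ Gt) (hh : h ∈ series n) :
    g * h * g⁻¹ * h⁻¹ ∈ series (n + 1) := by
  induction hg using Gt_induction with
  | one => simp
  | mul s g _ ih =>
    have e : gen s * g * h * (gen s * g)⁻¹ * h⁻¹ =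
        (gen s * (g * h * g⁻¹ * h⁻¹) * (gen s)⁻¹) * (gen s * h * (gen s)⁻¹ * h⁻¹) := by group
    rw [e]
    exact Subgroup.mul_mem _ (conjInv_series _ s _ ih) (series_comm_gen n s hh)

/-! ### Generators of the factors -/

/-- The generators of the factors of `layerSub k`. -/
def layerGens (k r : ℕ) : Set (Equiv.Perm Word) :=
  {spread x (k + 1) (basisU (k + 1) r), spread y (k + 1) (basisU (k + 1) r),
    spread (x * x) k (basisU k (r / 2))}

/-- Generators of `series n` modulo `series (n + 1)`. -/
def seriesGens (n : ℕ) : Set (Equiv.Perm Word) :=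
  if n = 0 then ∅ else if n = 1 then Set.range gen else if n = 2 then {x, y, z} else
    layerGens (Nat.log 2 (n - 1) - 1) (n - 1 - 2 ^ Nat.log 2 (n - 1))

theorem seriesGens_layer {k r : ℕ} (hr : r < 2 ^ (k + 1)) :
    seriesGens (2 ^ (k + 1) + 1 + r) = layerGens k r := by
  have h1 : 1 ≤ 2 ^ k := Nat.one_le_two_pow
  have h2 : 2 ^ (k + 1) = 2 * 2 ^ k := by rw [pow_succ, mul_comm]
  have hlog : Nat.log 2 (2 ^ (k + 1) + 1 + r - 1) = k + 1 := by
    refine Nat.log_eq_of_pow_le_of_lt_pow (by omega) ?_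
    rw [pow_succ 2 (k + 1)]
    omega
  rw [seriesGens, if_neg (by omega), if_neg (by omega), if_neg (by omega), hlog]
  congr 1
  omega

theorem seriesGens_finite (n : ℕ) : (seriesGens n).Finite := by
  induction n using series_cases with
  | h0 => exact Set.finite_empty
  | h1 =>
    have : seriesGens 1 = {a, dir .b, dir .c, dir .d} := by
      ext g
      constructor
      · rintro ⟨_ | _ | _ | _, rfl⟩ <;> simp [gen]
      · rintro (rfl | rfl | rfl | rfl)
        exacts [⟨none, rfl⟩, ⟨some .b, rfl⟩, ⟨some .c, rfl⟩, ⟨some .d, rfl⟩]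
    rw [this]
    exact Set.toFinite _
  | h2 => exact Set.toFinite ({x, y, z} : Set (Equiv.Perm Word))
  | h k r hr =>
    rw [seriesGens_layer hr, layerGens]
    exact Set.toFinite _

theorem spread_x_mem_layerSub {k r : ℕ} {u : U (k + 1)} (hu : u ∈ Usub (k + 1) r) :
    spread x (k + 1) u ∈ layerSub k r := by
  refine ⟨spread_x_mem k u, ?_⟩
  rw [layer_spread_x]
  exact ⟨hu, zero_mem _, zero_mem _⟩

theorem spread_y_mem_layerSub {k r : ℕ} {u : U (k + 1)} (hu : u ∈ Usub (k + 1) r) :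
    spread y (k + 1) u ∈ layerSub k r := by
  refine ⟨spread_y_mem k u, ?_⟩
  rw [layer_spread_y]
  exact ⟨zero_mem _, hu, zero_mem _⟩

theorem spread_sq_mem_layerSub {k r : ℕ} {u : U k} (hu : u ∈ Usub k (r / 2)) :
    spread (x * x) k u ∈ layerSub k r := by
  refine ⟨spread_sq_mem k u, ?_⟩
  rw [layer_spread_sq]
  exact ⟨zero_mem _, zero_mem _, hu⟩

theorem seriesGens_subset (n : ℕ) : seriesGens n ⊆ series n := by
  induction n using series_cases with
  | h0 => exact Set.empty_subset _
  | h1 => rintro _ ⟨s, rfl⟩; exact gen_mem s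
  | h2 => exact subset_normalClosureGt {x, y, z}
  | h k r hr =>
    have hr2 : r / 2 < 2 ^ k := by rw [pow_succ] at hr; omega
    rw [seriesGens_layer hr, series_layer hr.le]
    rintro _ (rfl | rfl | rfl)
    · exact spread_x_mem_layerSub (basisU_mem hr le_rfl)
    · exact spread_y_mem_layerSub (basisU_mem hr le_rfl)
    · exact spread_sq_mem_layerSub (basisU_mem hr2 le_rfl)

theorem seriesGens_sq (n : ℕ) : ∀ s ∈ seriesGens n, s * s ∈ series (2 * n) := by
  induction n using series_cases with
  | h0 => exact fun s hs => absurd hs (Set.notMem_empty s)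
  | h1 =>
    rintro _ ⟨s, rfl⟩
    have : gen s * gen s = 1 := by
      cases s
      exacts [a_mul_self, dir_mul_self _]
    rw [this]
    exact Subgroup.one_mem _
  | h2 =>
    rintro _ (rfl | rfl | rfl)
    -- Weight `4` is `r = 1` in the first layer; the third component is still unrestricted there, as
    -- `1 / 2 = 0`.
    · have h : series (2 * 2) = layerSub 0 1 := series_layer (k := 0) (r := 1) (by norm_num)
      rw [h]
      refine ⟨x_mul_x_mem, ?_⟩
      have e := layer_spread_sq 0 (basisU 0 0)
      have e2 : spread (x * x) 0 (basisU 0 0) = x * x := rfl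
      rw [e2] at e
      rw [e]
      exact ⟨zero_mem _, zero_mem _, by rw [Nat.div_eq_of_lt (by norm_num), Usub_zero]; trivial⟩
    · rw [y_mul_y]; exact Subgroup.one_mem _
    · rw [z_mul_z]; exact Subgroup.one_mem _
  | h k r hr =>
    rw [seriesGens_layer hr]
    rintro _ (rfl | rfl | rfl)
    -- The square of a spread `x` reappears in the third component of the next layer, with index `r
    -- = (2r + 1) / 2`. The other two kinds of generators are involutions.
    · have e : 2 * (2 ^ (k + 1) + 1 + r) = 2 ^ (k + 1 + 1) + 1 + (2 * r + 1) := by ring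
      rw [e, series_layer (by rw [pow_succ]; omega), spread_mul_self]
      refine spread_sq_mem_layerSub (basisU_mem hr ?_)
      omega
    · rw [spread_mul_self, y_mul_y, spread_one]
      exact Subgroup.one_mem _
    · have e : x * x * (x * x) = 1 := by rw [x_mul_x, pair_mul, z_mul_z, pair_one]
      rw [spread_mul_self, e, spread_one]
      exact Subgroup.one_mem _

theorem series_gen (n : ℕ) : series n ≤ series (n + 1) ⊔ Subgroup.closure (seriesGens n) := by
  induction n using series_cases with
  | h0 => exact le_sup_left
  | h1 =>
    rw [series_one, Gt_eq]
    exact le_sup_right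
  | h2 =>
    intro g hg
    obtain ⟨i, j, k, n, hn, rfl⟩ := exists_mul_of_mem_Mt hg
    have hle : Subgroup.closure (seriesGens 2) ≤
      series (2 + 1) ⊔ Subgroup.closure (seriesGens 2) := le_sup_right
    have h : ∀ g ∈ ({x, y, z} : Set (Equiv.Perm Word)),
        g ∈ series (2 + 1) ⊔ Subgroup.closure (seriesGens 2) :=
      fun g hg => hle (Subgroup.subset_closure hg)
    have hn' : n ∈ series (2 + 1) ⊔ Subgroup.closure (seriesGens 2) :=
      (le_sup_left : series (2 + 1) ≤ _) (by rw [series_three]; exact hn)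
    exact Subgroup.mul_mem _ (Subgroup.pow_mem _ (h x (by simp)) i)
      (Subgroup.mul_mem _ (Subgroup.pow_mem _ (h y (by simp)) j)
        (Subgroup.mul_mem _ (Subgroup.pow_mem _ (h z (by simp)) k) hn'))
  | h k r hr =>
    have hr2 : r / 2 < 2 ^ k := by rw [pow_succ] at hr; omega
    rw [seriesGens_layer hr, add_assoc _ r 1, series_layer hr, series_layer hr.le]
    intro g hg
    obtain ⟨h, h1, h2, h3⟩ := hg
    set C := Subgroup.closure (layerGens k r) with hC
    have hspread : ∀ (h : Equiv.Perm Word) (m i : ℕ) (c : ZMod 2),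
        spread h m (basisU m i) ∈ layerGens k r → spread h m (c • basisU m i) ∈ C := by
      intro h m i c hmem
      rcases ZMod.eq_zero_or_one c with rfl | rfl
      · rw [zero_smul, spread_zero]
        exact Subgroup.one_mem _
      · rw [one_smul]
        exact Subgroup.subset_closure hmem
    set u0 := coef (k + 1) r (layer k g).1 • basisU (k + 1) r with hu0
    set u1 := coef (k + 1) r (layer k g).2.1 • basisU (k + 1) r with hu1
    set u2 := coef k (r / 2) (layer k g).2.2 • basisU k (r / 2) with hu2
    set p := spread x (k + 1) u0 * spread y (k + 1) u1 * spread (x * x) k u2 with hp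
    have hpC : p ∈ C := Subgroup.mul_mem _ (Subgroup.mul_mem _
      (hspread _ _ _ _ (by simp [layerGens])) (hspread _ _ _ _ (by simp [layerGens])))
      (hspread _ _ _ _ (by simp [layerGens]))
    have hpN : p ∈ power (Nt 1) k := Subgroup.mul_mem _ (Subgroup.mul_mem _ (spread_x_mem k u0)
      (spread_y_mem k u1)) (spread_sq_mem k u2)
    have hlp : layer k p = (u0, u1, u2) := by
      rw [hp, layer_mul (Subgroup.mul_mem _ (spread_x_mem k u0) (spread_y_mem k u1))
        (spread_sq_mem k u2), layer_mul (spread_x_mem k u0) (spread_y_mem k u1),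
        layer_spread_x, layer_spread_y, layer_spread_sq]
      simp
    have hgp : g * p⁻¹ ∈ layerSub k (r + 1) := by
      refine ⟨Subgroup.mul_mem _ h (Subgroup.inv_mem _ hpN), ?_⟩
      rw [layer_mul h (Subgroup.inv_mem _ hpN), layer_inv hpN, hlp]
      have hsub : ∀ {m : ℕ} (u w : U m), u + w = u - w := fun u w => by
        rw [sub_eq_add_neg, neg_eq_self_U]
      simp only [Prod.fst_add, Prod.snd_add, hsub]
      exact ⟨sub_smul_basisU_mem hr h1, sub_smul_basisU_mem hr h2,
        Usub_anti k (by omega) (sub_smul_basisU_mem hr2 h3)⟩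
    have e : g = g * p⁻¹ * p := by group
    rw [e]
    exact Subgroup.mul_mem _ ((le_sup_left : layerSub k (r + 1) ≤ _) hgp)
      ((le_sup_right : C ≤ layerSub k (r + 1) ⊔ C) hpC)

/-! ### The recursion for the series -/

/-- `(x, …, x)` on level `k`. -/
def xAll : ℕ → Equiv.Perm Word
  | 0 => x
  | k + 1 => pair (xAll k, xAll k)

/-- All binary digits of `2 ^ k - 1` are `1`, so this basis vector is the constant function `1`, the
last one of its layer. -/
theorem xAll_eq (k : ℕ) : xAll k = spread x k (basisU k (2 ^ k - 1)) := by
  induction k with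
  | zero => rfl
  | succ k ih =>
    have h : 2 ^ (k + 1) - 1 = 2 * (2 ^ k - 1) + 1 := by
      have := Nat.one_le_two_pow (n := k)
      rw [pow_succ]; omega
    rw [h, basisU_odd, spread, lo_join, hi_join, ← ih]
    rfl

theorem xAll_mem (k : ℕ) : xAll k ∈ series (2 ^ (k + 1)) := by
  cases k with
  | zero => exact Kt_le_Mt x_mem_Kt
  | succ k =>
    have h := Nat.one_le_two_pow (n := k + 1)
    have e : 2 ^ (k + 1 + 1) = 2 ^ (k + 1) + 1 + (2 ^ (k + 1) - 1) := by
      rw [pow_succ 2 (k + 1)]; omega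
    rw [e, series_layer (by omega), xAll_eq]
    exact spread_x_mem_layerSub (basisU_mem (by omega) le_rfl)

theorem dir_comm_xAll (l : Label) (k : ℕ) :
    dir l * xAll (k + 1) * (dir l)⁻¹ * (xAll (k + 1))⁻¹ =
      pair (sidePerm l * xAll k * (sidePerm l)⁻¹ * (xAll k)⁻¹,
        dir l.next * xAll k * (dir l.next)⁻¹ * (xAll k)⁻¹) := by
  rw [xAll, dir_conj_pair, pair_inv, pair_mul]

theorem sidePerm_comm_xAll (l : Label) (k : ℕ) :
    sidePerm l * xAll (k + 1) * (sidePerm l)⁻¹ * (xAll (k + 1))⁻¹ = 1 := by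
  rcases sidePerm_eq l with h | h <;> rw [h]
  · exact a_comm_pair_self _
  · rw [one_mul, inv_one, mul_one, mul_inv_cancel]

/-- A copy of `x⁻¹` on level `k + 1` is a commutator with `(x, …, x)`. -/
theorem exists_comm_xAll_eq_x (k : ℕ) : ∃ l, dir l * xAll k * (dir l)⁻¹ * (xAll k)⁻¹ =
    atVertex x⁻¹ (List.replicate (k + 1) 1) := by
  -- The induction starts on level `1`: from there on `(x, …, x)` has equal halves, hence commutes
  -- with every section below `0`. On level `0` this fails for `a`, but `c̃` has trivial section
  -- there.
  have h1 : dir .c * xAll 1 * (dir .c)⁻¹ * (xAll 1)⁻¹ = atVertex x⁻¹ (List.replicate 2 1) := by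
    rw [dir_comm_xAll]
    have e : dir (Label.next .c) * xAll 0 * (dir (Label.next .c))⁻¹ * (xAll 0)⁻¹ =
      pair (1, x⁻¹) := d_comm_x
    rw [e, sidePerm, one_mul, inv_one, mul_one, mul_inv_cancel]
    rfl
  rcases k with _ | k
  · exact ⟨.d, d_comm_x⟩
  induction k with
  | zero => exact ⟨.c, h1⟩
  | succ k ih =>
    obtain ⟨l, hl⟩ := ih
    obtain ⟨l, rfl⟩ := l.exists_next
    exact ⟨l, by rw [dir_comm_xAll, hl, sidePerm_comm_xAll]; rfl⟩

/-- A copy of `y⁻¹` on level `k + 1` is, up to an element of `T̃_k`, a commutator with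
`(x, …, x)`. -/
theorem exists_comm_xAll_eq_y (k : ℕ) : ∃ l, ∃ t ∈ power Tt k,
    dir l * xAll k * (dir l)⁻¹ * (xAll k)⁻¹ = t * atVertex y⁻¹ (List.replicate (k + 1) 1) := by
  rcases k with _ | k
  · exact ⟨.c, 1, Subgroup.one_mem _, by rw [one_mul]; exact c_comm_x⟩
  induction k with
  | zero =>
    -- The label preceding `c̃` is `b̃`, whose section `a` at `0` inverts `x`; this produces the
    -- only correction in `T̃`.
    refine ⟨.b, pair ((x * x)⁻¹, 1),
      pair_mem_power (Tt.inv_mem x_mul_x_mem_Tt) (Subgroup.one_mem _), ?_⟩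
    rw [dir_comm_xAll]
    have e : dir (Label.next .b) * xAll 0 * (dir (Label.next .b))⁻¹ * (xAll 0)⁻¹ =
      pair (1, y⁻¹) := c_comm_x
    have e2 : sidePerm .b * xAll 0 * (sidePerm .b)⁻¹ * (xAll 0)⁻¹ = (x * x)⁻¹ := a_comm_x
    have e3 : atVertex y⁻¹ (List.replicate (0 + 1 + 1) 1) = pair (1, pair (1, y⁻¹)) := rfl
    rw [e, e2, e3, pair_mul, mul_one, one_mul]
  | succ k ih =>
    obtain ⟨l, t, ht, hl⟩ := ih
    obtain ⟨l, rfl⟩ := l.exists_next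
    refine ⟨l, pair (1, t), pair_mem_power (Subgroup.one_mem _) ht, ?_⟩
    have e3 : atVertex y⁻¹ (List.replicate (k + 1 + 1 + 1) 1) =
      pair (1, atVertex y⁻¹ (List.replicate (k + 1 + 1) 1)) := rfl
    rw [dir_comm_xAll, hl, sidePerm_comm_xAll, e3, pair_mul, one_mul]

/-- Transitivity reduces the claim to one copy each of `x²`, `x` and `y`. The first is given; it
yields `T̃_k ≤ R`, which absorbs the correction in the commutator of `(x, …, x)` giving `y⁻¹`. -/
theorem power_Nt_one_le_of_comm {R : Subgroup (Equiv.Perm Word)} (hR : ConjInv R) (k : ℕ)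
    (hcomm : ∀ s, ∀ u ∈ series (2 ^ (k + 1)), gen s * u * (gen s)⁻¹ * u⁻¹ ∈ R)
    (hsq : ∃ σ : Word, σ.length = k ∧ atVertex (x * x) σ ∈ R) : power (Nt 1) k ≤ R := by
  have hT : power Tt k ≤ R := by
    refine power_normalClosureGt_le hR ?_
    rintro _ rfl
    rwa [pow_two]
  have hK : power Kt (k + 1) ≤ R := by
    refine power_normalClosureGt_le hR ?_
    rintro _ (rfl | rfl) <;> refine ⟨List.replicate (k + 1) 1, List.length_replicate .., ?_⟩
    · obtain ⟨l, hl⟩ := exists_comm_xAll_eq_x k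
      have := R.inv_mem (hcomm (some l) _ (xAll_mem k))
      rw [gen, hl, ← atVertex_inv, inv_inv] at this
      exact this
    · obtain ⟨l, t, ht, hl⟩ := exists_comm_xAll_eq_y k
      have := hcomm (some l) _ (xAll_mem k)
      rw [gen, hl] at this
      have := R.inv_mem ((R.mul_mem_cancel_left (hT ht)).1 this)
      rw [← atVertex_inv, inv_inv] at this
      exact this
  rw [← Nt_succ]
  exact sup_le hK hT

theorem basisU_zero (m : ℕ) : basisU m 0 = delta fun _ => 0 := by
  induction m with
  | zero =>
    ext σ
    rw [Subsingleton.elim σ fun _ => 0]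
    simp [basisU, delta]
  | succ m ih =>
    have e : (fun _ => 0 : Fin (m + 1) → ZMod 2) = Fin.cons 0 fun _ => 0 := by
      ext i
      refine Fin.cases ?_ (fun i => ?_) i <;> simp
    rw [e, delta_cons_zero, ← ih]
    exact basisU_even m 0

/-- Includes `k = 0`: there `x` is a generator of `M̃`, of weight `2 = 2 ^ 0 + 1`. -/
theorem spread_x_mem_seriesGens {k j : ℕ} (hj : j < 2 ^ k) :
    spread x k (basisU k j) ∈ seriesGens (2 ^ k + 1 + j) := by
  cases k with
  | zero =>
    obtain rfl : j = 0 := by simpa using hj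
    exact Or.inl rfl
  | succ k =>
    rw [seriesGens_layer hj]
    exact Or.inl rfl

/-- A single copy of `x` on level `k` is the first generator of its layer, of weight `2 ^ k + 1`;
the bounds say that its square is among those allowed at weight `n`. -/
theorem exists_atVertex_sq_mem {R : Subgroup (Equiv.Perm Word)} {n k : ℕ}
    (hsq : ∀ j s, j < n → n ≤ 2 * j → s ∈ seriesGens j → s * s ∈ R)
    (h1 : 2 ^ k + 1 < n) (h2 : n ≤ 2 ^ (k + 1) + 2) :
    ∃ σ : Word, σ.length = k ∧ atVertex (x * x) σ ∈ R := by
  refine ⟨List.ofFn fun _ : Fin k => (0 : ZMod 2), List.length_ofFn, ?_⟩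
  rw [← spread_delta, ← basisU_zero, ← spread_mul_self]
  refine hsq (2 ^ k + 1) _ h1 (by rw [pow_succ] at h2; omega) ?_
  exact spread_x_mem_seriesGens (Nat.two_pow_pos k)

/-- The image in `U (k+1) × U (k+1) × U k` of a subgroup. -/
def layerImage (R : Subgroup (Equiv.Perm Word)) (k : ℕ) :
    Submodule (ZMod 2) (U (k + 1) × U (k + 1) × U k) where
  carrier := {t | ∃ g ∈ R, g ∈ power (Nt 1) k ∧ layer k g = t}
  add_mem' := by
    rintro _ _ ⟨g, hg, hg', rfl⟩ ⟨h, hh, hh', rfl⟩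
    exact ⟨g * h, R.mul_mem hg hh, Subgroup.mul_mem _ hg' hh', layer_mul hg' hh'⟩
  zero_mem' := ⟨1, R.one_mem, Subgroup.one_mem _, layer_one k⟩
  smul_mem' := by
    rintro c _ ⟨g, hg, hg', rfl⟩
    rcases ZMod.eq_zero_or_one c with rfl | rfl
    · exact ⟨1, R.one_mem, Subgroup.one_mem _, by rw [layer_one, zero_smul]⟩
    · exact ⟨g, hg, hg', (one_smul _ _).symm⟩

theorem layer_comm {k : ℕ} (s : Option Label) {g : Equiv.Perm Word} (hg : g ∈ power (Nt 1) k) :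
    layer k (gen s * g * (gen s)⁻¹ * g⁻¹ : Equiv.Perm Word) =
      (actU (k + 1) s (layer k g).1 - (layer k g).1,
        actU (k + 1) s (layer k g).2.1 - (layer k g).2.1,
        actU k s (layer k g).2.2 - (layer k g).2.2) := by
  have hsub : ∀ {m : ℕ} (u w : U m), u + w = u - w := fun u w => by
    rw [sub_eq_add_neg, neg_eq_self_U]
  rw [layer_mul (conjInv_Nt_one.power k s g hg) (Subgroup.inv_mem _ hg), layer_inv hg,
    layer_conj s hg]
  simp only [Prod.ext_iff, Prod.fst_add, Prod.snd_add, hsub, and_self]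

/-- The minimality half of the recursion. Inside a layer, `R` contains the next layer and it remains
to fill the image of `layer`: the first two components by commutators, through uniseriality, and the
third by squares. -/
theorem series_le_of_comm_of_sq {R : Subgroup (Equiv.Perm Word)} (hR : ConjInv R) {n : ℕ}
    (hn : 2 ≤ n)
    (hcomm : ∀ s, ∀ u ∈ series (n - 1), gen s * u * (gen s)⁻¹ * u⁻¹ ∈ R)
    (hsq : ∀ j s, j < n → n ≤ 2 * j → s ∈ seriesGens j → s * s ∈ R) : series n ≤ R := by
  induction n using series_cases with
  | h0 => omega
  | h1 => omega
  | h2 =>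
    refine normalClosureGt_le hR ?_
    rintro _ (rfl | rfl | rfl)
    · exact hcomm none _ (dir_mem .b)
    · exact hcomm none _ (dir_mem .d)
    · exact hcomm none _ (dir_mem .c)
  | h k r hr =>
    have hp1 := Nat.one_le_two_pow (n := k)
    have hp2 : 2 ^ (k + 1) = 2 * 2 ^ k := by rw [pow_succ, mul_comm]
    have hp3 : 2 ^ (k + 1 + 1) = 2 * 2 ^ (k + 1) := by rw [pow_succ, mul_comm]
    rw [series_layer hr.le]
    rcases Nat.eq_zero_or_pos r with rfl | hr0
    · rw [layerSub_zero]
      exact power_Nt_one_le_of_comm hR k (by simpa using hcomm)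
        (exists_atVertex_sq_mem hsq (by omega) (by omega))
    obtain ⟨r, rfl⟩ : ∃ r', r = r' + 1 := ⟨r - 1, by omega⟩
    -- The element `(x, …, x)` on level `k + 1` has weight `2 ^ (k + 2) ≥ n - 1`, so its commutators
    -- are already in `R`.
    have hker : power (Nt 1) (k + 1) ≤ R := by
      refine power_Nt_one_le_of_comm hR (k + 1) (fun s u hu => hcomm s u ?_)
        (exists_atVertex_sq_mem hsq (by omega) (by omega))
      exact series_anti (by omega) hu
    have hcomm' : ∀ s, ∀ u ∈ layerSub k r, gen s * u * (gen s)⁻¹ * u⁻¹ ∈ R := by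
      intro s u hu
      refine hcomm s u ?_
      rw [← series_layer (by omega)] at hu
      exact hu
    set W := layerImage R k with hW
    have hx : Usub (k + 1) (r + 1) ≤
        W.comap (LinearMap.inl (ZMod 2) (U (k + 1)) (U (k + 1) × U k)) := by
      refine Usub_succ_le fun s u hu => ?_
      have hmem := spread_x_mem k u
      refine ⟨_, hcomm' s _ (spread_x_mem_layerSub hu), Subgroup.mul_mem _
        (conjInv_Nt_one.power k s _ hmem) (Subgroup.inv_mem _ hmem), ?_⟩
      rw [layer_comm s hmem, layer_spread_x]
      simp
    have hy : Usub (k + 1) (r + 1) ≤ W.comap (LinearMap.inr (ZMod 2) (U (k + 1)) (U (k + 1) × U k) ∘ₗ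
        LinearMap.inl (ZMod 2) (U (k + 1)) (U k)) := by
      refine Usub_succ_le fun s u hu => ?_
      have hmem := spread_y_mem k u
      refine ⟨_, hcomm' s _ (spread_y_mem_layerSub hu), Subgroup.mul_mem _
        (conjInv_Nt_one.power k s _ hmem) (Subgroup.inv_mem _ hmem), ?_⟩
      rw [layer_comm s hmem, layer_spread_y]
      simp
    have hs : Usub k ((r + 1) / 2) ≤ W.comap (LinearMap.inr (ZMod 2) (U (k + 1)) (U (k + 1) × U k) ∘ₗ
        LinearMap.inr (ZMod 2) (U (k + 1)) (U k)) := by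
      rw [Usub_eq_span, Submodule.span_le]
      rintro _ ⟨j, hj, hj2, rfl⟩
      refine ⟨spread (x * x) k (basisU k j), ?_, spread_sq_mem k _, layer_spread_sq k _⟩
      rw [← spread_mul_self]
      -- With `n = 2 ^ (k + 1) + 2 + r`, the condition `n ≤ 2 (2 ^ k + 1 + j)` reads `r ≤ 2j`, that
      -- is, `(r + 1) / 2 ≤ j`.
      exact hsq (2 ^ k + 1 + j) _ (by omega) (by omega) (spread_x_mem_seriesGens hj2)
    rintro g ⟨hg, g0, g1, g2⟩
    have hgW : layer k g ∈ W := by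
      have e0 : ((layer k g).1, 0, 0) ∈ W := hx g0
      have e1 : (0, (layer k g).2.1, 0) ∈ W := hy g1
      have e2 : (0, 0, (layer k g).2.2) ∈ W := hs g2
      have := add_mem (add_mem e0 e1) e2
      simpa using this
    obtain ⟨h, hhR, hh, e⟩ := hgW
    have h0 : g * h⁻¹ ∈ power (Nt 1) (k + 1) := by
      rw [← layer_eq_zero_iff (Subgroup.mul_mem _ hg (Subgroup.inv_mem _ hh)),
        layer_mul hg (Subgroup.inv_mem _ hh), layer_inv hh, e]
      simp only [Prod.ext_iff, Prod.fst_add, Prod.snd_add, Prod.fst_zero, Prod.snd_zero]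
      refine ⟨?_, ?_, ?_⟩ <;> exact funext fun _ => ZMod.add_self_two _
    have := R.mul_mem (hker h0) hhR
    simpa using this

/-! ### The dimension series -/

theorem isRestrictedSeries : IsRestrictedSeries (fun n => (series n).subgroupOf Gt)
    (fun n => (Subtype.val : Gt → Equiv.Perm Word) ⁻¹' seriesGens n) where
  one_eq := Subgroup.subgroupOf_eq_top.2 le_rfl
  anti _ _ h := Subgroup.comap_mono (series_anti h)
  comm n := by
    rw [Subgroup.commutator_le]
    rintro ⟨g, hg⟩ - ⟨u, hu⟩ hun
    exact series_comm n hg hun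
  finite n := (seriesGens_finite n).preimage Subtype.val_injective.injOn
  subset n s hs := seriesGens_subset n hs
  gen n := by
    have hle : ((Subtype.val : Gt → Equiv.Perm Word) '' (Subtype.val ⁻¹' seriesGens n)) =
        seriesGens n := by
      rw [Set.image_preimage_eq_iff]
      intro s hs
      exact ⟨⟨s, series_le_Gt n (seriesGens_subset n hs)⟩, rfl⟩
    rw [← Subgroup.map_le_map_iff_of_injective Gt.subtype_injective, Subgroup.map_sup,
      MonoidHom.map_closure, Subgroup.map_subgroupOf_eq_of_le (series_le_Gt n),
      Subgroup.map_subgroupOf_eq_of_le (series_le_Gt (n + 1)), Subgroup.coe_subtype, hle]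
    exact series_gen n
  sq n s hs := seriesGens_sq n s.1 hs
  lower n hn := by
    set R := ⁅(⊤ : Subgroup Gt), (series (n - 1)).subgroupOf Gt⁆ ⊔ Subgroup.normalClosure
      {t : Gt | ∃ j s, j < n ∧ n ≤ 2 * j ∧
        s ∈ (Subtype.val : Gt → Equiv.Perm Word) ⁻¹' seriesGens j ∧ t = s * s} with hR
    have hN : ((series (n - 1)).subgroupOf Gt).Normal := ⟨fun u hu g =>
      (conjInv_series (n - 1)).conj_mem g.2 _ hu⟩
    have hRn : R.Normal := inferInstance
    have hRc : ConjInv (R.map Gt.subtype) := by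
      rintro s _ ⟨g, hg, rfl⟩
      exact ⟨_, hRn.conj_mem g hg ⟨gen s, gen_mem s⟩, rfl⟩
    rw [← Subgroup.map_le_map_iff_of_injective Gt.subtype_injective,
      Subgroup.map_subgroupOf_eq_of_le (series_le_Gt n)]
    refine series_le_of_comm_of_sq hRc hn (fun s u hu => ?_) (fun j s hj hj2 hs => ?_)
    · refine ⟨⁅(⟨gen s, gen_mem s⟩ : Gt), ⟨u, series_le_Gt _ hu⟩⁆, ?_, rfl⟩
      exact (le_sup_left : _ ≤ R) (Subgroup.commutator_mem_commutator (Subgroup.mem_top _) hu)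
    · refine ⟨⟨s, series_le_Gt j (seriesGens_subset j hs)⟩ *
        ⟨s, series_le_Gt j (seriesGens_subset j hs)⟩, ?_, rfl⟩
      exact (le_sup_right : _ ≤ R) (Subgroup.subset_normalClosure ⟨j, _, hj, hj2, hs, rfl⟩)

theorem dimensionSubgroup_Gt {n : ℕ} (hn : 1 ≤ n) :
    dimensionSubgroup (ZMod 2) Gt n = (series n).subgroupOf Gt :=
  isRestrictedSeries.dimensionSubgroup_eq hn

theorem dimGt_eq {n : ℕ} (hn : 1 ≤ n) : dimGt n = series n := by
  rw [dimGt, dimensionSubgroup_Gt hn, Subgroup.map_subgroupOf_eq_of_le (series_le_Gt n)]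

/-! ### Comparison with the modules `V n` -/

/-- The element of `V m` with given coefficients. -/
noncomputable def toV (m : ℕ) : U m ≃ₗ[ZMod 2] V m :=
  (Finsupp.linearEquivFunOnFinite (ZMod 2) (ZMod 2) (Fin m → ZMod 2)).symm ≪≫ₗ
    (AddMonoidAlgebra.coeffLinearEquiv (ZMod 2)).symm

theorem toV_delta {m : ℕ} (σ : Fin m → ZMod 2) : toV m (delta σ) = monomial σ := by
  rw [← LinearEquiv.eq_symm_apply]
  ext τ
  simp [toV, delta, monomial, Pi.single_apply, Finsupp.single_apply, eq_comm]

theorem U_eq_sum {m : ℕ} (u : U m) : u = ∑ σ, u σ • delta σ := by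
  ext τ
  simp [delta, Finset.sum_apply, Pi.single_apply]

/-- Prefixing a letter `0`. -/
noncomputable def consZero (m : ℕ) : V m →ₐ[ZMod 2] V (m + 1) :=
  AddMonoidAlgebra.mapDomainAlgHom (ZMod 2) (ZMod 2)
    { toFun := fun σ => (Fin.cons 0 σ : Fin (m + 1) → ZMod 2)
      map_zero' := by ext i; refine Fin.cases ?_ (fun i => ?_) i <;> simp
      map_add' := fun σ τ => by ext i; refine Fin.cases ?_ (fun i => ?_) i <;> simp }

theorem consZero_monomial {m : ℕ} (σ : Fin m → ZMod 2) :
    consZero m (monomial σ) = monomial (Fin.cons 0 σ : Fin (m + 1) → ZMod 2) := by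
  simp [consZero, monomial]

theorem X_zero_mul_monomial {m : ℕ} (σ : Fin m → ZMod 2) :
    X 0 * monomial (Fin.cons 0 σ : Fin (m + 1) → ZMod 2) =
      monomial (Fin.cons 1 σ : Fin (m + 1) → ZMod 2) := by
  rw [X, monomial, monomial, AddMonoidAlgebra.single_mul_single, one_mul, monomial]
  congr 1
  ext i
  refine Fin.cases ?_ (fun i => ?_) i <;> simp

theorem consZero_X {m : ℕ} (i : Fin m) : consZero m (X i) = X i.succ := by
  rw [X, consZero_monomial, X]
  congr 1
  ext j
  refine Fin.cases ?_ (fun j => ?_) j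
  · simp
  · simp [Pi.single_apply, Fin.succ_inj]

theorem toV_join {m : ℕ} (u0 u1 : U m) :
    toV (m + 1) (join m (u0, u1)) = consZero m (toV m u0) + X 0 * consZero m (toV m u1) := by
  have h0 : ∀ u : U m, toV (m + 1) (join m (u, 0)) = consZero m (toV m u) := by
    intro u
    have : (toV (m + 1)).toLinearMap ∘ₗ join m ∘ₗ LinearMap.inl (ZMod 2) (U m) (U m) =
        (consZero m).toLinearMap ∘ₗ (toV m).toLinearMap := by
      refine (Pi.basisFun (ZMod 2) (Fin m → ZMod 2)).ext fun σ => ?_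
      rw [Pi.basisFun_apply]
      change toV (m + 1) (join m (delta σ, 0)) = consZero m (toV m (delta σ))
      rw [← delta_cons_zero, toV_delta, toV_delta, consZero_monomial]
    exact LinearMap.congr_fun this u
  have h1 : ∀ u : U m, toV (m + 1) (join m (0, u)) = X 0 * consZero m (toV m u) := by
    intro u
    have : (toV (m + 1)).toLinearMap ∘ₗ join m ∘ₗ LinearMap.inr (ZMod 2) (U m) (U m) =
        LinearMap.mulLeft (ZMod 2) (X 0) ∘ₗ (consZero m).toLinearMap ∘ₗ (toV m).toLinearMap := by
      refine (Pi.basisFun (ZMod 2) (Fin m → ZMod 2)).ext fun σ => ?_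
      rw [Pi.basisFun_apply]
      change toV (m + 1) (join m (0, delta σ)) = X 0 * consZero m (toV m (delta σ))
      rw [← delta_cons_one, toV_delta, toV_delta, consZero_monomial, X_zero_mul_monomial]
    exact LinearMap.congr_fun this u
  have e : join m (u0, u1) = join m (u0, 0) + join m (0, u1) := by
    rw [← map_add, Prod.mk_add_mk, add_zero, zero_add]
  rw [e, map_add, h0, h1]

theorem v_succ (m r : ℕ) : v (m + 1) r = (1 - X 0) ^ (r % 2) * consZero m (v m (r / 2)) := by
  rw [v, Fin.prod_univ_succ, v, map_prod]
  congr 1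
  · simp
  · refine Finset.prod_congr rfl fun i _ => ?_
    rw [map_pow, map_sub, map_one, consZero_X, Fin.val_succ, pow_succ', Nat.div_div_eq_div_mul]

theorem neg_eq_self_V {m : ℕ} (w : V m) : -w = w := by
  have : (-1 : ZMod 2) = 1 := rfl
  rw [← one_smul (ZMod 2) w, ← neg_smul, this]

/-- Both recursions strip the lowest binary digit, which belongs to `X 0`, the first letter. A digit
`1` contributes `1 - X 0 = 1 + X 0`, that is, two equal halves. -/
theorem toV_basisU (m r : ℕ) : toV m (basisU m r) = v m r := by
  induction m generalizing r with
  | zero =>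
    have e : basisU 0 r = delta (fun _ => 0) := by
      rw [← basisU_zero]; rfl
    rw [e, toV_delta, v, Fin.prod_univ_zero]
    rfl
  | succ m ih =>
    rw [v_succ]
    rcases Nat.even_or_odd' r with ⟨k, rfl | rfl⟩
    · have h1 : 2 * k % 2 = 0 := by omega
      have h2 : 2 * k / 2 = k := by omega
      rw [basisU_even, toV_join, map_zero, map_zero, mul_zero, add_zero, ih, h1, h2, pow_zero,
        one_mul]
    · have h1 : (2 * k + 1) % 2 = 1 := by omega
      have h2 : (2 * k + 1) / 2 = k := by omega
      rw [basisU_odd, toV_join, ih, h1, h2, pow_one, sub_mul, one_mul, sub_eq_add_neg,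
        neg_eq_self_V]

theorem toV_mem_Vsub {m r : ℕ} {u : U m} : toV m u ∈ Vsub m r ↔ u ∈ Usub m r := by
  have h : Vsub m r = (Usub m r).map (toV m).toLinearMap := by
    rw [Usub_eq_span, Submodule.map_span, Vsub]
    congr 1
    ext w
    constructor
    · rintro ⟨j, hj, hj2, rfl⟩
      exact ⟨_, ⟨j, hj, hj2, rfl⟩, toV_basisU m j⟩
    · rintro ⟨_, ⟨j, hj, hj2, rfl⟩, rfl⟩
      exact ⟨j, hj, hj2, toV_basisU m j⟩
  rw [h]
  exact (toV m).injective.mem_set_image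

/-! ### The layer isomorphism -/

theorem Nt_succ_mem {k : ℕ} (g : Nt (k + 1)) : (g : Equiv.Perm Word) ∈ power (Nt 1) k :=
  Nt_succ k ▸ g.2

/-- The map `α ⊕ β ⊕ γ` on `Ñ_{k+1}`. -/
noncomputable def layerHom (k : ℕ) :
    Nt (k + 1) →* Multiplicative (V (k + 1) × V (k + 1) × V (k + 1 - 1)) where
  toFun g := Multiplicative.ofAdd (toV (k + 1) (layer k g.1).1, toV (k + 1) (layer k g.1).2.1,
    toV k (layer k g.1).2.2)
  map_one' := by
    rw [Subgroup.coe_one, layer_one]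
    simp only [Prod.fst_zero, Prod.snd_zero, map_zero]
    rfl
  map_mul' g h := by
    rw [Subgroup.coe_mul, layer_mul (Nt_succ_mem g) (Nt_succ_mem h)]
    simp only [Prod.fst_add, Prod.snd_add, map_add]
    rfl

theorem layerHom_apply {k : ℕ} (g : Nt (k + 1)) : layerHom k g =
    Multiplicative.ofAdd (toV (k + 1) (layer k g.1).1, toV (k + 1) (layer k g.1).2.1,
      toV k (layer k g.1).2.2) := rfl

theorem layerHom_eq_iff {k : ℕ} {g h : Nt (k + 1)} :
    layerHom k g = layerHom k h ↔ layer k g.1 = layer k h.1 := by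
  rw [layerHom_apply, layerHom_apply, Multiplicative.ofAdd.apply_eq_iff_eq]
  simp only [EmbeddingLike.apply_eq_iff_eq, Prod.ext_iff]

theorem mem_layerHom_ker {k : ℕ} {g : Nt (k + 1)} :
    g ∈ (layerHom k).ker ↔ g.1 ∈ Nt (k + 1 + 1) := by
  have : layerHom k g = 1 ↔ layerHom k g = layerHom k 1 := by rw [map_one]
  rw [MonoidHom.mem_ker, this, layerHom_eq_iff, Subgroup.coe_one, layer_one,
    layer_eq_zero_iff (Nt_succ_mem g), Nt_succ (k + 1)]

theorem mem_Nt_of_mem_power {k : ℕ} {g : Equiv.Perm Word} (hg : g ∈ power (Nt 1) k) :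
    g ∈ Nt (k + 1) := by
  rwa [Nt_succ]

theorem isLayerIso_layerHom (k : ℕ) : IsLayerIso (k + 1) (layerHom k) where
  surjective := by
    intro t
    set u0 := (toV (k + 1)).symm t.toAdd.1 with h0
    set u1 := (toV (k + 1)).symm t.toAdd.2.1 with h1
    set u2 := (toV k).symm t.toAdd.2.2 with h2
    have hx := spread_x_mem k u0
    have hy := spread_y_mem k u1
    have hs := spread_sq_mem k u2
    refine ⟨⟨_, mem_Nt_of_mem_power (Subgroup.mul_mem _ (Subgroup.mul_mem _ hx hy) hs)⟩, ?_⟩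
    rw [layerHom_apply]
    simp only [layer_mul (Subgroup.mul_mem _ hx hy) hs, layer_mul hx hy, layer_spread_x,
      layer_spread_y, layer_spread_sq, Prod.mk_add_mk, add_zero, zero_add]
    rw [h0, h1, h2, LinearEquiv.apply_symm_apply, LinearEquiv.apply_symm_apply,
      LinearEquiv.apply_symm_apply]
    rfl
  ker_eq := by
    ext g
    constructor
    · rintro ⟨g, hg, rfl⟩
      exact mem_layerHom_ker.1 hg
    · intro hg
      exact ⟨⟨g, Nt_succ_le (by omega) hg⟩, mem_layerHom_ker.2 hg, rfl⟩
  map_x σ := by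
    have hmem := spread_x_mem k (delta σ)
    have hl := layer_spread_x k (delta σ)
    rw [spread_delta] at hmem hl
    refine ⟨mem_Nt_of_mem_power hmem, ?_⟩
    rw [layerHom_apply]
    simp only [hl, toV_delta, map_zero]
  map_y σ := by
    have hmem := spread_y_mem k (delta σ)
    have hl := layer_spread_y k (delta σ)
    rw [spread_delta] at hmem hl
    refine ⟨mem_Nt_of_mem_power hmem, ?_⟩
    rw [layerHom_apply]
    simp only [hl, toV_delta, map_zero]
  map_x_sq σ := by
    have hmem := spread_sq_mem k (delta σ)
    have hl := layer_spread_sq k (delta σ)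
    rw [spread_delta, ← pow_two] at hmem hl
    refine ⟨mem_Nt_of_mem_power hmem, ?_⟩
    rw [layerHom_apply]
    simp only [hl, map_zero]
    exact congrArg (fun t => Multiplicative.ofAdd ((0 : V (k + 1)), (0 : V (k + 1)), t))
      (toV_delta (m := k) σ)

theorem IsLayerIso.mem_ker_iff {m : ℕ} {φ : Nt m →* Multiplicative (V m × V m × V (m - 1))}
    (h : IsLayerIso m φ) {g : Nt m} : g ∈ φ.ker ↔ g.1 ∈ Nt (m + 1) := by
  rw [← h.ker_eq]
  constructor
  · exact fun hg => ⟨g, hg, rfl⟩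
  · rintro ⟨g', hg', e⟩
    obtain rfl : g' = g := Subtype.ext e
    exact hg'

/-- The equalizer of the two maps contains the generators at all vertices, so its `layer` image is
everything. Hence every element agrees with one of the equalizer up to the common kernel `Ñ_{k+2}`.
-/
theorem IsLayerIso.eq_layerHom {k : ℕ}
    {φ : Nt (k + 1) →* Multiplicative (V (k + 1) × V (k + 1) × V (k + 1 - 1))}
    (h : IsLayerIso (k + 1) φ) : φ = layerHom k := by
  have h' := isLayerIso_layerHom k
  set L := φ.eqLocus (layerHom k) with hL
  set W := layerImage (L.map (Nt (k + 1)).subtype) k with hW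
  have hx : ∀ u : U (k + 1), (u, 0, 0) ∈ W := by
    intro u
    have : u ∈ W.comap (LinearMap.inl (ZMod 2) (U (k + 1)) (U (k + 1) × U k)) := by
      rw [U_eq_sum u]
      refine Submodule.sum_mem _ fun σ _ => Submodule.smul_mem _ _ ?_
      obtain ⟨hm, e⟩ := h.map_x σ
      obtain ⟨_, e'⟩ := h'.map_x σ
      refine ⟨_, ⟨⟨_, hm⟩, e.trans e'.symm, rfl⟩, Nt_succ_mem ⟨_, hm⟩, ?_⟩
      change layer k (atVertex x (List.ofFn σ)) = _
      rw [← spread_delta, layer_spread_x]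
      rfl
    exact this
  have hy : ∀ u : U (k + 1), (0, u, 0) ∈ W := by
    intro u
    have : u ∈ W.comap (LinearMap.inr (ZMod 2) (U (k + 1)) (U (k + 1) × U k) ∘ₗ
        LinearMap.inl (ZMod 2) (U (k + 1)) (U k)) := by
      rw [U_eq_sum u]
      refine Submodule.sum_mem _ fun σ _ => Submodule.smul_mem _ _ ?_
      obtain ⟨hm, e⟩ := h.map_y σ
      obtain ⟨_, e'⟩ := h'.map_y σ
      refine ⟨_, ⟨⟨_, hm⟩, e.trans e'.symm, rfl⟩, Nt_succ_mem ⟨_, hm⟩, ?_⟩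
      change layer k (atVertex y (List.ofFn σ)) = _
      rw [← spread_delta, layer_spread_y]
      rfl
    exact this
  have hs : ∀ u : U k, (0, 0, u) ∈ W := by
    intro u
    have : u ∈ W.comap (LinearMap.inr (ZMod 2) (U (k + 1)) (U (k + 1) × U k) ∘ₗ
        LinearMap.inr (ZMod 2) (U (k + 1)) (U k)) := by
      rw [U_eq_sum u]
      refine Submodule.sum_mem _ fun σ _ => Submodule.smul_mem _ _ ?_
      obtain ⟨hm, e⟩ := h.map_x_sq σ
      obtain ⟨_, e'⟩ := h'.map_x_sq σ
      refine ⟨_, ⟨⟨_, hm⟩, e.trans e'.symm, rfl⟩, Nt_succ_mem ⟨_, hm⟩, ?_⟩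
      change layer k (atVertex (x ^ 2) (List.ofFn (n := k) σ)) = _
      rw [← spread_delta, pow_two, layer_spread_sq]
      rfl
    exact this
  ext1 g
  have hgW : layer k g.1 ∈ W := by
    have := add_mem (add_mem (hx (layer k g.1).1) (hy (layer k g.1).2.1)) (hs (layer k g.1).2.2)
    simpa using this
  obtain ⟨_, ⟨l, hl, rfl⟩, -, e⟩ := hgW
  have hl : φ l = layerHom k l := hl
  have e1 : layerHom k l = layerHom k g := layerHom_eq_iff.2 e
  have e2 : l⁻¹ * g ∈ (layerHom k).ker := by
    rw [MonoidHom.mem_ker, map_mul, map_inv, e1, inv_mul_cancel]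
  have e3 : l⁻¹ * g ∈ φ.ker := h.mem_ker_iff.2 (mem_layerHom_ker.1 e2)
  rw [MonoidHom.mem_ker, map_mul, map_inv, inv_mul_eq_one] at e3
  rw [← e3, hl, e1]

theorem layerPreimage_layerHom {k r : ℕ} : layerPreimage (layerHom k) (Vsub (k + 1) r)
    (Vsub (k + 1) r) (Vsub (k + 1 - 1) (r / 2)) = layerSub k r := by
  have key : ∀ g : Nt (k + 1), g ∈ (AddSubgroup.toSubgroup ((Vsub (k + 1) r).prod
      ((Vsub (k + 1) r).prod (Vsub (k + 1 - 1) (r / 2)))).toAddSubgroup).comap (layerHom k) ↔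
      g.1 ∈ layerSub k r := by
    intro g
    change (toV (k + 1) (layer k g.1).1 ∈ Vsub (k + 1) r ∧ toV (k + 1) (layer k g.1).2.1 ∈
      Vsub (k + 1) r ∧ toV k (layer k g.1).2.2 ∈ Vsub k (r / 2)) ↔ _
    rw [toV_mem_Vsub, toV_mem_Vsub, toV_mem_Vsub, mem_layerSub]
    exact ⟨fun h => ⟨Nt_succ_mem g, h⟩, fun h => h.2⟩
  ext g
  constructor
  · rintro ⟨g, hg, rfl⟩
    exact (key g).1 hg
  · intro hg
    exact ⟨⟨g, mem_Nt_of_mem_power hg.1⟩, (key ⟨g, mem_Nt_of_mem_power hg.1⟩).2 hg, rfl⟩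

/-! ### The ranks -/

/-- Since `ℤ → 𝔽₂` is onto, tensoring an `𝔽₂`-space with `𝔽₂` over `ℤ` is the same as over `𝔽₂`, and
changes nothing. -/
theorem dimensionRank_eq_of_mulEquiv {G : Type*} [Group G] {i d : ℕ}
    (e : DimensionFactor (ZMod 2) G i ≃* Multiplicative (Fin d → ZMod 2)) :
    dimensionRank (ZMod 2) G i = d := by
  let E : Additive (DimensionFactor (ZMod 2) G i) ≃+ (Fin d → ZMod 2) :=
    { toFun := fun q => (e q.toMul).toAdd
      invFun := fun w => Additive.ofMul (e.symm (Multiplicative.ofAdd w))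
      left_inv := fun q => by simp
      right_inv := fun w => by simp
      map_add' := fun p q => by rw [toMul_add, map_mul]; rfl }
  have : TensorProduct.CompatibleSMul ℤ (ZMod 2) (ZMod 2) (Fin d → ZMod 2) :=
    TensorProduct.CompatibleSMul.of_algebraMap_surjective _ _ (ZMod.intCast_surjective)
  have f : (ZMod 2) ⊗[ℤ] Additive (DimensionFactor (ZMod 2) G i) ≃ₗ[ZMod 2] (Fin d → ZMod 2) :=
    (LinearEquiv.baseChange ℤ (ZMod 2) _ _ E.toIntLinearEquiv) ≪≫ₗ
      (TensorProduct.equivOfCompatibleSMul ℤ (ZMod 2) (ZMod 2) (ZMod 2) (Fin d → ZMod 2)).symm ≪≫ₗ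
      TensorProduct.lid (ZMod 2) (Fin d → ZMod 2)
  rw [dimensionRank, f.finrank_eq, Module.finrank_fin_fun]

/-- The rank of a factor on which independent characters separate the elements. -/
theorem dimensionRank_eq_of_characters {i d : ℕ} (hi : 1 ≤ i)
    (c : Fin d → (Word → Word) → ZMod 2) (hadd : ∀ t, AddOn (series i) (c t))
    (hker : ∀ g ∈ series i, g ∈ series (i + 1) ↔ ∀ t, c t g = 0)
    (hs : ∀ t, ∃ s ∈ series i, ∀ t', c t' s = if t' = t then 1 else 0) :
    dimensionRank (ZMod 2) Gt i = d := by
  have hmem : ∀ g : dimensionSubgroup (ZMod 2) Gt i, (g.1.1 : Equiv.Perm Word) ∈ series i :=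
    fun g => (dimensionSubgroup_Gt hi).le g.2
  let f : dimensionSubgroup (ZMod 2) Gt i →* Multiplicative (Fin d → ZMod 2) :=
    { toFun := fun g => Multiplicative.ofAdd fun t => c t (g.1.1 : Equiv.Perm Word)
      map_one' := congrArg Multiplicative.ofAdd (funext fun t => (hadd t).map_one)
      map_mul' := fun g h =>
        congrArg Multiplicative.ofAdd (funext fun t => hadd t _ (hmem g) _ (hmem h)) }
  have hf : Function.Surjective f := by
    let W : Submodule (ZMod 2) (Fin d → ZMod 2) :=
      { carrier := {w | ∃ g, f g = Multiplicative.ofAdd w}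
        add_mem' := by
          rintro p q ⟨g, hg⟩ ⟨h, hh⟩
          exact ⟨g * h, by rw [map_mul, hg, hh]; rfl⟩
        zero_mem' := ⟨1, map_one f⟩
        smul_mem' := by
          rintro s p ⟨g, hg⟩
          rcases ZMod.eq_zero_or_one s with rfl | rfl
          · exact ⟨1, by rw [zero_smul]; exact map_one f⟩
          · exact ⟨g, by rw [one_smul]; exact hg⟩ }
    have hW : ∀ w, w ∈ W := by
      intro w
      rw [pi_eq_sum_univ w]
      refine Submodule.sum_mem _ fun t _ => Submodule.smul_mem _ _ ?_
      obtain ⟨s, hs, hc⟩ := hs t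
      have hsD : (⟨s, series_le_Gt i hs⟩ : Gt) ∈ dimensionSubgroup (ZMod 2) Gt i := by
        rw [dimensionSubgroup_Gt hi]
        exact hs
      refine ⟨⟨⟨s, series_le_Gt i hs⟩, hsD⟩, ?_⟩
      refine congrArg Multiplicative.ofAdd (funext fun t' => ?_)
      rw [hc]
      simp only [eq_comm]
    exact fun w => hW w.toAdd
  have hkerf : (dimensionSubgroup (ZMod 2) Gt (i + 1)).subgroupOf
      (dimensionSubgroup (ZMod 2) Gt i) = f.ker := by
    ext g
    have h1 : g ∈ f.ker ↔ ∀ t, c t (g.1.1 : Equiv.Perm Word) = 0 := by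
      rw [MonoidHom.mem_ker]
      exact ⟨fun h t => congrFun (congrArg Multiplicative.toAdd h) t, fun h =>
        congrArg Multiplicative.ofAdd (funext h)⟩
    rw [h1, Subgroup.mem_subgroupOf, dimensionSubgroup_Gt (by omega), ← hker _ (hmem g)]
    rfl
  exact dimensionRank_eq_of_mulEquiv
    ((QuotientGroup.quotientMulEquivOfEq hkerf).trans
      (QuotientGroup.quotientKerEquivOfSurjective f hf))

theorem exists_pow_mul_of_mem_sup {Q : Subgroup (Equiv.Perm Word)} (hQ : ConjInv Q)
    {s : Option Label} {u : Equiv.Perm Word} (hu : u ∈ Q ⊔ Subgroup.closure {gen s}) :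
    ∃ i : ℕ, ∃ n ∈ Q, u = gen s ^ i * n := by
  have hsq : gen s * gen s = 1 := by
    cases s
    exacts [a_mul_self, dir_mul_self _]
  rcases Subgroup.mem_or_inv_mul_mem_of_mem_sup_closure_singleton
    (hQ.conj_mem (gen_mem s)) (by rw [hsq]; exact Q.one_mem) hu with h | h
  · exact ⟨0, u, h, by simp⟩
  · exact ⟨1, _, h, by simp⟩

theorem exists_mul_of_mem_Gt {g : Equiv.Perm Word} (hg : g ∈ Gt) : ∃ i j k l : ℕ, ∃ n ∈ Mt,
    g = gen none ^ i * (gen (some .b) ^ j * (gen (some .c) ^ k * (gen (some .d) ^ l * n))) := by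
  obtain ⟨A, hA⟩ : ∃ A, A = Mt ⊔ Subgroup.closure {gen (some .d)} := ⟨_, rfl⟩
  obtain ⟨B, hB⟩ : ∃ B, B = A ⊔ Subgroup.closure {gen (some .c)} := ⟨_, rfl⟩
  obtain ⟨C, hC⟩ : ∃ C, C = B ⊔ Subgroup.closure {gen (some .b)} := ⟨_, rfl⟩
  obtain ⟨D, hD⟩ : ∃ D, D = C ⊔ Subgroup.closure {gen none} := ⟨_, rfl⟩
  have leA : Mt ≤ A := hA ▸ le_sup_left
  have leB : A ≤ B := hB ▸ le_sup_left
  have leC : B ≤ C := hC ▸ le_sup_left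
  have leD : C ≤ D := hD ▸ le_sup_left
  have cA : ConjInv A :=
    hA ▸ conjInv_Mt.sup_closure_singleton fun s => comm_mem_Mt s (gen_mem _)
  have cB : ConjInv B :=
    hB ▸ cA.sup_closure_singleton fun s => leA (comm_mem_Mt s (gen_mem _))
  have cC : ConjInv C :=
    hC ▸ cB.sup_closure_singleton fun s => leB (leA (comm_mem_Mt s (gen_mem _)))
  have mem (Q : Subgroup (Equiv.Perm Word)) (u) : u ∈ Q ⊔ Subgroup.closure {u} :=
    Subgroup.mem_sup_right (Subgroup.mem_closure_singleton_self u)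
  have hgen : ∀ s, gen s ∈ D := by
    rintro (_ | _ | _ | _)
    · exact hD ▸ mem C _
    · exact leD (hC ▸ mem B _)
    · exact leD (leC (hB ▸ mem A _))
    · exact leD (leC (leB (hA ▸ mem Mt _)))
  have hall : Gt ≤ D := by
    rw [Gt_eq, Subgroup.closure_le]
    rintro _ ⟨s, rfl⟩
    exact hgen s
  obtain ⟨i, u, hu, rfl⟩ := exists_pow_mul_of_mem_sup cC (hD ▸ hall hg)
  obtain ⟨j, u, hu', rfl⟩ := exists_pow_mul_of_mem_sup cB (hC ▸ hu)
  obtain ⟨k, u, hu'', rfl⟩ := exists_pow_mul_of_mem_sup cA (hB ▸ hu')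
  obtain ⟨l, n, hn, rfl⟩ := exists_pow_mul_of_mem_sup conjInv_Mt (hA ▸ hu'')
  exact ⟨i, j, k, l, n, hn, rfl⟩

theorem addOn_eps (l : ℕ) : AddOn Gt (eps l) := fun _ hg _ hh => eps_mul l hg hh

theorem eps_a : eps 0 a = 1 ∧ eps 1 a = 0 ∧ eps 2 a = 0 ∧ eps 3 a = 0 :=
  ⟨eps_zero_a, eps_succ_a 0, eps_succ_a 1, eps_succ_a 2⟩

/-- The four parities are dual to the generators `a`, `b̃`, `d̃`, `c̃`, which are involutions
generating `G̃` modulo `M̃`, so vanishing parities make all exponents even. -/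
theorem mem_Mt_of_eps {g : Equiv.Perm Word} (hg : g ∈ Gt) (h0 : eps 0 g = 0) (h1 : eps 1 g = 0)
    (h2 : eps 2 g = 0) (h3 : eps 3 g = 0) : g ∈ Mt := by
  obtain ⟨i, j, k, l, n, hn, rfl⟩ := exists_mul_of_mem_Gt hg
  rw [show gen none = a from rfl, show gen (some .b) = bt from rfl,
    show gen (some .c) = ct from rfl, show gen (some .d) = dt from rfl] at *
  have hb : bt ∈ Gt := dir_mem .b
  have hc : ct ∈ Gt := dir_mem .c
  have hd : dt ∈ Gt := dir_mem .d
  have hnG := Mt_le_Gt hn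
  have key : ∀ t, eps t (a ^ i * (bt ^ j * (ct ^ k * (dt ^ l * n))) : Equiv.Perm Word) =
      i * eps t a + (j * eps t bt + (k * eps t ct + l * eps t dt)) := by
    intro t
    have hadd := addOn_eps t
    have m1 := Gt.mul_mem (Gt.pow_mem hd l) hnG
    have m2 := Gt.mul_mem (Gt.pow_mem hc k) m1
    have m3 := Gt.mul_mem (Gt.pow_mem hb j) m2
    rw [hadd _ (Gt.pow_mem a_mem i) _ m3, hadd _ (Gt.pow_mem hb j) _ m2,
      hadd _ (Gt.pow_mem hc k) _ m1, hadd _ (Gt.pow_mem hd l) _ hnG, eps_eq_zero_of_mem_Mt hn,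
      hadd.map_pow a_mem, hadd.map_pow hb, hadd.map_pow hc, hadd.map_pow hd, add_zero]
  have eb := eps_b
  have ec := eps_c
  have ed := eps_d
  rw [dir_b] at eb
  rw [dir_c] at ec
  rw [dir_d] at ed
  rw [key] at h0 h1 h2 h3
  simp only [eps_a.1, eb.1, ec.1, ed.1, mul_one, mul_zero, add_zero] at h0
  simp only [eps_a.2.1, eb.2.1, ec.2.1, ed.2.1, mul_one, mul_zero, add_zero, zero_add] at h1
  simp only [eps_a.2.2.1, eb.2.2.1, ec.2.2.1, ed.2.2.1, mul_one, mul_zero, zero_add] at h2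
  simp only [eps_a.2.2.2, eb.2.2.2, ec.2.2.2, ed.2.2.2, mul_one, mul_zero, add_zero,
    zero_add] at h3
  have hsq : ∀ s, gen s * gen s ∈ Mt := by
    rintro (_ | l)
    · exact a_mul_self.symm ▸ Mt.one_mem
    · exact (dir_mul_self l).symm ▸ Mt.one_mem
  exact Mt.mul_mem (pow_mem_of_cast_eq_zero (hsq none) h0)
    (Mt.mul_mem (pow_mem_of_cast_eq_zero (hsq (some .b)) h1)
      (Mt.mul_mem (pow_mem_of_cast_eq_zero (hsq (some .c)) h3)
        (Mt.mul_mem (pow_mem_of_cast_eq_zero (hsq (some .d)) h2) hn)))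

theorem dimensionRank_one : dimensionRank (ZMod 2) Gt 1 = 4 := by
  refine dimensionRank_eq_of_characters le_rfl (fun t : Fin 4 => eps t)
    (fun t => addOn_eps t) (fun g hg => ?_) ?_
  · rw [Fin.forall_fin_succ, Fin.forall_fin_succ, Fin.forall_fin_succ, Fin.forall_fin_one]
    exact ⟨fun h => ⟨eps_eq_zero_of_mem_Mt h 0, eps_eq_zero_of_mem_Mt h 1,
      eps_eq_zero_of_mem_Mt h 2, eps_eq_zero_of_mem_Mt h 3⟩,
      fun ⟨h0, h1, h2, h3⟩ => mem_Mt_of_eps hg h0 h1 h2 h3⟩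
  · intro t
    fin_cases t
    · exact ⟨_, a_mem, fun t' => by fin_cases t' <;> simp [eps_a]⟩
    · exact ⟨_, dir_mem .b, fun t' => by fin_cases t' <;> simp [eps_b]⟩
    · exact ⟨_, dir_mem .d, fun t' => by fin_cases t' <;> simp [eps_d]⟩
    · exact ⟨_, dir_mem .c, fun t' => by fin_cases t' <;> simp [eps_c]⟩

theorem dimensionRank_two : dimensionRank (ZMod 2) Gt 2 = 3 := by
  refine dimensionRank_eq_of_characters one_le_two (fun t : Fin 3 => chi t)
    (fun t => addOn_chi t) (fun g hg => ?_) ?_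
  · rw [Fin.forall_fin_succ, Fin.forall_fin_succ, Fin.forall_fin_one, series_three]
    exact ⟨fun h => ⟨chi_of_mem_Nt_one h 0, chi_of_mem_Nt_one h 1, chi_of_mem_Nt_one h 2⟩,
      fun ⟨h0, h1, h2⟩ => mem_Nt_one_of_chi hg h0 h1 h2⟩
  · intro t
    fin_cases t
    · exact ⟨_, Kt_le_Mt x_mem_Kt, fun t' => by fin_cases t' <;> simp [chi_x]⟩
    · exact ⟨_, Kt_le_Mt y_mem_Kt, fun t' => by fin_cases t' <;> simp [chi_y]⟩
    · exact ⟨_, z_mem_Mt, fun t' => by fin_cases t' <;> simp [chi_z]⟩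

theorem addOn_coef_layer (k r : ℕ) (p : U (k + 1) × U (k + 1) × U k →ₗ[ZMod 2] ZMod 2) :
    AddOn (layerSub k r) fun f => p (layer k f) := by
  intro g hg h hh
  change p (layer k (g * h : Equiv.Perm Word)) = _
  rw [layer_mul hg.1 hh.1, map_add]

/-- The first two components lose one dimension at every step, the third only when `(r + 1) / 2 > r
/ 2`, that is, for odd `r`; the weight `2 ^ (k + 1) + 1 + r` is then even. -/
theorem dimensionRank_layer {k r : ℕ} (hr : r < 2 ^ (k + 1)) :
    dimensionRank (ZMod 2) Gt (2 ^ (k + 1) + 1 + r) = if Odd r then 3 else 2 := by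
  have hr2 : r / 2 < 2 ^ k := by rw [pow_succ] at hr; omega
  let p0 : U (k + 1) × U (k + 1) × U k →ₗ[ZMod 2] ZMod 2 := coef (k + 1) r ∘ₗ LinearMap.fst _ _ _
  let p1 : U (k + 1) × U (k + 1) × U k →ₗ[ZMod 2] ZMod 2 :=
    coef (k + 1) r ∘ₗ LinearMap.fst _ _ _ ∘ₗ LinearMap.snd _ _ _
  let p2 : U (k + 1) × U (k + 1) × U k →ₗ[ZMod 2] ZMod 2 :=
    coef k (r / 2) ∘ₗ LinearMap.snd _ _ _ ∘ₗ LinearMap.snd _ _ _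
  have hp0 : ∀ t, p0 t = coef (k + 1) r t.1 := fun _ => rfl
  have hp1 : ∀ t, p1 t = coef (k + 1) r t.2.1 := fun _ => rfl
  have hp2 : ∀ t, p2 t = coef k (r / 2) t.2.2 := fun _ => rfl
  have hmem : ∀ g ∈ layerSub k r, g ∈ layerSub k (r + 1) ↔
      p0 (layer k g) = 0 ∧ p1 (layer k g) = 0 ∧ (Odd r → p2 (layer k g) = 0) := by
    rintro g ⟨hg, h0, h1, h2⟩
    rw [mem_layerSub, mem_Usub_succ, mem_Usub_succ, hp0, hp1, hp2]
    have h3 : (layer k g).2.2 ∈ Usub k ((r + 1) / 2) ↔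
        (Odd r → coef k (r / 2) (layer k g).2.2 = 0) := by
      rcases Nat.even_or_odd r with hr | hr
      · have e : (r + 1) / 2 = r / 2 := by obtain ⟨i, rfl⟩ := hr; omega
        rw [e]
        exact ⟨fun _ ho => absurd hr (Nat.not_even_iff_odd.2 ho), fun _ => h2⟩
      · have e : (r + 1) / 2 = r / 2 + 1 := by obtain ⟨i, rfl⟩ := hr; omega
        rw [e, mem_Usub_succ]
        exact ⟨fun h _ => h.2, fun h => ⟨h2, h hr⟩⟩
    rw [h3]
    tauto
  have e0 : coef (k + 1) r (basisU (k + 1) r) = 1 := by rw [coef_basisU _ r hr, if_pos rfl]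
  have e2 : coef k (r / 2) (basisU k (r / 2)) = 1 := by rw [coef_basisU _ _ hr2, if_pos rfl]
  have hx := spread_x_mem_layerSub (basisU_mem hr le_rfl)
  have hy := spread_y_mem_layerSub (basisU_mem hr le_rfl)
  have hs : spread (x * x) k (basisU k (r / 2)) ∈ layerSub k r :=
    spread_sq_mem_layerSub (basisU_mem hr2 le_rfl)
  have hlx := layer_spread_x k (basisU (k + 1) r)
  have hly := layer_spread_y k (basisU (k + 1) r)
  have hls := layer_spread_sq k (basisU k (r / 2))
  split_ifs with hodd
  · refine dimensionRank_eq_of_characters (by omega)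
      (fun t f => (![p0, p1, p2] : Fin 3 → _) t (layer k f)) (fun t => ?_) (fun g hg => ?_) ?_
    · rw [series_layer hr.le]
      exact addOn_coef_layer k r _
    · rw [series_layer hr.le] at hg
      rw [add_assoc _ r 1, series_layer hr, hmem g hg, Fin.forall_fin_succ, Fin.forall_fin_succ,
        Fin.forall_fin_one]
      exact ⟨fun h => ⟨h.1, h.2.1, h.2.2 hodd⟩, fun h => ⟨h.1, h.2.1, fun _ => h.2.2⟩⟩
    · rw [series_layer hr.le]
      intro t
      fin_cases t
      · exact ⟨_, hx, fun t' => by fin_cases t' <;> simp [hlx, hp0, hp1, hp2, e0]⟩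
      · exact ⟨_, hy, fun t' => by fin_cases t' <;> simp [hly, hp0, hp1, hp2, e0]⟩
      · exact ⟨_, hs, fun t' => by fin_cases t' <;> simp [hls, hp0, hp1, hp2, e2]⟩
  · refine dimensionRank_eq_of_characters (by omega)
      (fun t f => (![p0, p1] : Fin 2 → _) t (layer k f)) (fun t => ?_) (fun g hg => ?_) ?_
    · rw [series_layer hr.le]
      exact addOn_coef_layer k r _
    · rw [series_layer hr.le] at hg
      rw [add_assoc _ r 1, series_layer hr, hmem g hg, Fin.forall_fin_succ, Fin.forall_fin_one]
      exact ⟨fun h => ⟨h.1, h.2.1⟩, fun h => ⟨h.1, h.2, fun ho => absurd ho hodd⟩⟩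
    · rw [series_layer hr.le]
      intro t
      fin_cases t
      · exact ⟨_, hx, fun t' => by fin_cases t' <;> simp [hlx, hp0, hp1, e0]⟩
      · exact ⟨_, hy, fun t' => by fin_cases t' <;> simp [hly, hp0, hp1, e0]⟩

end Overgroup

/-! ### The main theorem -/

theorem mainTheorem3 :
    (∀ m : ℕ, 1 ≤ m → Overgroup.dimGt (2 ^ m + 1) = Overgroup.Nt m) ∧
    (∀ m : ℕ, 1 ≤ m →
      (∃! φ : Overgroup.Nt m →* Multiplicative
          (Overgroup.V m × Overgroup.V m × Overgroup.V (m - 1)), Overgroup.IsLayerIso m φ) ∧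
      ∀ φ : Overgroup.Nt m →* Multiplicative
          (Overgroup.V m × Overgroup.V m × Overgroup.V (m - 1)), Overgroup.IsLayerIso m φ →
        ∀ r : ℕ, r ≤ 2 ^ m →
          Overgroup.dimGt (2 ^ m + 1 + r) =
            Overgroup.layerPreimage φ (Overgroup.Vsub m r) (Overgroup.Vsub m r)
              (Overgroup.Vsub (m - 1) (if Even r then r / 2 else (r - 1) / 2))) ∧
    (∀ i : ℕ, 1 ≤ i →
      dimensionRank (ZMod 2) Overgroup.Gt i =
        if i = 1 then 4 else if Even i then 3 else 2) := by
  refine ⟨fun m hm => ?_, fun m hm => ?_, fun i hi => ?_⟩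
  · obtain ⟨k, rfl⟩ : ∃ k, m = k + 1 := ⟨m - 1, by omega⟩
    rw [Overgroup.dimGt_eq (Nat.le_add_left _ _), Overgroup.series_pow, Overgroup.Nt_succ k]
  · obtain ⟨k, rfl⟩ : ∃ k, m = k + 1 := ⟨m - 1, by omega⟩
    refine ⟨⟨Overgroup.layerHom k, Overgroup.isLayerIso_layerHom k,
      fun φ hφ => Overgroup.IsLayerIso.eq_layerHom hφ⟩, fun φ hφ r hr => ?_⟩
    -- Rounding down covers both parities of `r`.
    have hr2 : (if Even r then r / 2 else (r - 1) / 2) = r / 2 := by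
      split_ifs with h
      · rfl
      · rw [Nat.not_even_iff] at h
        omega
    rw [hφ.eq_layerHom, hr2, Overgroup.layerPreimage_layerHom, Overgroup.dimGt_eq (Nat.le_add_right_of_le (Nat.le_add_left _ _)),
      Overgroup.series_layer hr]
  · induction i using Overgroup.series_cases with
    | h0 => omega
    | h1 => exact Overgroup.dimensionRank_one
    | h2 => exact Overgroup.dimensionRank_two
    | h k r hr =>
      have h2 := Nat.one_le_two_pow (n := k)
      have he : Even (2 ^ (k + 1)) := by rw [pow_succ]; exact even_two.mul_left _
      have hpar : Even (2 ^ (k + 1) + 1 + r) ↔ Odd r := by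
        rw [Nat.even_iff] at *
        rw [Nat.odd_iff]
        omega
      have h1 : 2 ^ (k + 1) + 1 + r ≠ 1 := by rw [pow_succ]; omega
      rw [Overgroup.dimensionRank_layer hr, if_neg h1]
      simp only [hpar]
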